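/- Let $1<p<\infty$, $\alpha\in\mathbb{R}$ and $I=(-1,1)$. For $V\in C(\bar I)$ consider the Robin eigenvalue problem for the $p$-Laplacian, $$-(|u'|^{p-2}u')'+V|u|^{p-2}u=\lambda|u|^{p-2}u \ \text{ on } I,\qquad |u'|^{p-2}u'=\mp\alpha|u|^{p-2}u \ \text{ at } x=\pm1,$$ with Rayleigh quotient, for $u\in W^{1,p}(I)\setminus\{0\}$, $$\mathcal{R}_V[u]=\frac{\int_I \big(|u'|^p+V|u|^p\big)\,dx+\alpha\big(|u(1)|^p+|u(-1)|^p\big)}{\int_I|u|^p\,dx},$$ and the Ljusternik--Schnirelmann eigenvalues $$\lambda_i^V=\inf_{A\in\Sigma_i}\ \max_{u\in A}\mathcal{R}_V[u],\qquad i=0,1,2,\dots,$$ where $\Sigma_i$ is the family of all compact sets $A=-A\subset W^{1,p}(I)\setminus\{0\}$ whose Krasnoselskii genus (the least $n$ for which there is an odd continuous map $A\to\mathbb{R}^n\setminus\{0\}$, or $\infty$ if there is none) is at least $i+1$. Let $\Gamma_p(V)=\lambda_1^V-\lambda_0^V$ be the fundamental gap. Then for every $V\in C(\bar I)$ that is convex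 and not affine on $\bar I$, there exists $a\in\mathbb{R}$ such that $$\Gamma_p(V)>\Gamma_p(V_a),\qquad V_a(x)=ax.$$ -/

import Mathlib

noncomputable section

open Set MeasureTheory

namespace RobinGap

/-- Lebesgue measure on the open interval `I = (-1, 1)`. -/
abbrev μI : Measure ℝ := volume.restrict (Ioo (-1) 1)

/-- The closed interval `[-1, 1]`, the closure of `I`. -/
abbrev Ibar : Type := Icc (-1 : ℝ) 1

/-- The left end point `-1` of `I`. -/
def leftEnd : Ibar := ⟨-1, by norm_num, by norm_num⟩

instance factOneLe (p : ℝ) [hp : Fact (1 < p)] : Fact (1 ≤ ENNReal.ofReal p) :=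
  ⟨by simpa using ENNReal.ofReal_le_ofReal hp.out.le⟩

theorem intervalIntegrable_of_Lp {p : ℝ} [Fact (1 < p)] (g : Lp ℝ (ENNReal.ofReal p) μI)
    (x : Ibar) : IntervalIntegrable g volume (-1) x := by
  have h : IntegrableOn g (Ioo (-1) 1) volume := (Lp.memLp g).integrable Fact.out
  rw [intervalIntegrable_iff_integrableOn_Ioo_of_le x.2.1]
  exact h.mono_set (Ioo_subset_Ioo_right x.2.2)

theorem intervalIntegral_congr_of_ae {f g : ℝ → ℝ} (h : f =ᵐ[μI] g) (x : Ibar) :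
    ∫ t in (-1 : ℝ)..x, f t = ∫ t in (-1 : ℝ)..x, g t := by
  rw [intervalIntegral.integral_of_le x.2.1, intervalIntegral.integral_of_le x.2.1,
    integral_Ioc_eq_integral_Ioo, integral_Ioc_eq_integral_Ioo]
  exact integral_congr_ae (ae_mono (Measure.restrict_mono (Ioo_subset_Ioo_right x.2.2) le_rfl) h)

/-- The one-dimensional Sobolev space `W^{1,p}(I)`, in its description by absolutely continuous
representatives: a pair `(u, u')` where `u ∈ C([-1, 1])`, `u' ∈ L^p(I)` and `u` is the integral of
`u'`. The inherited norm `max ‖u‖_∞ ‖u'‖_p` is equivalent to the usual norm of `W^{1,p}(I)`. -/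
def W1p (p : ℝ) [Fact (1 < p)] : Submodule ℝ (C(Ibar, ℝ) × Lp ℝ (ENNReal.ofReal p) μI) where
  carrier := {w | ∀ x : Ibar, w.1 x = w.1 leftEnd + ∫ t in (-1 : ℝ)..x, w.2 t}
  zero_mem' := by
    intro x
    have h := intervalIntegral_congr_of_ae (Lp.coeFn_zero ℝ (ENNReal.ofReal p) μI) x
    simp only [Prod.fst_zero, Prod.snd_zero, ContinuousMap.zero_apply, zero_add]
    rw [h]
    simp
  add_mem' := by
    intro v w hv hw x
    have h := intervalIntegral_congr_of_ae (Lp.coeFn_add v.2 w.2) x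
    simp only [Prod.fst_add, Prod.snd_add, ContinuousMap.add_apply]
    rw [h, hv x, hw x]
    simp only [Pi.add_apply]
    rw [intervalIntegral.integral_add (intervalIntegrable_of_Lp v.2 x)
      (intervalIntegrable_of_Lp w.2 x)]
    ring
  smul_mem' := by
    intro c w hw x
    have h := intervalIntegral_congr_of_ae (Lp.coeFn_smul c w.2) x
    simp only [Prod.smul_fst, Prod.smul_snd, ContinuousMap.smul_apply, smul_eq_mul]
    rw [h, hw x]
    simp only [Pi.smul_apply, smul_eq_mul]
    rw [intervalIntegral.integral_const_mul]
    ring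

/-- The continuous representative of `u ∈ W^{1,p}(I)` on `[-1, 1]`, as a function on `ℝ` (constant
on either side of `[-1, 1]`). -/
def evalAt {p : ℝ} [Fact (1 < p)] (u : W1p p) : ℝ → ℝ :=
  IccExtend (by norm_num : (-1 : ℝ) ≤ 1) u.1.1

/-- The weak derivative of `u ∈ W^{1,p}(I)`. -/
def weakDeriv {p : ℝ} [Fact (1 < p)] (u : W1p p) : ℝ → ℝ := u.1.2

/-- The Rayleigh quotient of `-Δ_p + V |·|^{p-2} ·` with Robin parameter `α`. -/
def rayleigh (p : ℝ) [Fact (1 < p)] (α : ℝ) (V : ℝ → ℝ) (u : W1p p) : ℝ :=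
  ((∫ x in Ioo (-1 : ℝ) 1, (|weakDeriv u x| ^ p + V x * |evalAt u x| ^ p))
      + α * (|evalAt u 1| ^ p + |evalAt u (-1)| ^ p))
    / ∫ x in Ioo (-1 : ℝ) 1, |evalAt u x| ^ p

/-- There is an odd continuous map from the symmetric set `A` to `ℝ^n ∖ {0}`. -/
def HasOddMap {E : Type*} [TopologicalSpace E] [Neg E] (A : Set E) (n : ℕ) : Prop :=
  ∃ f : E → EuclideanSpace ℝ (Fin n),
    ContinuousOn f A ∧ (∀ u ∈ A, f (-u) = -f u) ∧ ∀ u ∈ A, f u ≠ 0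

/-- The Krasnoselskii genus of a symmetric set: the least `n` for which there is an odd continuous
map to `ℝ^n ∖ {0}`, and `⊤` if there is none; the empty set has genus `0`. -/
def genus {E : Type*} [TopologicalSpace E] [Neg E] (A : Set E) : ℕ∞ :=
  ⨅ (n : ℕ) (_ : HasOddMap A n), (n : ℕ∞)

/-- The Ljusternik-Schnirelmann class of level `i`, `i = 0, 1, …`: compact symmetric subsets of
`W^{1,p}(I) ∖ {0}` of genus at least `i + 1`. -/
def LSClass (p : ℝ) [Fact (1 < p)] (i : ℕ) : Set (Set (W1p p)) :=
  {A | IsCompact A ∧ (∀ u ∈ A, -u ∈ A) ∧ 0 ∉ A ∧ ((i + 1 : ℕ) : ℕ∞) ≤ genus A}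

/-- The eigenvalue `λ_i = inf_{A} max_{u ∈ A} R[u]`, `i = 0, 1, …`, the infimum over the
Ljusternik-Schnirelmann class of level `i`, of the Robin problem
`-Δ_p u + V |u|^{p-2} u = λ |u|^{p-2} u` on `I`,
`|u'|^{p-2} u' = ∓ α |u|^{p-2} u` at `±1`. -/
def eigenvalue (p : ℝ) [Fact (1 < p)] (α : ℝ) (V : ℝ → ℝ) (i : ℕ) : ℝ :=
  sInf {m : ℝ | ∃ A ∈ LSClass p i, IsGreatest (rayleigh p α V '' A) m}

/-- The fundamental gap `Γ_p(V) = λ_1 - λ_0`. -/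
def gap (p : ℝ) [Fact (1 < p)] (α : ℝ) (V : ℝ → ℝ) : ℝ :=
  eigenvalue p α V 1 - eigenvalue p α V 0

end RobinGap

end

open Set MeasureTheory Filter Topology
open scoped NNReal

namespace RobinGap

/-! ### Elementary one-variable calculus -/

/-! For a solution `u`, the quotient `r = |u'|^(p-2) u' / (|u|^(p-2) u)` satisfies the Riccati
equation `r' = V - l - (p-1)|r|^q`, with `q` conjugate to `p`, and the Robin conditions become
`r(-1) = α`, `r(1) = -α`. Shooting in a Prüfer-type angle gives levels `l₀ < l₁` whose solutions
have no pole and one pole `c`, respectively (`exists_riccati`). Integrating `r` recovers a positive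
`v` at level `l₀` and the nodal pieces `f` on `[c, 1]`, `g` on `[-1, c]` at level `l₁`. Picone's
inequality (`picone`) turns Riccati solutions and subsolutions into lower bounds for the energy;
`v`, `f`, `g` serve as test functions for upper bounds. For the second eigenvalue, every set of
genus at least two contains a function vanishing at `c`.

The core is `exists_gap_lt`. Choose an affine `κ x + m` such that `d = V - κ x - m` is orthogonal to
`f^p` and to `g^p`. Then `d` is convex with a zero on each side of the node: nonpositive between the
zeros, nonnegative outside. Riccati comparison makes `f / v` increasing and `g / v` decreasing, so
passing to the weight `v^p` favours the middle region, and `∫ d v^p < 0`, strictly because `V` is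
not affine. Along `V - s d` the second eigenvalue cannot rise, since the nodal pieces keep their
quotient `l₁`, while the first rises to first order in `s` (`exists_subsolution`). Constants do not
affect the gap, so it drops strictly along `(1-s) V + s κ x`.

This descent must end at a linear potential. If the slopes of `V` are bounded by `K`, the gap
attains a minimum over the potentials `t V + a x` with `0 ≤ t ≤ 1` and `|a| ≤ K (1-t)`. A minimum
with `t > 0` is impossible: another descent step stays in this compact set, because `κ` lies between
any lower and upper bounds for the slopes (`exists_gap_linear_le`). For general `V`, one descent
step gives a strict gain, and a dilation `x ↦ ρ x` with `ρ < 1` close to 1 then bounds the slopes at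
the cost of only part of that gain. -/

theorem hasDerivAt_of_eqOn_Iic_Ici {f g h : ℝ → ℝ} {a d : ℝ} (hg : HasDerivAt g d a)
    (hh : HasDerivAt h d a) (hfg : EqOn f g (Iic a)) (hfh : EqOn f h (Ici a)) :
    HasDerivAt f d a := by
  have h1 : HasDerivWithinAt f d (Iic a) a :=
    hg.hasDerivWithinAt.congr hfg (hfg self_mem_Iic)
  have h2 : HasDerivWithinAt f d (Ici a) a :=
    hh.hasDerivWithinAt.congr hfh (hfh self_mem_Ici)
  simpa using h1.union h2

/-- The derivative of `x ↦ x₊ ^ p`, `p > 1`. -/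
theorem hasDerivAt_max_zero_rpow {p : ℝ} (hp : 1 < p) (x : ℝ) :
    HasDerivAt (fun y : ℝ => max y 0 ^ p) (p * max x 0 ^ (p - 1)) x := by
  have h0 : ∀ y ≤ (0 : ℝ), max y 0 ^ p = 0 := fun y hy => by
    rw [max_eq_right hy, Real.zero_rpow (by linarith)]
  rcases lt_trichotomy x 0 with hx | rfl | hx
  · rw [max_eq_right hx.le, Real.zero_rpow (by linarith), mul_zero]
    refine (hasDerivAt_const x (0 : ℝ)).congr_of_eventuallyEq ?_
    filter_upwards [Iio_mem_nhds hx] with y hy using h0 y (le_of_lt hy)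
  · rw [max_self]
    have h1 : HasDerivAt (fun y : ℝ => y ^ p) (p * 0 ^ (p - 1)) 0 :=
      Real.hasDerivAt_rpow_const (Or.inr hp.le)
    rw [Real.zero_rpow (by linarith), mul_zero] at h1 ⊢
    refine hasDerivAt_of_eqOn_Iic_Ici (hasDerivAt_const 0 (0 : ℝ)) h1 (fun y hy => h0 y hy)
      (fun y hy => ?_)
    rw [max_eq_left hy]
  · rw [max_eq_left hx.le]
    refine (Real.hasDerivAt_rpow_const (Or.inl hx.ne')).congr_of_eventuallyEq ?_
    filter_upwards [Ioi_mem_nhds hx] with y hy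
    rw [max_eq_left (le_of_lt hy)]

/-- The signed power `x ↦ sign x * |x| ^ s`. -/
noncomputable def spow (s x : ℝ) : ℝ := max x 0 ^ s - max (-x) 0 ^ s

theorem continuous_spow {s : ℝ} (hs : 0 < s) : Continuous (spow s) := by
  unfold spow
  exact ((continuous_id.max continuous_const).rpow_const fun _ => Or.inr hs.le).sub
    ((continuous_neg.max continuous_const).rpow_const fun _ => Or.inr hs.le)

theorem spow_of_nonneg {s x : ℝ} (hs : 0 < s) (hx : 0 ≤ x) : spow s x = x ^ s := by
  rw [spow, max_eq_left hx, max_eq_right (by linarith : -x ≤ 0), Real.zero_rpow hs.ne', sub_zero]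

theorem spow_neg (s x : ℝ) : spow s (-x) = -spow s x := by
  simp [spow]

theorem abs_spow {s : ℝ} (hs : 0 < s) (x : ℝ) : |spow s x| = |x| ^ s := by
  rcases le_total 0 x with hx | hx
  · rw [spow_of_nonneg hs hx, abs_of_nonneg hx, abs_of_nonneg (Real.rpow_nonneg hx s)]
  · rw [← abs_neg, ← spow_neg, spow_of_nonneg hs (by linarith), abs_of_nonpos hx,
      abs_of_nonneg (Real.rpow_nonneg (by linarith) s)]

theorem mul_spow {s : ℝ} (hs : 0 < s) (x : ℝ) : x * spow s x = |x| ^ (s + 1) := by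
  have key : ∀ y : ℝ, 0 ≤ y → y * spow s y = |y| ^ (s + 1) := fun y hy => by
    rw [spow_of_nonneg hs hy, abs_of_nonneg hy, Real.rpow_add_one' hy (by linarith), mul_comm]
  rcases le_total 0 x with hx | hx
  · exact key x hx
  · have := key (-x) (by linarith)
    rwa [spow_neg, neg_mul_neg, abs_neg] at this

theorem strictMono_spow {s : ℝ} (hs : 0 < s) : StrictMono (spow s) := by
  have key : StrictMonoOn (spow s) (Ici 0) := fun x hx y hy hxy => by
    rw [spow_of_nonneg hs hx, spow_of_nonneg hs hy]
    exact Real.rpow_lt_rpow hx hxy hs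
  refine StrictMonoOn.Iic_union_Ici (a := 0) (fun x hx y hy hxy => ?_) key
  have := key (show (0 : ℝ) ≤ -y by simpa using hy) (show (0 : ℝ) ≤ -x by simpa using hx)
    (by linarith)
  rw [spow_neg, spow_neg] at this
  linarith

theorem abs_rpow_eq_add {s : ℝ} (hs : 0 < s) (x : ℝ) : |x| ^ s = max x 0 ^ s + max (-x) 0 ^ s := by
  rcases le_total 0 x with hx | hx
  · rw [max_eq_left hx, max_eq_right (by linarith : -x ≤ 0), Real.zero_rpow hs.ne', add_zero,
      abs_of_nonneg hx]
  · rw [max_eq_right hx, max_eq_left (by linarith : 0 ≤ -x), Real.zero_rpow hs.ne', zero_add,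
      abs_of_nonpos hx]

theorem hasDerivAt_abs_rpow_spow {q : ℝ} (hq : 1 < q) (x : ℝ) :
    HasDerivAt (fun y : ℝ => |y| ^ q) (q * spow (q - 1) x) x := by
  have h1 := hasDerivAt_max_zero_rpow hq x
  have h2 := (hasDerivAt_max_zero_rpow hq (-x)).comp x (hasDerivAt_neg x)
  have h3 := h1.add h2
  refine (h3.congr_deriv (by rw [spow]; ring)).congr_of_eventuallyEq ?_
  filter_upwards with y
  simpa using abs_rpow_eq_add (by linarith : 0 < q) y

/-- Tangent line inequality for the convex function `|x| ^ q`, with the tangent at the end point. -/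
theorem abs_rpow_sub_le {q : ℝ} (hq : 1 < q) (a b : ℝ) :
    |b| ^ q - |a| ^ q ≤ q * spow (q - 1) b * (b - a) := by
  have hder := hasDerivAt_abs_rpow_spow hq
  have hmono := strictMono_spow (by linarith : 0 < q - 1)
  rcases lt_trichotomy a b with h | rfl | h
  · obtain ⟨c, hc, hc'⟩ := exists_hasDerivAt_eq_slope (fun y : ℝ => |y| ^ q) _ h
      (fun x _ => (hder x).continuousAt.continuousWithinAt) (fun x _ => hder x)
    rw [eq_div_iff (by linarith)] at hc'
    rw [← hc']
    have := hmono.monotone hc.2.le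
    gcongr
  · simp
  · obtain ⟨c, hc, hc'⟩ := exists_hasDerivAt_eq_slope (fun y : ℝ => |y| ^ q) _ h
      (fun x _ => (hder x).continuousAt.continuousWithinAt) (fun x _ => hder x)
    rw [eq_div_iff (by linarith)] at hc'
    have := hmono.monotone hc.1.le
    have h2 : q * spow (q - 1) b * (a - b) ≤ q * spow (q - 1) c * (a - b) := by
      gcongr
    nlinarith

/-- Young's inequality in the form used in Picone's argument. -/
theorem mul_rpow_le_add {p q : ℝ} (hpq : p.HolderConjugate q) (r t : ℝ) {h : ℝ} (hh : 0 ≤ h) :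
    p * (|r| * h ^ (p - 1) * |t|) ≤ |t| ^ p + (p - 1) * |r| ^ q * h ^ p := by
  have h1 := Real.young_inequality_of_nonneg (abs_nonneg t)
    (mul_nonneg (abs_nonneg r) (Real.rpow_nonneg hh (p - 1))) hpq
  rw [Real.mul_rpow (abs_nonneg r) (Real.rpow_nonneg hh _), ← Real.rpow_mul hh,
    hpq.sub_one_mul_conj] at h1
  have hp := hpq.pos
  have h2 : p / q = p - 1 := by
    rw [hpq.conjugate_eq]
    have := hpq.sub_one_pos
    field_simp
  calc p * (|r| * h ^ (p - 1) * |t|) = p * (|t| * (|r| * h ^ (p - 1))) := by ring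
    _ ≤ p * (|t| ^ p / p + |r| ^ q * h ^ p / q) := by gcongr
    _ = |t| ^ p + p / q * |r| ^ q * h ^ p := by field_simp
    _ = _ := by rw [h2]

/-- A function whose derivative is negative at each of its zeros stays negative once it is
nonpositive. -/
theorem neg_of_deriv_neg_at_zeros {z z' : ℝ → ℝ} {a b : ℝ}
    (hz : ∀ x ∈ Icc a b, HasDerivAt z (z' x) x) (hneg : ∀ x ∈ Icc a b, z x = 0 → z' x < 0)
    (ha : z a ≤ 0) {x : ℝ} (hx : x ∈ Ioc a b) : z x < 0 := by
  have hle : ∀ ⦃y⦄, y ∈ Icc a b → z y ≤ 0 :=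
    image_le_of_deriv_right_lt_deriv_boundary' (B := fun _ => 0) (B' := fun _ => 0)
      (fun y hy => (hz y hy).continuousAt.continuousWithinAt)
      (fun y hy => (hz y (Ico_subset_Icc_self hy)).hasDerivWithinAt) ha continuousOn_const
      (fun y _ => hasDerivWithinAt_const _ _ _) (fun y hy => hneg y (Ico_subset_Icc_self hy))
  -- If `z x = 0`, the negative derivative at `x` would make `z` positive just to the left of `x`.
  refine (hle ⟨hx.1.le, hx.2⟩).lt_of_ne fun h0 => ?_
  have hd := hz x ⟨hx.1.le, hx.2⟩
  have hlt := hneg x ⟨hx.1.le, hx.2⟩ h0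
  have hev := (hd.tendsto_slope.mono_left (nhdsLT_le_nhdsNE x)).eventually (gt_mem_nhds hlt)
  have hev2 : ∀ᶠ y in 𝓝[<] x, a < y := mem_nhdsWithin_of_mem_nhds (Ioi_mem_nhds hx.1)
  obtain ⟨y, ⟨hy, hay⟩, hyx⟩ := ((hev.and hev2).and self_mem_nhdsWithin).exists
  have hyx' : y < x := hyx
  rw [slope_def_field, h0] at hy
  have := hle ⟨hay.le, hyx'.le.trans hx.2⟩
  rw [div_neg_iff] at hy
  rcases hy with hy | hy <;> linarith

/-! ### Absolutely continuous functions -/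

/-- This form covers composites `G ∘ u` where `G` is Lipschitz only on a bounded set containing the
range of `u`. -/
theorem absolutelyContinuousOnInterval_of_dist_le {f g : ℝ → ℝ} {a b K : ℝ}
    (hf : AbsolutelyContinuousOnInterval f a b)
    (hK : ∀ x ∈ uIcc a b, ∀ y ∈ uIcc a b, dist (g x) (g y) ≤ K * dist (f x) (f y)) :
    AbsolutelyContinuousOnInterval g a b := by
  have h1 : Tendsto (fun E : ℕ × (ℕ → ℝ × ℝ) =>
      K * ∑ i ∈ Finset.range E.1, dist (f (E.2 i).1) (f (E.2 i).2))
      (AbsolutelyContinuousOnInterval.totalLengthFilter ⊓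
        𝓟 (AbsolutelyContinuousOnInterval.disjWithin a b)) (𝓝 0) := by
    simpa using Tendsto.const_mul K hf
  refine squeeze_zero' (Eventually.of_forall fun E => Finset.sum_nonneg fun _ _ => dist_nonneg)
    ?_ h1
  filter_upwards [mem_inf_of_right (mem_principal_self _)] with E hE
  rw [Finset.mul_sum]
  exact Finset.sum_le_sum fun i hi => hK _ (hE.1 i hi).1 _ (hE.1 i hi).2

/-! ### The space `W1p` -/

section W1p

variable {p : ℝ} [Fact (1 < p)]

theorem continuous_evalAt (u : W1p p) : Continuous (evalAt u) :=
  u.1.1.continuous.Icc_extend'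

theorem evalAt_of_mem (u : W1p p) {x : ℝ} (hx : x ∈ Icc (-1 : ℝ) 1) :
    evalAt u x = u.1.1 ⟨x, hx⟩ :=
  IccExtend_of_mem _ _ hx

theorem evalAt_eq_add_integral (u : W1p p) {x : ℝ} (hx : x ∈ Icc (-1 : ℝ) 1) :
    evalAt u x = evalAt u (-1) + ∫ t in (-1 : ℝ)..x, weakDeriv u t := by
  rw [evalAt_of_mem u hx, evalAt_of_mem u (by norm_num)]
  exact u.2 ⟨x, hx⟩

theorem intervalIntegrable_weakDeriv (u : W1p p) :
    IntervalIntegrable (weakDeriv u) volume (-1) 1 :=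
  intervalIntegrable_of_Lp u.1.2 ⟨1, by norm_num, le_rfl⟩

theorem ae_hasDerivAt_evalAt (u : W1p p) :
    ∀ᵐ x, x ∈ Ioo (-1 : ℝ) 1 → HasDerivAt (evalAt u) (weakDeriv u x) x := by
  filter_upwards [(intervalIntegrable_weakDeriv u).ae_hasDerivAt_integral] with x hx hxI
  rw [uIcc_of_le (by norm_num)] at hx
  have h := hx (Ioo_subset_Icc_self hxI) (-1) (by norm_num)
  refine (h.const_add (evalAt u (-1))).congr_of_eventuallyEq ?_
  filter_upwards [Ioo_mem_nhds hxI.1 hxI.2] with y hy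
  exact evalAt_eq_add_integral u (Ioo_subset_Icc_self hy)

theorem absolutelyContinuousOnInterval_evalAt (u : W1p p) :
    AbsolutelyContinuousOnInterval (evalAt u) (-1) 1 := by
  refine absolutelyContinuousOnInterval_of_dist_le (K := 1)
    ((intervalIntegrable_weakDeriv u).absolutelyContinuousOnInterval_intervalIntegral
      (c := -1) (by simp)) fun x hx y hy => ?_
  rw [uIcc_of_le (by norm_num)] at hx hy
  rw [evalAt_eq_add_integral u hx, evalAt_eq_add_integral u hy, dist_add_left, one_mul]

theorem integrableOn_abs_weakDeriv_rpow (u : W1p p) :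
    IntegrableOn (fun x => |weakDeriv u x| ^ p) (Ioo (-1) 1) := by
  have hp : 1 < p := Fact.out
  have h := (Lp.memLp u.1.2).integrable_norm_rpow (by simpa using by linarith) (by simp)
  rw [ENNReal.toReal_ofReal (by linarith)] at h
  exact h

theorem integral_abs_weakDeriv_rpow (u : W1p p) :
    ∫ x in Ioo (-1 : ℝ) 1, |weakDeriv u x| ^ p = ‖u.1.2‖ ^ p := by
  have hp : 1 < p := Fact.out
  have h := (Lp.memLp u.1.2).eLpNorm_eq_integral_rpow_norm (by simpa using by linarith) (by simp)
  rw [Lp.norm_def, h, ENNReal.toReal_ofReal (by positivity),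
    ENNReal.toReal_ofReal (by linarith), ← Real.rpow_mul (by positivity),
    inv_mul_cancel₀ (by linarith), Real.rpow_one]
  rfl

theorem integrableOn_mul_abs_evalAt_rpow {V : ℝ → ℝ} (hV : Continuous V) (u : W1p p) :
    IntegrableOn (fun x => V x * |evalAt u x| ^ p) (Ioo (-1) 1) := by
  have hp : 1 < p := Fact.out
  have : Continuous fun x => V x * |evalAt u x| ^ p :=
    hV.mul ((continuous_evalAt u).abs.rpow_const fun _ => Or.inr (by linarith))
  exact (this.integrableOn_Icc).mono_set Ioo_subset_Icc_self

theorem integrableOn_abs_evalAt_rpow (u : W1p p) :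
    IntegrableOn (fun x => |evalAt u x| ^ p) (Ioo (-1) 1) := by
  simpa using integrableOn_mul_abs_evalAt_rpow continuous_const (V := fun _ => 1) u

/-- The numerator of the Rayleigh quotient. -/
noncomputable def energy (p : ℝ) [Fact (1 < p)] (α : ℝ) (V : ℝ → ℝ) (u : W1p p) : ℝ :=
  (∫ x in Ioo (-1 : ℝ) 1, (|weakDeriv u x| ^ p + V x * |evalAt u x| ^ p))
      + α * (|evalAt u 1| ^ p + |evalAt u (-1)| ^ p)

/-- The denominator of the Rayleigh quotient. -/
noncomputable def mass (p : ℝ) [Fact (1 < p)] (u : W1p p) : ℝ :=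
  ∫ x in Ioo (-1 : ℝ) 1, |evalAt u x| ^ p

theorem rayleigh_eq (α : ℝ) (V : ℝ → ℝ) (u : W1p p) :
    rayleigh p α V u = energy p α V u / mass p u := rfl

theorem energy_eq {V : ℝ → ℝ} (hV : Continuous V) (α : ℝ) (u : W1p p) :
    energy p α V u = (∫ x in Ioo (-1 : ℝ) 1, |weakDeriv u x| ^ p)
      + (∫ x in Ioo (-1 : ℝ) 1, V x * |evalAt u x| ^ p)
      + α * (|evalAt u 1| ^ p + |evalAt u (-1)| ^ p) := by
  rw [energy, integral_add (integrableOn_abs_weakDeriv_rpow u)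
    (integrableOn_mul_abs_evalAt_rpow hV u)]

/-- The `L^p` component is almost everywhere the derivative of the continuous one, hence determined
by it. This is what makes the mass of a nonzero element positive. -/
theorem eq_zero_of_evalAt_eq_zero {u : W1p p} (h : ∀ x ∈ Icc (-1 : ℝ) 1, evalAt u x = 0) :
    u = 0 := by
  have h1 : u.1.1 = 0 := by
    ext x
    have := h x x.2
    rwa [evalAt_of_mem u x.2] at this
  have h2 : u.1.2 = 0 := by
    rw [Lp.eq_zero_iff_ae_eq_zero]
    rw [Filter.EventuallyEq, ae_restrict_iff' measurableSet_Ioo]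
    filter_upwards [ae_hasDerivAt_evalAt u] with x hx hxI
    have h3 : HasDerivAt (evalAt u) 0 x := by
      refine (hasDerivAt_const x (0 : ℝ)).congr_of_eventuallyEq ?_
      filter_upwards [Ioo_mem_nhds hxI.1 hxI.2] with y hy
      exact h y (Ioo_subset_Icc_self hy)
    exact (hx hxI).unique h3
  exact Subtype.ext (Prod.ext h1 h2)

theorem mass_pos {u : W1p p} (hu : u ≠ 0) : 0 < mass p u := by
  have hp : 1 < p := Fact.out
  have hcont : Continuous fun x => |evalAt u x| ^ p :=
    (continuous_evalAt u).abs.rpow_const fun _ => Or.inr (by linarith)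
  obtain ⟨x, hx, hux⟩ : ∃ x ∈ Icc (-1 : ℝ) 1, evalAt u x ≠ 0 := by
    by_contra! h
    exact hu (eq_zero_of_evalAt_eq_zero h)
  have := intervalIntegral.integral_pos (a := -1) (b := 1) (by norm_num) hcont.continuousOn
    (fun y _ => by positivity) ⟨x, hx, by positivity⟩
  rwa [intervalIntegral.integral_of_le (by norm_num), integral_Ioc_eq_integral_Ioo] at this

/-- The gradient term is a power of the `L^p` norm; dominated convergence handles the potential.
Continuity ensures that maxima over compact sets are attained, so that the infima defining the
eigenvalues run over nonempty sets. -/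
theorem continuous_energy {V : ℝ → ℝ} (hV : Continuous V) (α : ℝ) :
    Continuous (energy p α V) := by
  have hp : 1 < p := Fact.out
  have hfst : Continuous fun u : W1p p => u.1.1 := continuous_fst.comp continuous_subtype_val
  have hev : ∀ x, Continuous fun u : W1p p => evalAt u x := fun x =>
    (ContinuousEvalConst.continuous_eval_const (F := C(Ibar, ℝ))
      (projIcc (-1) 1 (by norm_num) x)).comp hfst
  have hevp : ∀ x, Continuous fun u : W1p p => |evalAt u x| ^ p := fun x =>
    (hev x).abs.rpow_const fun _ => Or.inr (by linarith)
  have h1 : Continuous fun u : W1p p => ∫ x in Ioo (-1 : ℝ) 1, |weakDeriv u x| ^ p := by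
    simp_rw [integral_abs_weakDeriv_rpow]
    exact ((continuous_snd.comp continuous_subtype_val).norm).rpow_const
      fun _ => Or.inr (by linarith)
  have h2 : Continuous fun u : W1p p => ∫ x in Ioo (-1 : ℝ) 1, V x * |evalAt u x| ^ p := by
    rw [continuous_iff_continuousAt]
    intro u
    have hint : IntegrableOn (fun x => |V x| * (‖u.1.1‖ + 1) ^ p) (Ioo (-1) 1) :=
      ((hV.abs.mul continuous_const).integrableOn_Icc).mono_set Ioo_subset_Icc_self
    refine continuousAt_of_dominated ?_ ?_ hint ?_
    · exact Eventually.of_forall fun v =>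
        (integrableOn_mul_abs_evalAt_rpow hV v).aestronglyMeasurable
    · have : ∀ᶠ v : W1p p in 𝓝 u, ‖v.1.1‖ < ‖u.1.1‖ + 1 :=
        hfst.norm.continuousAt.eventually (gt_mem_nhds (by simp))
      filter_upwards [this] with v hv
      refine Eventually.of_forall fun x => ?_
      rw [norm_mul, Real.norm_eq_abs, Real.norm_of_nonneg (by positivity)]
      gcongr
      exact (v.1.1.norm_coe_le_norm _).trans hv.le
    · exact Eventually.of_forall fun x => ((hevp x).const_mul _).continuousAt
  have h3 := (h1.add h2).add (((hevp 1).add (hevp (-1))).const_mul α)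
  refine h3.congr fun u => (energy_eq hV α u).symm

theorem continuous_mass : Continuous (mass p) := by
  have h1 := (continuous_energy (p := p) (V := fun _ => 1) continuous_const 0).sub
    (continuous_energy (p := p) (V := fun _ => 0) continuous_const 0)
  refine h1.congr fun u => ?_
  rw [Pi.sub_apply, energy_eq continuous_const, energy_eq continuous_const, mass]
  simp

theorem continuousOn_rayleigh {V : ℝ → ℝ} (hV : Continuous V) (α : ℝ) :
    ContinuousOn (rayleigh p α V) {u | u ≠ 0} :=
  (continuous_energy hV α).continuousOn.div continuous_mass.continuousOn
    fun _ hu => (mass_pos hu).ne'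

/-- A continuous function with an almost everywhere bounded derivative defines an element of
`W1p`. -/
theorem exists_W1p {f f' : ℝ → ℝ} {C : ℝ} {s : Set ℝ} (hs : s.Countable)
    (hf : ContinuousOn f (Icc (-1) 1)) (hf' : ∀ x ∈ Ioo (-1 : ℝ) 1 \ s, HasDerivAt f (f' x) x)
    (hm : AEStronglyMeasurable f' μI) (hC : ∀ x ∈ Ioo (-1 : ℝ) 1, |f' x| ≤ C) :
    ∃ u : W1p p, (∀ x ∈ Icc (-1 : ℝ) 1, evalAt u x = f x) ∧ weakDeriv u =ᵐ[μI] f' := by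
  have hmem : MemLp f' (ENNReal.ofReal p) μI := by
    refine MemLp.of_bound hm C ?_
    rw [ae_restrict_iff' measurableSet_Ioo]
    exact Eventually.of_forall hC
  let F : C(Ibar, ℝ) := ⟨fun x => f x, continuousOn_iff_continuous_domRestrict.1 hf⟩
  have hw : ((F, hmem.toLp f') : C(Ibar, ℝ) × Lp ℝ (ENNReal.ofReal p) μI) ∈ W1p p := by
    intro x
    rw [intervalIntegral_congr_of_ae hmem.coeFn_toLp x]
    change f x = f (-1) + _
    have hint : IntervalIntegrable f' volume (-1) x :=
      ((intervalIntegrable_of_Lp (hmem.toLp f') x).congr_ae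
        (by
          rw [uIoc_of_le x.2.1, ← restrict_Ioo_eq_restrict_Ioc]
          exact ae_mono (Measure.restrict_mono (Ioo_subset_Ioo_right x.2.2) le_rfl)
            hmem.coeFn_toLp))
    rw [integral_eq_of_hasDerivAt_off_countable f f' hs
      (by rw [uIcc_of_le x.2.1]; exact hf.mono (Icc_subset_Icc_right x.2.2))
      (by
        rw [min_eq_left x.2.1, max_eq_right x.2.1]
        exact fun y hy => hf' y ⟨⟨hy.1.1, hy.1.2.trans_le x.2.2⟩, hy.2⟩) hint]
    ring
  exact ⟨⟨_, hw⟩, fun x hx => evalAt_of_mem _ hx, hmem.coeFn_toLp⟩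

end W1p

/-! ### Picone's inequality -/

theorem max_abs_zero (x : ℝ) : max |x| 0 = |x| := max_eq_left (abs_nonneg x)

theorem max_abs_sub_rpow {p ε : ℝ} (hp : 0 < p) (hε : 0 ≤ ε) (t : ℝ) :
    max (|t| - ε) 0 ^ p = max (t - ε) 0 ^ p + max (-t - ε) 0 ^ p := by
  rcases le_total 0 t with ht | ht
  · rw [abs_of_nonneg ht, max_eq_right (by linarith : -t - ε ≤ 0), Real.zero_rpow hp.ne', add_zero]
  · rw [abs_of_nonpos ht, max_eq_right (by linarith : t - ε ≤ 0), Real.zero_rpow hp.ne', zero_add]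

theorem hasDerivAt_max_abs_sub_rpow {p ε : ℝ} (hp : 1 < p) (hε : 0 ≤ ε) (t : ℝ) :
    HasDerivAt (fun t : ℝ => max (|t| - ε) 0 ^ p)
      (p * (max (t - ε) 0 ^ (p - 1) - max (-t - ε) 0 ^ (p - 1))) t := by
  have h1 := (hasDerivAt_max_zero_rpow hp (t - ε)).comp t ((hasDerivAt_id t).sub_const ε)
  have h2 := (hasDerivAt_max_zero_rpow hp (-t - ε)).comp t ((hasDerivAt_neg t).sub_const ε)
  refine ((h1.add h2).congr_deriv (by ring)).congr_of_eventuallyEq ?_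
  filter_upwards with y
  simpa using max_abs_sub_rpow (by linarith : 0 < p) hε y

theorem abs_deriv_max_abs_sub_rpow_le {p ε : ℝ} (hp : 1 < p) (hε : 0 ≤ ε) (t : ℝ) :
    |p * (max (t - ε) 0 ^ (p - 1) - max (-t - ε) 0 ^ (p - 1))|
      ≤ p * max (|t| - ε) 0 ^ (p - 1) := by
  rw [max_abs_sub_rpow (by linarith) hε, abs_mul, abs_of_pos (by linarith : 0 < p)]
  have h1 : 0 ≤ max (t - ε) 0 ^ (p - 1) := by positivity
  have h2 : 0 ≤ max (-t - ε) 0 ^ (p - 1) := by positivity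
  gcongr
  rw [abs_le]
  constructor <;> linarith

theorem absolutelyContinuousOnInterval_of_hasDerivAt {r r' : ℝ → ℝ} {a b : ℝ} (hab : a ≤ b)
    (hr : ∀ x ∈ Icc a b, HasDerivAt r (r' x) x) (hr' : ContinuousOn r' (Icc a b)) :
    AbsolutelyContinuousOnInterval r a b := by
  obtain ⟨C, hC⟩ := isCompact_Icc.exists_bound_of_continuousOn hr'
  have hC0 : 0 ≤ C := (norm_nonneg _).trans (hC a ⟨le_rfl, hab⟩)
  have : LipschitzOnWith C.toNNReal r (Icc a b) :=
    (convex_Icc a b).lipschitzOnWith_of_nnnorm_hasDerivWithin_le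
      (fun x hx => (hr x hx).hasDerivWithinAt)
      (fun x hx => by
        rw [← NNReal.coe_le_coe, coe_nnnorm, Real.coe_toNNReal C hC0]
        exact hC x hx)
  rw [← uIcc_of_le hab] at this
  exact this.absolutelyContinuousOnInterval

/-- Picone's inequality: a solution of the Riccati differential inequality bounds the energy of
`(|u| - ε)₊` from below by boundary terms. -/
theorem picone {p q : ℝ} (hpq : p.HolderConjugate q) {u g r r' W : ℝ → ℝ} {a b ε : ℝ}
    (hab : a ≤ b) (hε : 0 ≤ ε) (hu : AbsolutelyContinuousOnInterval u a b)
    (hg : ∀ᵐ x, x ∈ Ioo a b → HasDerivAt u (g x) x)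
    (hgp : IntervalIntegrable (fun x => |g x| ^ p) volume a b)
    (hr : ∀ x ∈ Icc a b, HasDerivAt r (r' x) x) (hr' : ContinuousOn r' (Icc a b))
    (hW : ContinuousOn W (Icc a b)) (hle : ∀ x ∈ Icc a b, r' x ≤ W x - (p - 1) * |r x| ^ q) :
    r b * max (|u b| - ε) 0 ^ p - r a * max (|u a| - ε) 0 ^ p
      ≤ ∫ x in a..b, (|g x| ^ p + W x * max (|u x| - ε) 0 ^ p) := by
  have hp := hpq.lt
  set G : ℝ → ℝ := fun t => max (|t| - ε) 0 ^ p with hG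
  have hGd := hasDerivAt_max_abs_sub_rpow hp hε
  have hucont := hu.continuousOn
  obtain ⟨M, hM⟩ := hu.exists_bound
  have hGu : AbsolutelyContinuousOnInterval (fun x => G (u x)) a b := by
    refine absolutelyContinuousOnInterval_of_dist_le (K := p * M ^ (p - 1)) hu fun x hx y hy => ?_
    have hbd : ∀ t ∈ Icc (-M) M,
        ‖p * (max (t - ε) 0 ^ (p - 1) - max (-t - ε) 0 ^ (p - 1))‖ ≤ p * M ^ (p - 1) := by
      intro t ht
      have htM : |t| ≤ M := abs_le.2 ht
      refine (abs_deriv_max_abs_sub_rpow_le hp hε t).trans ?_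
      gcongr
      exact max_le (by linarith) ((abs_nonneg t).trans htM)
    have := (convex_Icc (-M) M).norm_image_sub_le_of_norm_hasDerivWithin_le
      (fun t _ => (hGd t).hasDerivWithinAt) hbd (abs_le.1 (hM y hy)) (abs_le.1 (hM x hx))
    exact this
  have hF := (absolutelyContinuousOnInterval_of_hasDerivAt hab hr hr').fun_mul hGu
  have hint : IntervalIntegrable (fun x => |g x| ^ p + W x * G (u x)) volume a b := by
    refine hgp.add (ContinuousOn.intervalIntegrable ?_)
    rw [uIcc_of_le hab]
    refine hW.mul ?_
    have := hGu.continuousOn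
    rwa [uIcc_of_le hab] at this
  change r b * G (u b) - r a * G (u a) ≤ _
  rw [← hF.integral_deriv_eq_sub]
  refine intervalIntegral.integral_mono_ae_restrict hab hF.intervalIntegrable_deriv hint ?_
  rw [← restrict_Ioo_eq_restrict_Icc, Filter.EventuallyLE, ae_restrict_iff' measurableSet_Ioo]
  -- The derivative of `r G(u)` is `r' G(u) + r G'(u) g`. The Riccati inequality bounds the first
  -- term, and Young's inequality bounds the second by `|g|^p + (p-1)|r|^q G(u)`; the terms in
  -- `|r|^q` cancel.
  filter_upwards [hg] with x hx hxI
  have hxc := Ioo_subset_Icc_self hxI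
  have h1 := (hr x hxc).mul ((hGd (u x)).comp x (hx hxI))
  have h2 : deriv (fun x => r x * G (u x)) x = _ := h1.deriv
  rw [h2]
  have hG0 : 0 ≤ G (u x) := by simp only [hG]; positivity
  have h3 : r' x * G (u x) ≤ (W x - (p - 1) * |r x| ^ q) * G (u x) :=
    mul_le_mul_of_nonneg_right (hle x hxc) hG0
  have h4 := mul_rpow_le_add hpq (r x) (g x) (le_max_right (|u x| - ε) 0)
  have h5 := abs_deriv_max_abs_sub_rpow_le hp hε (u x)
  set D := p * (max (u x - ε) 0 ^ (p - 1) - max (-u x - ε) 0 ^ (p - 1))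
  have h6 : r x * (D * g x) ≤ p * (|r x| * max (|u x| - ε) 0 ^ (p - 1) * |g x|) := by
    refine (le_abs_self _).trans ?_
    rw [abs_mul, abs_mul]
    calc |r x| * (|D| * |g x|)
        ≤ |r x| * (p * max (|u x| - ε) 0 ^ (p - 1) * |g x|) := by gcongr
      _ = _ := by ring
  simp only [Function.comp, hG] at h3 h4 h6 ⊢
  linarith

theorem continuousOn_riccati_rhs {p q : ℝ} {V r r' : ℝ → ℝ} {l : ℝ} {s : Set ℝ} (hq : 0 ≤ q)
    (hV : Continuous V) (hr : ∀ x ∈ s, HasDerivAt r (r' x) x) :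
    ContinuousOn (fun x => V x - l - (p - 1) * |r x| ^ q) s := by
  have h : ContinuousOn r s := fun x hx => (hr x hx).continuousAt.continuousWithinAt
  exact (hV.continuousOn.sub continuousOn_const).sub
    (continuousOn_const.mul (h.abs.rpow_const fun _ _ => Or.inr hq))

/-! ### Lower bounds for the energy from Riccati solutions. -/

section Bounds

variable {p : ℝ} [hp : Fact (1 < p)] {q : ℝ}

theorem picone_evalAt (hpq : p.HolderConjugate q) (u : W1p p) {r r' W : ℝ → ℝ} {a b ε : ℝ}
    (ha : -1 ≤ a) (hab : a ≤ b) (hb : b ≤ 1) (hε : 0 ≤ ε)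
    (hr : ∀ x ∈ Icc a b, HasDerivAt r (r' x) x) (hr' : ContinuousOn r' (Icc a b))
    (hW : Continuous W) (hle : ∀ x ∈ Icc a b, r' x ≤ W x - (p - 1) * |r x| ^ q) :
    r b * max (|evalAt u b| - ε) 0 ^ p - r a * max (|evalAt u a| - ε) 0 ^ p
      ≤ ∫ x in a..b, (|weakDeriv u x| ^ p + W x * max (|evalAt u x| - ε) 0 ^ p) := by
  have hsub : uIcc a b ⊆ uIcc (-1) 1 := by
    rw [uIcc_of_le hab, uIcc_of_le (by norm_num)]
    exact Icc_subset_Icc ha hb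
  refine picone hpq hab hε ((absolutelyContinuousOnInterval_evalAt u).mono hsub) ?_ ?_ hr hr'
    hW.continuousOn hle
  · filter_upwards [ae_hasDerivAt_evalAt u] with x hx hxI
    exact hx (Ioo_subset_Ioo ha hb hxI)
  · rw [intervalIntegrable_iff_integrableOn_Ioo_of_le hab]
    exact (integrableOn_abs_weakDeriv_rpow u).mono_set (Ioo_subset_Ioo ha hb)

theorem intervalIntegrable_abs_weakDeriv_rpow (u : W1p p) {a b : ℝ}
    (ha : -1 ≤ a) (hab : a ≤ b) (hb : b ≤ 1) :
    IntervalIntegrable (fun x => |weakDeriv u x| ^ p) volume a b := by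
  rw [intervalIntegrable_iff_integrableOn_Ioo_of_le hab]
  exact (integrableOn_abs_weakDeriv_rpow u).mono_set (Ioo_subset_Ioo ha hb)

theorem energy_sub_eq {V : ℝ → ℝ} (hV : Continuous V) (α l : ℝ) (u : W1p p) :
    energy p α V u - l * mass p u
      = (∫ x in (-1 : ℝ)..1, (|weakDeriv u x| ^ p + (V x - l) * |evalAt u x| ^ p))
        + α * (|evalAt u 1| ^ p + |evalAt u (-1)| ^ p) := by
  have hW : Continuous fun x => V x - l := hV.sub continuous_const
  rw [intervalIntegral.integral_of_le (by norm_num), integral_Ioc_eq_integral_Ioo,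
    energy_eq hV, mass, integral_add (integrableOn_abs_weakDeriv_rpow u)
      (integrableOn_mul_abs_evalAt_rpow hW u)]
  simp_rw [sub_mul]
  rw [integral_sub (integrableOn_mul_abs_evalAt_rpow hV u)
      (integrableOn_mul_abs_evalAt_rpow continuous_const u), integral_const_mul]
  ring

/-- A Riccati subsolution with the Robin boundary values gives a lower bound for the energy. -/
theorem mul_mass_le_energy (hpq : p.HolderConjugate q) {V : ℝ → ℝ} (hV : Continuous V) {α l : ℝ}
    {r r' : ℝ → ℝ} (hr : ∀ x ∈ Icc (-1 : ℝ) 1, HasDerivAt r (r' x) x)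
    (hr' : ContinuousOn r' (Icc (-1) 1))
    (hle : ∀ x ∈ Icc (-1 : ℝ) 1, r' x ≤ V x - l - (p - 1) * |r x| ^ q)
    (h1 : r 1 = -α) (h2 : r (-1) = α) (u : W1p p) : l * mass p u ≤ energy p α V u := by
  have hW : Continuous fun x => V x - l := hV.sub continuous_const
  have h := picone_evalAt hpq u le_rfl (by norm_num) le_rfl le_rfl hr hr' hW hle
  simp only [sub_zero, max_abs_zero, h1, h2] at h
  have := energy_sub_eq hV α l u
  linarith

/-- The line `r = -α x` has the Robin boundary values and is a Riccati subsolution once `l` is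
negative enough. The bound is needed because the infimum of a set of reals unbounded below defaults
to zero. -/
theorem exists_mul_mass_le_energy {V : ℝ → ℝ} (hV : Continuous V) (α : ℝ) :
    ∃ l : ℝ, ∀ u : W1p p, l * mass p u ≤ energy p α V u := by
  have hpq := Real.HolderConjugate.conjExponent hp.out
  set q := p.conjExponent
  obtain ⟨C, hC⟩ := (isCompact_Icc (a := (-1 : ℝ)) (b := 1)).exists_bound_of_continuousOn
    hV.continuousOn
  refine ⟨-C - |α| - (p - 1) * |α| ^ q, fun u => mul_mass_le_energy hpq hV (r := fun x => -α * x)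
    (r' := fun _ => -α) (fun x _ => by simpa using (hasDerivAt_id x).const_mul (-α))
    continuousOn_const (fun x hx => ?_) (by simp) (by simp) u⟩
  have h1 := neg_le_of_abs_le (hC x hx)
  have h2 : |(-α) * x| ^ q ≤ |α| ^ q := by
    refine Real.rpow_le_rpow (abs_nonneg _) ?_ hpq.symm.nonneg
    rw [abs_mul, abs_neg]
    exact mul_le_of_le_one_right (abs_nonneg _) (abs_le.2 hx)
  have h3 : (p - 1) * |(-α) * x| ^ q ≤ (p - 1) * |α| ^ q :=
    mul_le_mul_of_nonneg_left h2 hpq.sub_one_pos.le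
  have := neg_abs_le α
  have := neg_le_abs α
  linarith

theorem continuous_integral_max_abs_sub_rpow (u : W1p p) {W : ℝ → ℝ} (hW : Continuous W)
    {a b : ℝ} : Continuous fun ε : ℝ => ∫ x in a..b, W x * max (|evalAt u x| - ε) 0 ^ p := by
  refine intervalIntegral.continuous_parametric_intervalIntegral_of_continuous' ?_ a b
  have h1 := (continuous_evalAt u).comp (continuous_snd (X := ℝ) (Y := ℝ))
  exact (hW.comp continuous_snd).mul (((h1.abs.sub continuous_fst).max continuous_const).rpow_const
    fun _ => Or.inr (by linarith [hp.out]))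

/-- Near a pole of `r`, Picone's inequality is available only for the truncation at `ε > 0`;
continuity in `ε` removes it. -/
theorem le_integral_of_forall_pos (u : W1p p) {W : ℝ → ℝ} (hW : Continuous W) {a b B e : ℝ}
    (ha : -1 ≤ a) (hab : a ≤ b) (hb : b ≤ 1)
    (h : ∀ ε > 0, B * max (|evalAt u e| - ε) 0 ^ p
      ≤ ∫ x in a..b, (|weakDeriv u x| ^ p + W x * max (|evalAt u x| - ε) 0 ^ p)) :
    B * |evalAt u e| ^ p ≤ ∫ x in a..b, (|weakDeriv u x| ^ p + W x * |evalAt u x| ^ p) := by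
  have hp0 : 0 ≤ p := by linarith [hp.out]
  have hsplit : ∀ ε : ℝ, ∫ x in a..b, (|weakDeriv u x| ^ p + W x * max (|evalAt u x| - ε) 0 ^ p)
      = (∫ x in a..b, |weakDeriv u x| ^ p)
        + ∫ x in a..b, W x * max (|evalAt u x| - ε) 0 ^ p := fun ε =>
    intervalIntegral.integral_add (intervalIntegrable_abs_weakDeriv_rpow u ha hab hb)
      (Continuous.intervalIntegrable (hW.mul
        ((((continuous_evalAt u).abs.sub continuous_const).max continuous_const).rpow_const
          fun _ => Or.inr hp0)) _ _)
  have hL : Continuous fun ε : ℝ => B * max (|evalAt u e| - ε) 0 ^ p :=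
    continuous_const.mul (((continuous_const.sub continuous_id).max continuous_const).rpow_const
      fun _ => Or.inr hp0)
  have hR : Continuous fun ε : ℝ =>
      ∫ x in a..b, (|weakDeriv u x| ^ p + W x * max (|evalAt u x| - ε) 0 ^ p) := by
    simp_rw [hsplit]
    exact continuous_const.add (continuous_integral_max_abs_sub_rpow u hW)
  have := le_of_tendsto_of_tendsto (b := 𝓝[>] (0 : ℝ))
    ((hL.tendsto 0).mono_left nhdsWithin_le_nhds) ((hR.tendsto 0).mono_left nhdsWithin_le_nhds)
    (by filter_upwards [self_mem_nhdsWithin] with ε hε using h ε hε)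
  simpa only [sub_zero, max_abs_zero] using this

/-- Here `r` may blow up at `c`. Since `u` vanishes there, `(|u| - ε)₊` is zero on some `[c, a]`
with `a > c`, so Picone's inequality is needed only on `[a, 1]`; on `[c, a]` the integrand is
`|u'|^p ≥ 0`. -/
theorem neg_mul_le_integral_right (hpq : p.HolderConjugate q) {V : ℝ → ℝ} (hV : Continuous V)
    {α l c : ℝ} {r : ℝ → ℝ} (hc : c ∈ Ioo (-1 : ℝ) 1)
    (hr : ∀ x ∈ Ioc c 1, HasDerivAt r (V x - l - (p - 1) * |r x| ^ q) x) (h1 : r 1 = -α)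
    {u : W1p p} (hu : evalAt u c = 0) :
    -α * |evalAt u 1| ^ p
      ≤ ∫ x in c..1, (|weakDeriv u x| ^ p + (V x - l) * |evalAt u x| ^ p) := by
  have hp0 : 0 < p := hpq.pos
  have hW : Continuous fun x => V x - l := hV.sub continuous_const
  refine le_integral_of_forall_pos u hW hc.1.le hc.2.le le_rfl fun ε hε => ?_
  have hev : ∀ᶠ x in 𝓝 c, |evalAt u x| < ε := by
    refine (continuous_evalAt u).abs.continuousAt.eventually (gt_mem_nhds ?_)
    simpa [hu] using hε
  obtain ⟨d, hd, hd'⟩ := Metric.eventually_nhds_iff.1 hev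
  set a := min (c + d / 2) 1 with ha
  have hca : c < a := lt_min (by linarith) hc.2
  have ha1 : a ≤ 1 := min_le_right _ _
  have hz : ∀ x ∈ Icc c a, max (|evalAt u x| - ε) 0 ^ p = 0 := fun x hx => by
    have : |evalAt u x| < ε := hd' (by
      rw [Real.dist_eq, abs_of_nonneg (by linarith [hx.1])]
      linarith [hx.2, min_le_left (c + d / 2) 1])
    rw [max_eq_right (by linarith), Real.zero_rpow hp0.ne']
  have hsub : ∀ x ∈ Icc a 1, x ∈ Ioc c 1 := fun x hx => ⟨hca.trans_le hx.1, hx.2⟩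
  have h := picone_evalAt hpq u (hc.1.le.trans hca.le) ha1 le_rfl hε.le
    (fun x hx => hr x (hsub x hx))
    (continuousOn_riccati_rhs hpq.symm.nonneg hV fun x hx => hr x (hsub x hx)) hW
    (fun x _ => le_rfl)
  rw [hz a ⟨hca.le, le_rfl⟩, h1, mul_zero, sub_zero] at h
  have hi : ∀ s t : ℝ, -1 ≤ s → s ≤ t → t ≤ 1 → IntervalIntegrable
      (fun x => |weakDeriv u x| ^ p + (V x - l) * max (|evalAt u x| - ε) 0 ^ p) volume s t :=
    fun s t hs hst ht => (intervalIntegrable_abs_weakDeriv_rpow u hs hst ht).add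
      (Continuous.intervalIntegrable (hW.mul
        ((((continuous_evalAt u).abs.sub continuous_const).max continuous_const).rpow_const
          fun _ => Or.inr hp0.le)) _ _)
  rw [← intervalIntegral.integral_add_adjacent_intervals (hi c a hc.1.le hca.le ha1)
    (hi a 1 (hc.1.le.trans hca.le) ha1 le_rfl)]
  have h0 : 0 ≤ ∫ x in c..a, (|weakDeriv u x| ^ p
      + (V x - l) * max (|evalAt u x| - ε) 0 ^ p) := by
    refine intervalIntegral.integral_nonneg hca.le fun x hx => ?_
    rw [hz x hx, mul_zero, add_zero]
    positivity
  linarith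

theorem neg_mul_le_integral_left (hpq : p.HolderConjugate q) {V : ℝ → ℝ} (hV : Continuous V)
    {α l c : ℝ} {r : ℝ → ℝ} (hc : c ∈ Ioo (-1 : ℝ) 1)
    (hr : ∀ x ∈ Ico (-1) c, HasDerivAt r (V x - l - (p - 1) * |r x| ^ q) x) (h1 : r (-1) = α)
    {u : W1p p} (hu : evalAt u c = 0) :
    -α * |evalAt u (-1)| ^ p
      ≤ ∫ x in (-1)..c, (|weakDeriv u x| ^ p + (V x - l) * |evalAt u x| ^ p) := by
  have hp0 : 0 < p := hpq.pos
  have hW : Continuous fun x => V x - l := hV.sub continuous_const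
  refine le_integral_of_forall_pos u hW le_rfl hc.1.le hc.2.le fun ε hε => ?_
  have hev : ∀ᶠ x in 𝓝 c, |evalAt u x| < ε := by
    refine (continuous_evalAt u).abs.continuousAt.eventually (gt_mem_nhds ?_)
    simpa [hu] using hε
  obtain ⟨d, hd, hd'⟩ := Metric.eventually_nhds_iff.1 hev
  set a := max (c - d / 2) (-1) with ha
  have hca : a < c := max_lt (by linarith) hc.1
  have ha1 : -1 ≤ a := le_max_right _ _
  have hz : ∀ x ∈ Icc a c, max (|evalAt u x| - ε) 0 ^ p = 0 := fun x hx => by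
    have : |evalAt u x| < ε := hd' (by
      rw [Real.dist_eq, abs_of_nonpos (by linarith [hx.2])]
      linarith [hx.1, le_max_left (c - d / 2) (-1)])
    rw [max_eq_right (by linarith), Real.zero_rpow hp0.ne']
  have hsub : ∀ x ∈ Icc (-1) a, x ∈ Ico (-1) c := fun x hx => ⟨hx.1, hx.2.trans_lt hca⟩
  have h := picone_evalAt hpq u le_rfl ha1 (hca.le.trans hc.2.le) hε.le
    (fun x hx => hr x (hsub x hx))
    (continuousOn_riccati_rhs hpq.symm.nonneg hV fun x hx => hr x (hsub x hx)) hW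
    (fun x _ => le_rfl)
  rw [hz a ⟨le_rfl, hca.le⟩, h1, mul_zero, zero_sub] at h
  have hi : ∀ s t : ℝ, -1 ≤ s → s ≤ t → t ≤ 1 → IntervalIntegrable
      (fun x => |weakDeriv u x| ^ p + (V x - l) * max (|evalAt u x| - ε) 0 ^ p) volume s t :=
    fun s t hs hst ht => (intervalIntegrable_abs_weakDeriv_rpow u hs hst ht).add
      (Continuous.intervalIntegrable (hW.mul
        ((((continuous_evalAt u).abs.sub continuous_const).max continuous_const).rpow_const
          fun _ => Or.inr hp0.le)) _ _)
  rw [← intervalIntegral.integral_add_adjacent_intervals (hi (-1) a le_rfl ha1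
    (hca.le.trans hc.2.le)) (hi a c ha1 hca.le hc.2.le)]
  have h0 : 0 ≤ ∫ x in a..c, (|weakDeriv u x| ^ p
      + (V x - l) * max (|evalAt u x| - ε) 0 ^ p) := by
    refine intervalIntegral.integral_nonneg hca.le fun x hx => ?_
    rw [hz x hx, mul_zero, add_zero]
    positivity
  linarith

/-- Riccati solutions on the two sides of a node bound the energy of functions vanishing there. -/
theorem mul_mass_le_energy_of_node (hpq : p.HolderConjugate q) {V : ℝ → ℝ} (hV : Continuous V)
    {α l c : ℝ} {r s : ℝ → ℝ} (hc : c ∈ Ioo (-1 : ℝ) 1)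
    (hr : ∀ x ∈ Ioc c 1, HasDerivAt r (V x - l - (p - 1) * |r x| ^ q) x) (hr1 : r 1 = -α)
    (hs : ∀ x ∈ Ico (-1) c, HasDerivAt s (V x - l - (p - 1) * |s x| ^ q) x) (hs1 : s (-1) = α)
    {u : W1p p} (hu : evalAt u c = 0) : l * mass p u ≤ energy p α V u := by
  have h1 := neg_mul_le_integral_right hpq hV hc hr hr1 hu
  have h2 := neg_mul_le_integral_left hpq hV hc hs hs1 hu
  have hi : ∀ s t : ℝ, -1 ≤ s → s ≤ t → t ≤ 1 → IntervalIntegrable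
      (fun x => |weakDeriv u x| ^ p + (V x - l) * |evalAt u x| ^ p) volume s t :=
    fun s t hs hst ht => (intervalIntegrable_abs_weakDeriv_rpow u hs hst ht).add
      (Continuous.intervalIntegrable ((hV.sub continuous_const).mul
        ((continuous_evalAt u).abs.rpow_const fun _ => Or.inr hpq.nonneg)) _ _)
  have h3 := energy_sub_eq hV α l u
  rw [← intervalIntegral.integral_add_adjacent_intervals (hi (-1) c le_rfl hc.1.le hc.2.le)
    (hi c 1 hc.1.le hc.2.le le_rfl)] at h3
  linarith

end Bounds

/-! ### Genus and the minimax values -/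

theorem abs_add_rpow_of_mul_eq_zero {p x y : ℝ} (hp0 : 0 < p) (a b : ℝ) (h : x * y = 0) :
    |a * x + b * y| ^ p = |a| ^ p * |x| ^ p + |b| ^ p * |y| ^ p := by
  rcases mul_eq_zero.1 h with rfl | rfl <;>
  simp [abs_mul, Real.mul_rpow (abs_nonneg _) (abs_nonneg _), Real.zero_rpow hp0.ne']

section Minimax

variable {p : ℝ} [hp : Fact (1 < p)]

theorem genus_le_of_hasOddMap {E : Type*} [TopologicalSpace E] [Neg E] {A : Set E} {n : ℕ}
    (h : HasOddMap A n) : genus A ≤ n :=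
  iInf₂_le n h

theorem LSClass_nonempty_of_mem {i : ℕ} {A : Set (W1p p)} (hA : A ∈ LSClass p i) :
    A.Nonempty := by
  rw [nonempty_iff_ne_empty]
  rintro rfl
  have h : genus (∅ : Set (W1p p)) ≤ (0 : ℕ) :=
    genus_le_of_hasOddMap ⟨fun _ => 0, by simp, by simp, by simp⟩
  have := hA.2.2.2.trans h
  norm_cast at this

theorem exists_isGreatest_rayleigh {V : ℝ → ℝ} (hV : Continuous V) (α : ℝ) {i : ℕ}
    {A : Set (W1p p)} (hA : A ∈ LSClass p i) : ∃ m, IsGreatest (rayleigh p α V '' A) m := by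
  have hsub : A ⊆ {u | u ≠ 0} := fun u hu h0 => hA.2.2.1 (h0 ▸ hu)
  exact (hA.1.image_of_continuousOn ((continuousOn_rayleigh hV α).mono hsub)).exists_isGreatest
    ((LSClass_nonempty_of_mem hA).image _)

theorem le_rayleigh_iff {V : ℝ → ℝ} {α l : ℝ} {u : W1p p} (hu : u ≠ 0) :
    l ≤ rayleigh p α V u ↔ l * mass p u ≤ energy p α V u := by
  rw [rayleigh_eq, le_div_iff₀ (mass_pos hu)]

theorem rayleigh_le_iff {V : ℝ → ℝ} {α l : ℝ} {u : W1p p} (hu : u ≠ 0) :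
    rayleigh p α V u ≤ l ↔ energy p α V u ≤ l * mass p u := by
  rw [rayleigh_eq, div_le_iff₀ (mass_pos hu)]

theorem ne_zero_of_mem_LSClass {i : ℕ} {A : Set (W1p p)} (hA : A ∈ LSClass p i) {u : W1p p}
    (hu : u ∈ A) : u ≠ 0 :=
  fun h => hA.2.2.1 (h ▸ hu)

theorem eigenvalue_le {V : ℝ → ℝ} (hV : Continuous V) {α m : ℝ} {i : ℕ} {A : Set (W1p p)}
    (hA : A ∈ LSClass p i) (hm : ∀ u ∈ A, rayleigh p α V u ≤ m) : eigenvalue p α V i ≤ m := by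
  obtain ⟨l, hl⟩ := exists_mul_mass_le_energy (p := p) hV α
  obtain ⟨M, hM⟩ := exists_isGreatest_rayleigh hV α hA
  have hMm : M ≤ m := by
    obtain ⟨u, hu, rfl⟩ := hM.1
    exact hm u hu
  have hbdd : BddBelow {m : ℝ | ∃ A ∈ LSClass p i, IsGreatest (rayleigh p α V '' A) m} := by
    refine ⟨l, ?_⟩
    rintro k ⟨B, hB, hk⟩
    obtain ⟨u, hu, rfl⟩ := hk.1
    exact (le_rayleigh_iff (ne_zero_of_mem_LSClass hB hu)).2 (hl u)
  exact (csInf_le hbdd ⟨A, hA, hM⟩).trans hMm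

theorem le_eigenvalue {V : ℝ → ℝ} (hV : Continuous V) {α m : ℝ} {i : ℕ}
    (hne : (LSClass p i).Nonempty) (hm : ∀ A ∈ LSClass p i, ∃ u ∈ A, m ≤ rayleigh p α V u) :
    m ≤ eigenvalue p α V i := by
  obtain ⟨A, hA⟩ := hne
  obtain ⟨M, hM⟩ := exists_isGreatest_rayleigh hV α hA
  refine le_csInf ⟨M, A, hA, hM⟩ ?_
  rintro k ⟨B, hB, hk⟩
  obtain ⟨u, hu, hmu⟩ := hm B hB
  exact hmu.trans (hk.2 ⟨u, hu, rfl⟩)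

theorem not_hasOddMap_zero {E : Type*} [TopologicalSpace E] [Neg E] {A : Set E}
    (hA : A.Nonempty) : ¬ HasOddMap A 0 := by
  rintro ⟨f, -, -, hf⟩
  obtain ⟨u, hu⟩ := hA
  exact hf u hu (Subsingleton.elim _ _)

theorem pair_mem_LSClass {u : W1p p} (hu : u ≠ 0) : ({u, -u} : Set (W1p p)) ∈ LSClass p 0 := by
  refine ⟨(Set.toFinite _).isCompact, ?_, ?_, ?_⟩
  · rintro v (rfl | rfl) <;> simp
  · rintro (h | h)
    · exact hu h.symm
    · exact hu (by simpa using h.symm)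
  · refine le_iInf₂ fun n hn => ?_
    rcases n with _ | n
    · exact absurd hn (not_hasOddMap_zero ⟨u, by simp⟩)
    · exact_mod_cast Nat.succ_le_succ (Nat.zero_le n)

/-- The path joins `γ 0` to `-γ 0`, so an odd scalar function changes sign along it and has a zero.
This gives the circles below genus at least two. -/
theorem not_hasOddMap_one_range {E : Type*} [TopologicalSpace E] [Neg E] {γ : ℝ → E}
    (hγ : Continuous γ) {T : ℝ} (hT : ∀ t, γ (t + T) = -γ t) : ¬ HasOddMap (range γ) 1 := by
  rintro ⟨f, hfc, hfo, hf0⟩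
  have h1 : Continuous fun t : ℝ => f (γ t) := hfc.comp_continuous hγ fun t => mem_range_self t
  have hgc : Continuous fun t : ℝ => f (γ t) 0 :=
    (EuclideanSpace.proj (𝕜 := ℝ) (0 : Fin 1)).continuous.comp h1
  have h0 : f (γ (0 + T)) 0 = -f (γ 0) 0 := by
    rw [hT, hfo _ (mem_range_self _)]
    rfl
  have hzero : ∃ t, f (γ t) 0 = 0 := by
    rcases le_total (f (γ 0) 0) 0 with h | h
    · exact mem_range_of_exists_le_of_exists_ge hgc ⟨0, h⟩ ⟨0 + T, by rw [h0]; linarith⟩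
    · exact mem_range_of_exists_le_of_exists_ge hgc ⟨0 + T, by rw [h0]; linarith⟩ ⟨0, h⟩
  obtain ⟨t, ht⟩ := hzero
  refine hf0 _ (mem_range_self t) ?_
  ext j
  rw [Subsingleton.elim j 0]
  exact ht

/-- The circle through `u` and `v`. -/
def circleSet (u v : W1p p) : Set (W1p p) :=
  range fun t : ℝ => Real.cos t • u + Real.sin t • v

theorem circleSet_mem_LSClass {u v : W1p p} (huv : ∀ a b : ℝ, a • u + b • v = 0 → a = 0 ∧ b = 0) :
    circleSet u v ∈ LSClass p 1 := by
  have hcont : Continuous fun t : ℝ => Real.cos t • u + Real.sin t • v := by fun_prop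
  have hpi : ∀ t : ℝ, Real.cos (t + Real.pi) • u + Real.sin (t + Real.pi) • v
      = -(Real.cos t • u + Real.sin t • v) := fun t => by
    rw [Real.cos_add_pi, Real.sin_add_pi]
    module
  refine ⟨?_, ?_, ?_, ?_⟩
  · have hper : Function.Periodic (fun t : ℝ => Real.cos t • u + Real.sin t • v)
        (2 * Real.pi) := fun t => by simp
    rw [circleSet, ← hper.image_Icc (by positivity) 0]
    exact isCompact_Icc.image hcont
  · rintro _ ⟨t, rfl⟩
    exact ⟨t + Real.pi, hpi t⟩
  · rintro ⟨t, ht⟩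
    obtain ⟨h1, h2⟩ := huv _ _ ht
    have := Real.cos_sq_add_sin_sq t
    simp [h1, h2] at this
  · refine le_iInf₂ fun n hn => ?_
    rcases n with _ | _ | n
    · exact absurd hn (not_hasOddMap_zero ⟨_, mem_range_self 0⟩)
    · exact absurd hn (not_hasOddMap_one_range hcont hpi)
    · exact_mod_cast Nat.succ_le_succ (Nat.succ_le_succ (Nat.zero_le n))

theorem evalAt_smul_add_smul (a b : ℝ) (u v : W1p p) (x : ℝ) :
    evalAt (a • u + b • v) x = a * evalAt u x + b * evalAt v x := rfl

theorem weakDeriv_smul_add_smul (a b : ℝ) (u v : W1p p) :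
    weakDeriv (a • u + b • v) =ᵐ[μI] fun x => a * weakDeriv u x + b * weakDeriv v x := by
  have h1 := Lp.coeFn_add (a • u.1.2) (b • v.1.2)
  have h2 := Lp.coeFn_smul a u.1.2
  have h3 := Lp.coeFn_smul b v.1.2
  filter_upwards [h1, h2, h3] with x h1 h2 h3
  change (a • u.1.2 + b • v.1.2 : Lp ℝ (ENNReal.ofReal p) μI) x = _
  rw [h1, Pi.add_apply, h2, h3]
  rfl

theorem LSClass_one_nonempty : (LSClass p 1).Nonempty := by
  obtain ⟨u, hu, -⟩ := exists_W1p (p := p) (f := fun _ => 1) (f' := fun _ => 0) (C := 0)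
    countable_empty continuousOn_const (fun x _ => hasDerivAt_const x 1)
    aestronglyMeasurable_const (by simp)
  obtain ⟨v, hv, -⟩ := exists_W1p (p := p) (f := fun x => x) (f' := fun _ => 1) (C := 1)
    countable_empty continuousOn_id (fun x _ => hasDerivAt_id x)
    aestronglyMeasurable_const (by simp)
  refine ⟨circleSet u v, circleSet_mem_LSClass fun a b hab => ?_⟩
  have key : ∀ x ∈ Icc (-1 : ℝ) 1, a + b * x = 0 := fun x hx => by
    have := evalAt_smul_add_smul a b u v x
    rw [hab, hu x hx, hv x hx] at this
    rw [mul_one] at this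
    exact this.symm
  have h1 := key 0 (by norm_num)
  have h2 := key 1 (by norm_num)
  constructor <;> linarith

theorem LSClass_zero_nonempty : (LSClass p 0).Nonempty := by
  obtain ⟨A, hA⟩ := LSClass_one_nonempty (p := p)
  obtain ⟨u, hu⟩ := LSClass_nonempty_of_mem hA
  exact ⟨_, pair_mem_LSClass (ne_zero_of_mem_LSClass hA hu)⟩

theorem le_eigenvalue_zero {V : ℝ → ℝ} (hV : Continuous V) {α l : ℝ}
    (h : ∀ u : W1p p, l * mass p u ≤ energy p α V u) : l ≤ eigenvalue p α V 0 :=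
  le_eigenvalue hV LSClass_zero_nonempty fun A hA => by
    obtain ⟨u, hu⟩ := LSClass_nonempty_of_mem hA
    exact ⟨u, hu, (le_rayleigh_iff (ne_zero_of_mem_LSClass hA hu)).2 (h u)⟩

/-- Otherwise evaluation at `c` would be an odd continuous map to `ℝ ∖ {0}`, and the genus would be
at most one. -/
theorem exists_mem_evalAt_eq_zero {A : Set (W1p p)} (hA : A ∈ LSClass p 1) (c : ℝ) :
    ∃ u ∈ A, evalAt u c = 0 := by
  by_contra! h
  have hodd : HasOddMap A 1 := by
    refine ⟨fun u => WithLp.toLp 2 fun _ => evalAt u c, Continuous.continuousOn ?_, ?_, ?_⟩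
    · have hev : Continuous fun u : W1p p => evalAt u c :=
        (ContinuousEvalConst.continuous_eval_const (F := C(Ibar, ℝ))
          (projIcc (-1) 1 (by norm_num) c)).comp (continuous_fst.comp continuous_subtype_val)
      exact (PiLp.continuous_toLp 2 _).comp (continuous_pi fun _ => hev)
    · intro u _
      ext j
      rfl
    · intro u hu h0
      exact h u hu (congrArg (fun w : EuclideanSpace ℝ (Fin 1) => w 0) h0)
  have := hA.2.2.2.trans (genus_le_of_hasOddMap hodd)
  norm_cast at this

theorem le_eigenvalue_one {V : ℝ → ℝ} (hV : Continuous V) {α l c : ℝ}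
    (h : ∀ u : W1p p, evalAt u c = 0 → l * mass p u ≤ energy p α V u) :
    l ≤ eigenvalue p α V 1 :=
  le_eigenvalue hV LSClass_one_nonempty fun A hA => by
    obtain ⟨u, hu, huc⟩ := exists_mem_evalAt_eq_zero hA c
    exact ⟨u, hu, (le_rayleigh_iff (ne_zero_of_mem_LSClass hA hu)).2 (h u huc)⟩

theorem mass_neg (u : W1p p) : mass p (-u) = mass p u := by
  have h : ∀ x, evalAt (-u) x = -evalAt u x := fun _ => rfl
  simp only [mass, h, abs_neg]

theorem energy_neg {V : ℝ → ℝ} (hV : Continuous V) (α : ℝ) (u : W1p p) :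
    energy p α V (-u) = energy p α V u := by
  have h : ∀ x, evalAt (-u) x = -evalAt u x := fun _ => rfl
  have h2 : (-u).1.2 = -u.1.2 := rfl
  rw [energy_eq hV, energy_eq hV, integral_abs_weakDeriv_rpow, integral_abs_weakDeriv_rpow, h2,
    norm_neg]
  simp only [h, abs_neg]

theorem eigenvalue_zero_le {V : ℝ → ℝ} (hV : Continuous V) {α l : ℝ} {u : W1p p} (hu : u ≠ 0)
    (h : energy p α V u ≤ l * mass p u) : eigenvalue p α V 0 ≤ l := by
  refine eigenvalue_le hV (pair_mem_LSClass hu) ?_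
  rintro v (rfl | rfl)
  · exact (rayleigh_le_iff hu).2 h
  · refine (rayleigh_le_iff (neg_ne_zero.2 hu)).2 ?_
    rwa [energy_neg hV, mass_neg]

/-- Two functions with disjoint supports and Rayleigh quotients at most `l` bound the second
eigenvalue. -/
theorem eigenvalue_one_le {V : ℝ → ℝ} (hV : Continuous V) {α l : ℝ} {u v : W1p p} (hu : u ≠ 0)
    (hv : v ≠ 0) (h0 : ∀ x ∈ Icc (-1 : ℝ) 1, evalAt u x * evalAt v x = 0)
    (h0' : ∀ᵐ x ∂μI, weakDeriv u x * weakDeriv v x = 0)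
    (hul : energy p α V u ≤ l * mass p u) (hvl : energy p α V v ≤ l * mass p v) :
    eigenvalue p α V 1 ≤ l := by
  have hp0 : 0 < p := by linarith [hp.out]
  -- Disjointness removes all cross terms: mass and energy of `a u + b v` are combinations with
  -- coefficients `|a|^p` and `|b|^p`. Hence the whole circle through `u` and `v` stays at quotient
  -- at most `l`.
  have hmass : ∀ a b : ℝ, mass p (a • u + b • v) = |a| ^ p * mass p u + |b| ^ p * mass p v := by
    intro a b
    rw [mass, mass, mass, ← integral_const_mul, ← integral_const_mul,
      ← integral_add ((integrableOn_abs_evalAt_rpow u).const_mul _)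
        ((integrableOn_abs_evalAt_rpow v).const_mul _)]
    refine setIntegral_congr_fun measurableSet_Ioo fun x hx => ?_
    simp only [evalAt_smul_add_smul]
    exact abs_add_rpow_of_mul_eq_zero hp0 a b (h0 x (Ioo_subset_Icc_self hx))
  have henergy : ∀ a b : ℝ, energy p α V (a • u + b • v)
      = |a| ^ p * energy p α V u + |b| ^ p * energy p α V v := by
    intro a b
    have h1 : ∫ x in Ioo (-1 : ℝ) 1, |weakDeriv (a • u + b • v) x| ^ p
        = |a| ^ p * (∫ x in Ioo (-1 : ℝ) 1, |weakDeriv u x| ^ p)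
          + |b| ^ p * ∫ x in Ioo (-1 : ℝ) 1, |weakDeriv v x| ^ p := by
      rw [← integral_const_mul, ← integral_const_mul,
        ← integral_add ((integrableOn_abs_weakDeriv_rpow u).const_mul _)
          ((integrableOn_abs_weakDeriv_rpow v).const_mul _)]
      refine integral_congr_ae ?_
      filter_upwards [weakDeriv_smul_add_smul a b u v, h0'] with x hx hx0
      rw [hx]
      exact abs_add_rpow_of_mul_eq_zero hp0 a b hx0
    have h2 : ∫ x in Ioo (-1 : ℝ) 1, V x * |evalAt (a • u + b • v) x| ^ p
        = |a| ^ p * (∫ x in Ioo (-1 : ℝ) 1, V x * |evalAt u x| ^ p)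
          + |b| ^ p * ∫ x in Ioo (-1 : ℝ) 1, V x * |evalAt v x| ^ p := by
      rw [← integral_const_mul, ← integral_const_mul,
        ← integral_add ((integrableOn_mul_abs_evalAt_rpow hV u).const_mul _)
          ((integrableOn_mul_abs_evalAt_rpow hV v).const_mul _)]
      refine setIntegral_congr_fun measurableSet_Ioo fun x hx => ?_
      simp only [evalAt_smul_add_smul]
      rw [abs_add_rpow_of_mul_eq_zero hp0 a b (h0 x (Ioo_subset_Icc_self hx))]
      ring
    rw [energy_eq hV, energy_eq hV, energy_eq hV, h1, h2, evalAt_smul_add_smul,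
      evalAt_smul_add_smul, abs_add_rpow_of_mul_eq_zero hp0 a b (h0 1 (by norm_num)),
      abs_add_rpow_of_mul_eq_zero hp0 a b (h0 (-1) (by norm_num))]
    ring
  have hind : ∀ a b : ℝ, a • u + b • v = 0 → a = 0 ∧ b = 0 := by
    intro a b hab
    have h1 := hmass a b
    rw [hab] at h1
    have hz : mass p (0 : W1p p) = 0 := by
      have h : ∀ x, evalAt (0 : W1p p) x = 0 := fun _ => rfl
      simp [mass, h, Real.zero_rpow hp0.ne']
    rw [hz] at h1
    have h2 := mass_pos hu
    have h3 := mass_pos hv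
    have h4 : 0 ≤ |a| ^ p := by positivity
    have h5 : 0 ≤ |b| ^ p := by positivity
    have h6 : |a| ^ p = 0 := by nlinarith
    have h7 : |b| ^ p = 0 := by nlinarith
    rw [Real.rpow_eq_zero (abs_nonneg _) hp0.ne', abs_eq_zero] at h6 h7
    exact ⟨h6, h7⟩
  have hmem := circleSet_mem_LSClass hind
  refine eigenvalue_le hV hmem fun w hw => ?_
  have hw0 := ne_zero_of_mem_LSClass hmem hw
  obtain ⟨t, rfl⟩ := hw
  simp only at hw0 ⊢
  rw [rayleigh_le_iff hw0, hmass, henergy]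
  have h4 : 0 ≤ |Real.cos t| ^ p := by positivity
  have h5 : 0 ≤ |Real.sin t| ^ p := by positivity
  nlinarith

/-- Monotonicity and shift of the eigenvalues under a change of the potential. -/
theorem eigenvalue_le_add {V W : ℝ → ℝ} (hV : Continuous V) (hW : Continuous W) {α b : ℝ} {i : ℕ}
    (hne : (LSClass p i).Nonempty) (h : ∀ x ∈ Icc (-1 : ℝ) 1, V x ≤ W x + b) :
    eigenvalue p α V i ≤ eigenvalue p α W i + b := by
  rw [← sub_le_iff_le_add]
  obtain ⟨A, hA⟩ := hne
  obtain ⟨M, hM⟩ := exists_isGreatest_rayleigh hW α hA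
  refine le_csInf ⟨M, A, hA, hM⟩ ?_
  rintro m ⟨B, hB, hm⟩
  rw [sub_le_iff_le_add]
  refine eigenvalue_le hV hB fun u hu => ?_
  have hu0 := ne_zero_of_mem_LSClass hB hu
  refine le_trans ?_ (add_le_add_left (hm.2 ⟨u, hu, rfl⟩) b)
  rw [rayleigh_le_iff hu0, add_mul, rayleigh_eq, div_mul_cancel₀ _ (mass_pos hu0).ne',
    energy_eq hV, energy_eq hW, mass]
  have : ∫ x in Ioo (-1 : ℝ) 1, V x * |evalAt u x| ^ p
      ≤ (∫ x in Ioo (-1 : ℝ) 1, W x * |evalAt u x| ^ p)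
        + b * ∫ x in Ioo (-1 : ℝ) 1, |evalAt u x| ^ p := by
    rw [← integral_const_mul, ← integral_add (integrableOn_mul_abs_evalAt_rpow hW u)
      ((integrableOn_abs_evalAt_rpow u).const_mul _)]
    refine setIntegral_mono_on (integrableOn_mul_abs_evalAt_rpow hV u)
      ((integrableOn_mul_abs_evalAt_rpow hW u).add
        ((integrableOn_abs_evalAt_rpow u).const_mul _)) measurableSet_Ioo fun x hx => ?_
    rw [← add_mul]
    exact mul_le_mul_of_nonneg_right (h x (Ioo_subset_Icc_self hx)) (by positivity)
  linarith

theorem gap_le_add {V W : ℝ → ℝ} (hV : Continuous V) (hW : Continuous W) {α b b' : ℝ}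
    (h : ∀ x ∈ Icc (-1 : ℝ) 1, V x ≤ W x + b) (h' : ∀ x ∈ Icc (-1 : ℝ) 1, W x ≤ V x + b') :
    gap p α V ≤ gap p α W + (b + b') := by
  have h1 := eigenvalue_le_add (p := p) (α := α) hV hW LSClass_one_nonempty h
  have h2 := eigenvalue_le_add (p := p) (α := α) hW hV LSClass_zero_nonempty h'
  rw [gap, gap]
  linarith

theorem gap_congr {V W : ℝ → ℝ} {α : ℝ} (h : ∀ x ∈ Icc (-1 : ℝ) 1, V x = W x) :
    gap p α V = gap p α W := by
  have : rayleigh p α V = rayleigh p α W := by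
    funext u
    rw [rayleigh, rayleigh]
    congr 2
    refine setIntegral_congr_fun measurableSet_Ioo fun x hx => ?_
    simp only [h x (Ioo_subset_Icc_self hx)]
  simp only [gap, eigenvalue, this]

end Minimax

/-! ### An angular coordinate for the Riccati equation

The Riccati equation `r' = V - l - (p - 1) |r| ^ q` blows up in finite time. In the coordinate
`θ ∈ (-p, p)` with `r = riccatiChart p θ` it becomes an equation with a bounded and Lipschitz right
hand side, in which a solution passes smoothly through `r = ∓∞`. -/

/-- The weight of the potential in the angular equation. -/
noncomputable def angleA (p θ : ℝ) : ℝ := max 0 (min 1 ((p - |θ|) / (p - 1))) ^ p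

/-- The weight of the nonlinear term in the angular equation. -/
noncomputable def angleB (q θ : ℝ) : ℝ := min 1 |θ| ^ q

theorem abs_rpow_sub_rpow_le {s x y : ℝ} (hs : 1 ≤ s) (hx : x ∈ Icc (0 : ℝ) 1)
    (hy : y ∈ Icc (0 : ℝ) 1) : |x ^ s - y ^ s| ≤ s * |x - y| := by
  refine (convex_Icc (0 : ℝ) 1).norm_image_sub_le_of_norm_hasDerivWithin_le
    (f := fun x : ℝ => x ^ s) (f' := fun x => s * x ^ (s - 1))
    (fun z _ => (Real.hasDerivAt_rpow_const (Or.inr hs)).hasDerivWithinAt) (fun z hz => ?_) hy hx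
  have h1 : 0 ≤ z ^ (s - 1) := Real.rpow_nonneg hz.1 _
  have h2 : z ^ (s - 1) ≤ 1 := Real.rpow_le_one hz.1 hz.2 (by linarith)
  rw [Real.norm_of_nonneg (by positivity)]
  nlinarith

theorem angleA_base_mem (p θ : ℝ) : max 0 (min 1 ((p - |θ|) / (p - 1))) ∈ Icc (0 : ℝ) 1 :=
  ⟨le_max_left _ _, max_le zero_le_one (min_le_left _ _)⟩

theorem angleB_base_mem (θ : ℝ) : min 1 |θ| ∈ Icc (0 : ℝ) 1 :=
  ⟨le_min zero_le_one (abs_nonneg _), min_le_left _ _⟩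

section Angle

variable {p q : ℝ}

theorem angleA_nonneg (θ : ℝ) : 0 ≤ angleA p θ := Real.rpow_nonneg (angleA_base_mem p θ).1 _

theorem angleA_le_one (hp : 1 < p) (θ : ℝ) : angleA p θ ≤ 1 :=
  Real.rpow_le_one (angleA_base_mem p θ).1 (angleA_base_mem p θ).2 (by linarith)

theorem angleB_nonneg (θ : ℝ) : 0 ≤ angleB q θ := Real.rpow_nonneg (angleB_base_mem θ).1 _

theorem angleB_le_one (hq : 1 < q) (θ : ℝ) : angleB q θ ≤ 1 :=
  Real.rpow_le_one (angleB_base_mem θ).1 (angleB_base_mem θ).2 (by linarith)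

theorem abs_angleA_sub_le (hp : 1 < p) (x y : ℝ) :
    |angleA p x - angleA p y| ≤ p / (p - 1) * |x - y| := by
  refine (abs_rpow_sub_rpow_le hp.le (angleA_base_mem p x) (angleA_base_mem p y)).trans ?_
  have h1 : |max 0 (min 1 ((p - |x|) / (p - 1))) - max 0 (min 1 ((p - |y|) / (p - 1)))|
      ≤ |(p - |x|) / (p - 1) - (p - |y|) / (p - 1)| := by
    refine (abs_max_sub_max_le_max 0 _ 0 _).trans ?_
    rw [sub_self, abs_zero, max_eq_right (abs_nonneg _)]
    refine (abs_min_sub_min_le_max 1 _ 1 _).trans ?_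
    rw [sub_self, abs_zero, max_eq_right (abs_nonneg _)]
  have h2 : |(p - |x|) / (p - 1) - (p - |y|) / (p - 1)| ≤ |x - y| / (p - 1) := by
    rw [← sub_div, abs_div, abs_of_pos (by linarith : 0 < p - 1)]
    refine div_le_div_of_nonneg_right ?_ (by linarith)
    rw [show p - |x| - (p - |y|) = |y| - |x| by ring, abs_sub_comm x y]
    exact abs_abs_sub_abs_le_abs_sub y x
  calc p * |_| ≤ p * (|x - y| / (p - 1)) := by gcongr; exact h1.trans h2
    _ = _ := by ring

theorem abs_angleB_sub_le (hq : 1 < q) (x y : ℝ) :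
    |angleB q x - angleB q y| ≤ q * |x - y| := by
  refine (abs_rpow_sub_rpow_le hq.le (angleB_base_mem x) (angleB_base_mem y)).trans ?_
  refine mul_le_mul_of_nonneg_left ?_ (by linarith)
  refine (abs_min_sub_min_le_max 1 _ 1 _).trans ?_
  rw [sub_self, abs_zero, max_eq_right (abs_nonneg _)]
  exact abs_abs_sub_abs_le_abs_sub x y

theorem angleA_eq_zero (hp : 1 < p) {θ : ℝ} (h : p ≤ |θ|) : angleA p θ = 0 := by
  have : (p - |θ|) / (p - 1) ≤ 0 := div_nonpos_of_nonpos_of_nonneg (by linarith) (by linarith)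
  rw [angleA, max_eq_left ((min_le_right _ _).trans this), Real.zero_rpow (by linarith)]

theorem angleB_eq_one {θ : ℝ} (h : 1 ≤ |θ|) : angleB q θ = 1 := by
  rw [angleB, min_eq_left h, Real.one_rpow]

theorem angleA_pos (hp : 1 < p) {θ : ℝ} (h : |θ| < p) : 0 < angleA p θ := by
  have : 0 < (p - |θ|) / (p - 1) := div_pos (by linarith) (by linarith)
  exact Real.rpow_pos_of_pos (lt_max_of_lt_right (lt_min one_pos this)) _

theorem angleA_le_of_abs_le (hp : 1 < p) {θ η : ℝ} (h : |θ| ≤ |η|) : angleA p η ≤ angleA p θ := by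
  have hp1 : 0 < p - 1 := by linarith
  refine Real.rpow_le_rpow (angleA_base_mem p η).1 ?_ (by linarith)
  gcongr

theorem angleA_eq_one (hp : 1 < p) {θ : ℝ} (h : |θ| ≤ 1) : angleA p θ = 1 := by
  have : 1 ≤ (p - |θ|) / (p - 1) := (one_le_div (by linarith)).2 (by linarith)
  rw [angleA, min_eq_left this, max_eq_right zero_le_one, Real.one_rpow]

theorem angleA_neg (θ : ℝ) : angleA p (-θ) = angleA p θ := by simp [angleA]

theorem angleB_neg (θ : ℝ) : angleB q (-θ) = angleB q θ := by simp [angleB]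

theorem angleA_of_one_le (hp : 1 < p) {θ : ℝ} (h1 : 1 ≤ θ) (h2 : θ < p) :
    angleA p θ = ((p - θ) / (p - 1)) ^ p := by
  have h3 : (p - θ) / (p - 1) ≤ 1 := (div_le_one (by linarith)).2 (by linarith)
  have h4 : 0 ≤ (p - θ) / (p - 1) := div_nonneg (by linarith) (by linarith)
  rw [angleA, abs_of_nonneg (by linarith), min_eq_right h3, max_eq_right h4]

/-- The half of `riccatiChart` to the left of `p`. -/
noncomputable def halfChart (p θ : ℝ) : ℝ := if θ ≤ 1 then θ else ((p - θ) / (p - 1)) ^ (1 - p)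

/-- The coordinate change `r = riccatiChart p θ`, `-p < θ < p`. -/
noncomputable def riccatiChart (p θ : ℝ) : ℝ := halfChart p θ - halfChart p (-θ) - θ

theorem riccatiChart_neg (θ : ℝ) : riccatiChart p (-θ) = -riccatiChart p θ := by
  simp only [riccatiChart, neg_neg]
  ring

theorem riccatiChart_of_abs_le {θ : ℝ} (h : |θ| ≤ 1) : riccatiChart p θ = θ := by
  rw [abs_le] at h
  rw [riccatiChart, halfChart, halfChart, if_pos h.2, if_pos (by linarith)]
  ring

theorem riccatiChart_of_one_lt {θ : ℝ} (h : 1 < θ) :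
    riccatiChart p θ = ((p - θ) / (p - 1)) ^ (1 - p) := by
  rw [riccatiChart, halfChart, halfChart, if_neg (by linarith), if_pos (by linarith)]
  ring

theorem hasDerivAt_halfChart (hp : 1 < p) {θ : ℝ} (hθ : θ < p) :
    HasDerivAt (halfChart p) (if θ ≤ 1 then 1 else ((p - θ) / (p - 1)) ^ (-p)) θ := by
  have hp1 : 0 < p - 1 := by linarith
  have hpow : ∀ η < p, HasDerivAt (fun θ : ℝ => ((p - θ) / (p - 1)) ^ (1 - p))
      (((p - η) / (p - 1)) ^ (-p)) η := fun η hη => by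
    have h1 : HasDerivAt (fun θ : ℝ => (p - θ) / (p - 1)) (-1 / (p - 1)) η := by
      simpa using ((hasDerivAt_id η).const_sub p).div_const (p - 1)
    have h2 := h1.rpow_const (p := 1 - p) (Or.inl (div_pos (by linarith) hp1).ne')
    refine h2.congr_deriv ?_
    rw [show 1 - p - 1 = -p by ring]
    field_simp
    ring
  rcases lt_trichotomy θ 1 with h | rfl | h
  · rw [if_pos h.le]
    refine (hasDerivAt_id θ).congr_of_eventuallyEq ?_
    filter_upwards [Iio_mem_nhds h] with y hy
    rw [halfChart, if_pos (le_of_lt hy), id]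
  · rw [if_pos le_rfl]
    have h1 := hpow 1 hθ
    rw [div_self hp1.ne', Real.one_rpow] at h1
    refine hasDerivAt_of_eqOn_Iic_Ici (hasDerivAt_id 1) h1
      (fun y hy => by rw [halfChart, if_pos (mem_Iic.1 hy), id]) (fun y hy => ?_)
    rcases eq_or_lt_of_le (show (1 : ℝ) ≤ y from hy) with rfl | hy
    · simp [halfChart, div_self hp1.ne']
    · rw [halfChart, if_neg (by linarith)]
  · rw [if_neg (by linarith)]
    refine (hpow θ hθ).congr_of_eventuallyEq ?_
    filter_upwards [Ioi_mem_nhds h] with y hy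
    rw [halfChart, if_neg (not_le.2 hy)]

/-- The outer branch agrees with the identity to first order at `|θ| = 1`, and its exponent `1 - p`
makes its derivative the reciprocal of the weight, which vanishes at `|θ| = p`. -/
theorem hasDerivAt_riccatiChart (hp : 1 < p) {θ : ℝ} (hθ : |θ| < p) :
    HasDerivAt (riccatiChart p) (angleA p θ)⁻¹ θ := by
  obtain ⟨h1, h2⟩ := abs_lt.1 hθ
  have hd := ((hasDerivAt_halfChart hp h2).sub
    ((hasDerivAt_halfChart hp (by linarith : -θ < p)).comp θ (hasDerivAt_neg θ))).sub
    (hasDerivAt_id θ)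
  refine hd.congr_deriv ?_
  rcases lt_or_ge 1 θ with h | h
  · rw [if_neg (by linarith), if_pos (by linarith), angleA_of_one_le hp h.le h2,
      ← Real.rpow_neg (div_nonneg (by linarith) (by linarith))]
    ring
  · rcases lt_or_ge θ (-1) with h' | h'
    · rw [if_pos (by linarith), if_neg (by linarith), ← angleA_neg,
        angleA_of_one_le hp (by linarith) (by linarith),
        ← Real.rpow_neg (div_nonneg (by linarith) (by linarith))]
      ring
    · rw [if_pos (by linarith), if_pos (by linarith), angleA_eq_one hp (abs_le.2 ⟨h', h⟩)]
      ring

/-- Since `p + (1-p) q = 0`, the weight exactly compensates the growth of `|r|^q` at a pole.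
Multiplying the Riccati equation by `angleA` therefore gives the bounded equation `θ' = (V - l) A -
(p-1) B`. -/
theorem angleA_mul_abs_riccatiChart (hpq : p.HolderConjugate q) {θ : ℝ} (hθ : |θ| < p) :
    angleA p θ * |riccatiChart p θ| ^ q = angleB q θ := by
  have hp := hpq.lt
  have key : ∀ θ : ℝ, 1 < θ → θ < p →
      angleA p θ * |riccatiChart p θ| ^ q = angleB q θ := fun θ h1 h2 => by
    have hy : 0 < (p - θ) / (p - 1) := div_pos (by linarith) (by linarith)
    rw [angleB_eq_one (by rw [abs_of_pos (by linarith)]; exact h1.le), riccatiChart_of_one_lt h1,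
      angleA_of_one_le hp h1.le h2, abs_of_pos (Real.rpow_pos_of_pos hy _), ← Real.rpow_mul hy.le,
      ← Real.rpow_add hy, show p + (1 - p) * q = p - (p - 1) * q by ring, hpq.sub_one_mul_conj,
      sub_self, Real.rpow_zero]
  obtain ⟨h1, h2⟩ := abs_lt.1 hθ
  rcases le_or_gt |θ| 1 with h | h
  · rw [riccatiChart_of_abs_le h, angleA_eq_one hp h, angleB, min_eq_right h, one_mul]
  · rcases lt_abs.1 h with h | h
    · exact key θ h h2
    · have := key (-θ) h (by linarith)
      rwa [angleA_neg, angleB_neg, riccatiChart_neg, abs_neg] at this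

theorem exists_riccatiChart_eq (hp : 1 < p) (β : ℝ) : ∃ τ, |τ| < p ∧ riccatiChart p τ = β := by
  have key : ∀ β : ℝ, 0 ≤ β → ∃ τ, |τ| < p ∧ riccatiChart p τ = β := fun β hβ => by
    rcases le_or_gt β 1 with h | h
    · have hb : |β| ≤ 1 := by rwa [abs_of_nonneg hβ]
      exact ⟨β, by linarith, riccatiChart_of_abs_le hb⟩
    · have hp1 : 0 < p - 1 := by linarith
      -- This solves `y^(1-p) = β`, where `y = (p - τ)/(p - 1)`.
      set y := β ^ (-(p - 1)⁻¹) with hy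
      have hy0 : 0 < y := Real.rpow_pos_of_pos (by linarith) _
      have hy1 : y < 1 := Real.rpow_lt_one_of_one_lt_of_neg h (by simpa using hp)
      have hτ : 1 < p - (p - 1) * y := by nlinarith
      refine ⟨p - (p - 1) * y, ?_, ?_⟩
      · rw [abs_of_pos (by linarith)]
        nlinarith
      · rw [riccatiChart_of_one_lt hτ, sub_sub_cancel, mul_div_cancel_left₀ _ hp1.ne', hy,
          ← Real.rpow_mul (by linarith), show -(p - 1)⁻¹ * (1 - p) = 1 by field_simp; ring,
          Real.rpow_one]
  rcases le_total 0 β with h | h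
  · exact key β h
  · obtain ⟨τ, h1, h2⟩ := key (-β) (by linarith)
    exact ⟨-τ, by rwa [abs_neg], by rw [riccatiChart_neg, h2, neg_neg]⟩

theorem strictMonoOn_riccatiChart (hp : 1 < p) : StrictMonoOn (riccatiChart p) (Ioo (-p) p) := by
  have hd : ∀ θ ∈ Ioo (-p) p, HasDerivAt (riccatiChart p) (angleA p θ)⁻¹ θ := fun θ hθ =>
    hasDerivAt_riccatiChart hp (abs_lt.2 hθ)
  refine strictMonoOn_of_deriv_pos (convex_Ioo _ _)
    (fun θ hθ => (hd θ hθ).continuousAt.continuousWithinAt) fun θ hθ => ?_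
  rw [interior_Ioo] at hθ
  rw [(hd θ hθ).deriv]
  exact inv_pos.2 (angleA_pos hp (abs_lt.2 hθ))

theorem tendsto_riccatiChart (hp : 1 < p) : Tendsto (riccatiChart p) (𝓝[<] p) atTop := by
  rw [tendsto_atTop]
  intro M
  obtain ⟨τ, hτ, hM⟩ := exists_riccatiChart_eq hp M
  rw [abs_lt] at hτ
  filter_upwards [Ioo_mem_nhdsLT hτ.2] with θ hθ
  rw [← hM]
  exact (strictMonoOn_riccatiChart hp hτ ⟨hτ.1.trans hθ.1, hθ.2⟩ hθ.1).le

/-! ### The angular equation -/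

/-- The right hand side of the angular equation, covering two adjacent periods. -/
noncomputable def angleField (p q : ℝ) (V : ℝ → ℝ) (l x θ : ℝ) : ℝ :=
  (V x - l) * (angleA p θ + angleA p (θ + 2 * p))
    - (p - 1) * (angleB q θ + angleB q (θ + 2 * p) - 1)

theorem angleField_of_ge (hp : 1 < p) {V : ℝ → ℝ} {l x θ : ℝ} (h : -p ≤ θ) :
    angleField p q V l x θ = (V x - l) * angleA p θ - (p - 1) * angleB q θ := by
  have h1 : p ≤ |θ + 2 * p| := (by linarith : p ≤ θ + 2 * p).trans (le_abs_self _)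
  rw [angleField, angleA_eq_zero hp h1, angleB_eq_one (hp.le.trans h1)]
  ring

theorem angleField_of_le (hp : 1 < p) {V : ℝ → ℝ} {l x θ : ℝ} (h : θ ≤ -p) :
    angleField p q V l x θ
      = (V x - l) * angleA p (θ + 2 * p) - (p - 1) * angleB q (θ + 2 * p) := by
  have h1 : p ≤ |θ| := (by linarith : p ≤ -θ).trans (neg_le_abs _)
  rw [angleField, angleA_eq_zero hp h1, angleB_eq_one (hp.le.trans h1)]
  ring

/-- The poles sit at the angles `p`, `-p`, `-3p`. There the weight of the potential vanishes and the
field is negative whatever `V` and `l` are, so each of these angles can only be crossed downwards.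
-/
theorem angleField_node (hp : 1 < p) {V : ℝ → ℝ} {l x θ : ℝ} (h1 : p ≤ |θ|)
    (h2 : p ≤ |θ + 2 * p|) : angleField p q V l x θ = -(p - 1) := by
  rw [angleField, angleA_eq_zero hp h1, angleB_eq_one (hp.le.trans h1), angleA_eq_zero hp h2,
    angleB_eq_one (hp.le.trans h2)]
  ring

theorem abs_angleField_sub_le (hp : 1 < p) (hq : 1 < q) {V : ℝ → ℝ} {l x M : ℝ}
    (hM : |V x| ≤ M) (θ η : ℝ) :
    |angleField p q V l x θ - angleField p q V l x η|
      ≤ ((M + |l|) * (2 * (p / (p - 1))) + (p - 1) * (2 * q)) * |θ - η| := by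
  have a1 := abs_angleA_sub_le hp θ η
  have a2 := abs_angleA_sub_le hp (θ + 2 * p) (η + 2 * p)
  have b1 := abs_angleB_sub_le hq θ η
  have b2 := abs_angleB_sub_le hq (θ + 2 * p) (η + 2 * p)
  rw [add_sub_add_right_eq_sub] at a2 b2
  have hv : |V x - l| ≤ M + |l| := (abs_sub _ _).trans (by linarith)
  have e : angleField p q V l x θ - angleField p q V l x η
      = (V x - l) * ((angleA p θ - angleA p η) + (angleA p (θ + 2 * p) - angleA p (η + 2 * p)))
        - (p - 1) * ((angleB q θ - angleB q η) + (angleB q (θ + 2 * p) - angleB q (η + 2 * p))) := by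
    rw [angleField, angleField]
    ring
  rw [e]
  refine (abs_sub _ _).trans ?_
  rw [abs_mul, abs_mul, abs_of_pos (by linarith : 0 < p - 1)]
  calc _ ≤ (M + |l|) * (p / (p - 1) * |θ - η| + p / (p - 1) * |θ - η|)
        + (p - 1) * (q * |θ - η| + q * |θ - η|) := by
        gcongr
        · exact (abs_nonneg _).trans hv
        · exact (abs_add_le _ _).trans (add_le_add a1 a2)
        · exact (abs_add_le _ _).trans (add_le_add b1 b2)
    _ = _ := by ring

theorem abs_angleField_le (hp : 1 < p) (hq : 1 < q) {V : ℝ → ℝ} {l x M : ℝ}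
    (hM : |V x| ≤ M) (θ : ℝ) : |angleField p q V l x θ| ≤ (M + |l|) * 2 + (p - 1) := by
  have hv : |V x - l| ≤ M + |l| := (abs_sub _ _).trans (by linarith)
  refine (abs_sub _ _).trans ?_
  rw [abs_mul, abs_mul, abs_of_pos (by linarith : 0 < p - 1)]
  have a1 := angleA_nonneg (p := p) θ
  have a2 := angleA_nonneg (p := p) (θ + 2 * p)
  have a3 := angleA_le_one hp θ
  have a4 := angleA_le_one hp (θ + 2 * p)
  have b1 := angleB_nonneg (q := q) θ
  have b2 := angleB_nonneg (q := q) (θ + 2 * p)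
  have b3 := angleB_le_one hq θ
  have b4 := angleB_le_one hq (θ + 2 * p)
  have hA : |angleA p θ + angleA p (θ + 2 * p)| ≤ 2 := abs_le.2 ⟨by linarith, by linarith⟩
  have hB : |angleB q θ + angleB q (θ + 2 * p) - 1| ≤ 1 := abs_le.2 ⟨by linarith, by linarith⟩
  have h0 : 0 ≤ M + |l| := (abs_nonneg _).trans hv
  calc _ ≤ (M + |l|) * 2 + (p - 1) * 1 := by gcongr
    _ = _ := by ring

theorem exists_angle_solution (hp : 1 < p) (hq : 1 < q) {V : ℝ → ℝ} (hV : Continuous V)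
    (l θ₀ : ℝ) : ∃ θ : ℝ → ℝ, θ (-1) = θ₀ ∧
      ∀ x ∈ Icc (-1 : ℝ) 1, HasDerivAt θ (angleField p q V l x (θ x)) x := by
  obtain ⟨M, hM⟩ := (isCompact_Icc (a := (-2 : ℝ)) (b := 2)).exists_bound_of_continuousOn
    hV.continuousOn
  simp only [Real.norm_eq_abs] at hM
  have hM0 : 0 ≤ M := (abs_nonneg _).trans (hM 0 (by norm_num))
  have hL0 : 0 ≤ (M + |l|) * 2 + (p - 1) := by
    have : 0 ≤ p - 1 := by linarith
    positivity
  have hK0 : 0 ≤ (M + |l|) * (2 * (p / (p - 1))) + (p - 1) * (2 * q) := by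
    have : 0 ≤ p - 1 := by linarith
    positivity
  -- Solving on `[-2, 2]` yields two-sided derivatives at both end points of `[-1, 1]`. The radius
  -- is the bound on the field times 3, the longest time elapsed from `-1`.
  have hPL : IsPicardLindelof (angleField p q V l) (tmin := -2) (tmax := 2)
      ⟨-1, by norm_num⟩ θ₀ (((M + |l|) * 2 + (p - 1)).toNNReal * 3) 0
      ((M + |l|) * 2 + (p - 1)).toNNReal
      ((M + |l|) * (2 * (p / (p - 1))) + (p - 1) * (2 * q)).toNNReal := by
    refine ⟨fun x hx => LipschitzOnWith.of_dist_le_mul fun θ _ η _ => ?_, fun θ _ => ?_,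
      fun x hx θ _ => ?_, ?_⟩
    · rw [Real.coe_toNNReal _ hK0]
      exact abs_angleField_sub_le hp hq (hM x hx) θ η
    · exact (((hV.sub continuous_const).mul continuous_const).sub
        continuous_const).continuousOn
    · rw [Real.coe_toNNReal _ hL0]
      exact abs_angleField_le hp hq (hM x hx) θ
    · norm_num
  obtain ⟨θ, h1, h2⟩ := hPL.exists_eq_forall_mem_Icc_hasDerivWithinAt₀
  refine ⟨θ, h1, fun x hx => ?_⟩
  exact (h2 x ⟨by linarith [hx.1], by linarith [hx.2]⟩).hasDerivAt
    (Icc_mem_nhds (by linarith [hx.1]) (by linarith [hx.2]))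

/-- The fields at levels `l` and `l'` differ by at most `2|l' - l|`, so Grönwall's inequality
controls the distance of the trajectories. -/
theorem continuous_angle_solution (hp : 1 < p) (hq : 1 < q) {V : ℝ → ℝ} (hV : Continuous V)
    {θ₀ : ℝ} {θ : ℝ → ℝ → ℝ} (h0 : ∀ l, θ l (-1) = θ₀)
    (hθ : ∀ l, ∀ x ∈ Icc (-1 : ℝ) 1, HasDerivAt (θ l) (angleField p q V l x (θ l x)) x) :
    Continuous fun l => θ l 1 := by
  obtain ⟨M, hM⟩ := (isCompact_Icc (a := (-1 : ℝ)) (b := 1)).exists_bound_of_continuousOn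
    hV.continuousOn
  simp only [Real.norm_eq_abs] at hM
  have hM0 : 0 ≤ M := (abs_nonneg _).trans (hM 0 (by norm_num))
  rw [continuous_iff_continuousAt]
  intro l
  have hK0 : 0 ≤ (M + |l|) * (2 * (p / (p - 1))) + (p - 1) * (2 * q) := by
    have : 0 ≤ p - 1 := by linarith
    positivity
  set K := ((M + |l|) * (2 * (p / (p - 1))) + (p - 1) * (2 * q)).toNNReal
  have key : ∀ l' : ℝ, dist (θ l' 1) (θ l 1) ≤ gronwallBound 0 K (|l' - l| * 2 + 0) (1 - -1) := by
    intro l'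
    refine dist_le_of_approx_trajectories_ODE_of_mem (v := angleField p q V l)
      (s := fun _ => univ) (a := -1) (b := 1) (f' := fun x => angleField p q V l' x (θ l' x))
      (g' := fun x => angleField p q V l x (θ l x)) ?_ ?_ ?_ ?_ ?_ ?_ ?_ ?_ ?_ ?_ 1 (by norm_num)
    · intro x hx
      refine (LipschitzOnWith.of_dist_le_mul fun a _ b _ => ?_)
      rw [Real.coe_toNNReal _ hK0]
      exact abs_angleField_sub_le hp hq (hM x (Ico_subset_Icc_self hx)) a b
    · exact fun x hx => (hθ l' x hx).continuousAt.continuousWithinAt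
    · exact fun x hx => (hθ l' x (Ico_subset_Icc_self hx)).hasDerivWithinAt
    · intro x _
      rw [Real.dist_eq, angleField, angleField]
      have e : ∀ a b : ℝ, (V x - l') * a - b - ((V x - l) * a - b) = -((l' - l) * a) := by
        intros
        ring
      rw [e, abs_neg, abs_mul]
      have a1 := angleA_nonneg (p := p) (θ l' x)
      have a2 := angleA_nonneg (p := p) (θ l' x + 2 * p)
      have a3 := angleA_le_one hp (θ l' x)
      have a4 := angleA_le_one hp (θ l' x + 2 * p)
      gcongr
      exact abs_le.2 ⟨by linarith, by linarith⟩
    · exact fun _ _ => mem_univ _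
    · exact fun x hx => (hθ l x hx).continuousAt.continuousWithinAt
    · exact fun x hx => (hθ l x (Ico_subset_Icc_self hx)).hasDerivWithinAt
    · intro x _
      simp
    · exact fun _ _ => mem_univ _
    · rw [h0, h0, dist_self]
  have hlim : Tendsto (fun l' : ℝ => gronwallBound 0 K (|l' - l| * 2 + 0) (1 - -1)) (𝓝 l)
      (𝓝 0) := by
    have h1 : Continuous fun l' : ℝ => gronwallBound 0 K (|l' - l| * 2 + 0) (1 - -1) :=
      (gronwallBound_continuous_ε 0 K (1 - -1)).comp (by fun_prop)
    have h2 := h1.tendsto l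
    simpa [gronwallBound_ε0_δ0] using h2
  exact tendsto_iff_dist_tendsto_zero.2
    (squeeze_zero (fun _ => dist_nonneg) key hlim)

end Angle

/-! ### Shooting -/

section Shooting

variable {p q : ℝ}

theorem continuous_angleA (hp : 1 < p) : Continuous (angleA p) := by
  unfold angleA
  exact (continuous_const.max (continuous_const.min
    ((continuous_const.sub continuous_abs).div_const _))).rpow_const
      fun _ => Or.inr (by linarith)

theorem continuous_angleB (hq : 1 < q) : Continuous (angleB q) := by
  unfold angleB
  exact (continuous_const.min continuous_abs).rpow_const fun _ => Or.inr (by linarith)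

/-- For very negative `l` the line `τ x`, which starts at `-τ` and ends at `τ`, is a lower barrier:
along it `|τ x| ≤ |τ| < p` keeps `angleA` away from zero, and the term `(V - l) A` dominates. -/
theorem exists_lt_angle_solution (hp : 1 < p) (hq : 1 < q) {V : ℝ → ℝ} (hV : Continuous V)
    {τ : ℝ} (hτ : |τ| < p) {θ : ℝ → ℝ → ℝ} (h0 : ∀ l, θ l (-1) = -τ)
    (hθ : ∀ l, ∀ x ∈ Icc (-1 : ℝ) 1, HasDerivAt (θ l) (angleField p q V l x (θ l x)) x) :
    ∃ l, τ < θ l 1 := by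
  obtain ⟨M, hM⟩ := (isCompact_Icc (a := (-1 : ℝ)) (b := 1)).exists_bound_of_continuousOn
    hV.continuousOn
  have ha := angleA_pos hp hτ
  set l := -M - (|τ| + p) / angleA p τ with hl
  refine ⟨l, ?_⟩
  have hz := neg_of_deriv_neg_at_zeros (z := fun x => τ * x - θ l x)
    (z' := fun x => τ - angleField p q V l x (θ l x)) (a := -1) (b := 1) (x := 1)
    (fun x hx => (((hasDerivAt_id x).const_mul τ).sub (hθ l x hx)).congr_deriv (by simp))
    (fun x hx hzero => ?_) (by simp [h0]) (by norm_num)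
  · simp only [mul_one] at hz
    linarith
  · have hxθ : θ l x = τ * x := by linarith
    have habs : |τ * x| ≤ |τ| := by
      rw [abs_mul]
      exact mul_le_of_le_one_right (abs_nonneg _) (abs_le.2 hx)
    have h1 := angleA_le_of_abs_le hp habs
    have h2 : (|τ| + p) / angleA p τ ≤ V x - l := by
      have := neg_le_of_abs_le (hM x hx)
      rw [hl]
      linarith
    have h3 : |τ| + p ≤ (V x - l) * angleA p (τ * x) := by
      have hnn : 0 ≤ (|τ| + p) / angleA p τ := by positivity
      calc |τ| + p = (|τ| + p) / angleA p τ * angleA p τ := by field_simp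
        _ ≤ _ := by gcongr; linarith
    have h4 : -p ≤ τ * x := (abs_le.1 (habs.trans hτ.le)).1
    have h5 := angleB_le_one hq (τ * x)
    simp only [hxθ]
    rw [angleField_of_ge hp h4]
    have := le_abs_self τ
    nlinarith

/-- For large `l` the curve `σ` is an upper barrier. It descends from `p` at `-1` through `-p` at
`0` to `-3p` at `1`, and is flat at exactly these points of `[-1, 1]`. There `l` has no influence,
but the field is `-(p-1) < 0 = σ'`; elsewhere the weight of `l` is positive and a large `l` pushes
the field below `σ'`. -/
theorem exists_forall_angle_solution_lt (hp : 1 < p) (hq : 1 < q) {V : ℝ → ℝ} (hV : Continuous V)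
    {τ : ℝ} (hτ : |τ| < p) {θ : ℝ → ℝ → ℝ} (h0 : ∀ l, θ l (-1) = -τ)
    (hθ : ∀ l, ∀ x ∈ Icc (-1 : ℝ) 1, HasDerivAt (θ l) (angleField p q V l x (θ l x)) x) :
    ∃ L, ∀ l ≥ L, θ l 1 < -3 * p := by
  obtain ⟨M, hM⟩ := (isCompact_Icc (a := (-1 : ℝ)) (b := 1)).exists_bound_of_continuousOn
    hV.continuousOn
  set σ : ℝ → ℝ := fun x => -p - p * (x ^ 3 * (5 - 3 * x ^ 2)) with hσ
  set σ' : ℝ → ℝ := fun x => -15 * p * (x ^ 2 * (1 - x ^ 2)) with hσ'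
  have hσd : ∀ x, HasDerivAt σ (σ' x) x := fun x => by
    have h1 := ((((hasDerivAt_pow 3 x).mul
      (((hasDerivAt_pow 2 x).const_mul 3).const_sub 5)).const_mul p).const_sub (-p))
    refine h1.congr_deriv ?_
    simp only [hσ']
    push_cast
    ring
  set A : ℝ → ℝ := fun x => angleA p (σ x) + angleA p (σ x + 2 * p) with hA
  set B : ℝ → ℝ := fun x => angleB q (σ x) + angleB q (σ x + 2 * p) - 1 with hB
  have hσc : Continuous σ := by fun_prop
  have hAc : Continuous A := ((continuous_angleA hp).comp hσc).add
    ((continuous_angleA hp).comp (hσc.add continuous_const))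
  have hBc : Continuous B := (((continuous_angleB hq).comp hσc).add
    ((continuous_angleB hq).comp (hσc.add continuous_const))).sub continuous_const
  have hσ'c : Continuous σ' := by fun_prop
  have hA0 : ∀ x, 0 ≤ A x := fun x => add_nonneg (angleA_nonneg _) (angleA_nonneg _)
  have hpt : ∀ x ∈ Icc (-1 : ℝ) 1, ∃ K, -K * A x - (p - 1) * B x < σ' x := by
    intro x hx
    rcases (hA0 x).lt_or_eq with hpos | hzero
    · refine ⟨(1 - (p - 1) * B x - σ' x) / A x, ?_⟩
      rw [neg_mul, div_mul_cancel₀ _ hpos.ne']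
      linarith
    · have hx3 : x = -1 ∨ x = 0 ∨ x = 1 := by
        by_contra! hne
        obtain ⟨hn1, hn2, hn3⟩ := hne
        have h1 : -1 < x := lt_of_le_of_ne hx.1 hn1.symm
        have h2 : x < 1 := lt_of_le_of_ne hx.2 hn3
        have hsum : angleA p (σ x) = 0 ∧ angleA p (σ x + 2 * p) = 0 :=
          (add_eq_zero_iff_of_nonneg (angleA_nonneg _) (angleA_nonneg _)).1 hzero.symm
        rcases lt_or_gt_of_ne hn2 with hneg | hposx
        · have e1 : x ^ 3 * (5 - 3 * x ^ 2) < 0 :=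
            mul_neg_of_neg_of_pos (Odd.pow_neg (by decide) hneg) (by nlinarith)
          have e2 : 0 < 2 + x ^ 3 * (5 - 3 * x ^ 2) := by
            have : 2 + x ^ 3 * (5 - 3 * x ^ 2)
                = (1 + x) ^ 2 * (2 - 4 * x + 6 * x ^ 2 - 3 * x ^ 3) := by ring
            rw [this]
            have h3 : x ^ 3 < 0 := Odd.pow_neg (by decide) hneg
            have h4 : 0 < 1 + x := by linarith
            exact mul_pos (by positivity) (by nlinarith)
          refine (angleA_pos hp (θ := σ x) ?_).ne' hsum.1
          rw [abs_lt]
          simp only [hσ]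
          constructor <;> nlinarith
        · have e1 : 0 < x ^ 3 * (5 - 3 * x ^ 2) := mul_pos (by positivity) (by nlinarith)
          have e2 : 0 < 2 - x ^ 3 * (5 - 3 * x ^ 2) := by
            have : 2 - x ^ 3 * (5 - 3 * x ^ 2)
                = (1 - x) ^ 2 * (2 + 4 * x + 6 * x ^ 2 + 3 * x ^ 3) := by ring
            rw [this]
            have h4 : 0 < 1 - x := by linarith
            positivity
          refine (angleA_pos hp (θ := σ x + 2 * p) ?_).ne' hsum.2
          rw [abs_lt]
          simp only [hσ]
          constructor <;> nlinarith
      refine ⟨0, ?_⟩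
      have hs : σ' x = 0 := by
        rcases hx3 with rfl | rfl | rfl <;> simp [hσ']
      have hsx : p ≤ |σ x| ∧ p ≤ |σ x + 2 * p| := by
        rcases hx3 with rfl | rfl | rfl <;> simp only [hσ]
        · exact ⟨(by linarith : p ≤ _).trans (le_abs_self _),
            (by linarith : p ≤ _).trans (le_abs_self _)⟩
        · exact ⟨(by linarith : p ≤ _).trans (neg_le_abs _),
            (by linarith : p ≤ _).trans (le_abs_self _)⟩
        · exact ⟨(by linarith : p ≤ _).trans (neg_le_abs _),
            (by linarith : p ≤ _).trans (neg_le_abs _)⟩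
      have hBx : B x = 1 := by
        simp only [hB]
        rw [angleB_eq_one (hp.le.trans hsx.1), angleB_eq_one (hp.le.trans hsx.2)]
        ring
      rw [hs, hBx]
      linarith
  -- The pointwise strict inequality is open in `x` and persists for larger `k` because `A ≥ 0`, so
  -- compactness gives a uniform threshold.
  obtain ⟨K, hK⟩ : ∃ K, ∀ k ≥ K, ∀ x ∈ Icc (-1 : ℝ) 1, -k * A x - (p - 1) * B x < σ' x := by
    refine isCompact_Icc.induction_on
      (p := fun s => ∃ K, ∀ k ≥ K, ∀ x ∈ s, -k * A x - (p - 1) * B x < σ' x) ⟨0, by simp⟩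
      (fun s t hst ⟨K, hK⟩ => ⟨K, fun k hk x hx => hK k hk x (hst hx)⟩)
      (fun s t ⟨K, hK⟩ ⟨K', hK'⟩ => ⟨max K K', fun k hk x hx => ?_⟩) fun x hx => ?_
    · rcases hx with hx | hx
      · exact hK k ((le_max_left _ _).trans hk) x hx
      · exact hK' k ((le_max_right _ _).trans hk) x hx
    · obtain ⟨K, hK⟩ := hpt x hx
      have hcont : Continuous fun x => -K * A x - (p - 1) * B x :=
        (hAc.const_mul _).sub (hBc.const_mul _)
      refine ⟨{y | -K * A y - (p - 1) * B y < σ' y}, mem_nhdsWithin_of_mem_nhds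
        ((isOpen_lt hcont hσ'c).mem_nhds hK), K, fun k hk y hy => lt_of_le_of_lt ?_ hy⟩
      have := mul_le_mul_of_nonneg_right hk (hA0 y)
      linarith
  refine ⟨M + K, fun l hl => ?_⟩
  have hz := neg_of_deriv_neg_at_zeros (z := fun x => θ l x - σ x)
    (z' := fun x => angleField p q V l x (θ l x) - σ' x) (a := -1) (b := 1) (x := 1)
    (fun x hx => (hθ l x hx).sub (hσd x)) (fun x hx hzero => ?_) ?_ (by norm_num)
  · simp only [hσ] at hz
    linarith
  · have hxθ : θ l x = σ x := by linarith
    have h1 := hK (l - M) (by linarith) x hx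
    have h2 := le_of_abs_le (hM x hx)
    have h3 : (V x - l) * A x ≤ -(l - M) * A x :=
      mul_le_mul_of_nonneg_right (by linarith) (hA0 x)
    simp only [hxθ, angleField]
    change (V x - l) * A x - (p - 1) * B x - σ' x < 0
    linarith
  · simp only [hσ, h0]
    have := neg_le_abs τ
    linarith

/-- A solution of the Riccati equation obtained from a solution of the angular equation. -/
theorem hasDerivAt_riccatiChart_comp (hpq : p.HolderConjugate q) {θ : ℝ → ℝ} {x v : ℝ}
    (hθ : |θ x| < p) (h : HasDerivAt θ (v * angleA p (θ x) - (p - 1) * angleB q (θ x)) x) :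
    HasDerivAt (fun y => riccatiChart p (θ y))
      (v - (p - 1) * |riccatiChart p (θ x)| ^ q) x := by
  refine ((hasDerivAt_riccatiChart hpq.lt hθ).comp x h).congr_deriv ?_
  have h1 := angleA_mul_abs_riccatiChart hpq hθ
  have h2 := angleA_pos hpq.lt hθ
  rw [← h1]
  field_simp

/-- Existence of the first two eigenvalues, with the solutions of the Riccati equation belonging to
them: the first without singularity, the second with a single singularity `c`. -/
theorem exists_riccati (hpq : p.HolderConjugate q) {V : ℝ → ℝ} (hV : Continuous V) (α : ℝ) :
    ∃ (l₀ l₁ c : ℝ) (r₀ r s : ℝ → ℝ), l₀ < l₁ ∧ c ∈ Ioo (-1 : ℝ) 1 ∧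
      (∀ x ∈ Icc (-1 : ℝ) 1, HasDerivAt r₀ (V x - l₀ - (p - 1) * |r₀ x| ^ q) x) ∧
      r₀ 1 = -α ∧ r₀ (-1) = α ∧
      (∀ x ∈ Ioc c 1, HasDerivAt r (V x - l₁ - (p - 1) * |r x| ^ q) x) ∧
      r 1 = -α ∧ Tendsto r (𝓝[>] c) atTop ∧
      (∀ x ∈ Ico (-1) c, HasDerivAt s (V x - l₁ - (p - 1) * |s x| ^ q) x) ∧
      s (-1) = α ∧ Tendsto s (𝓝[<] c) atBot := by
  have hp := hpq.lt
  have hq := hpq.symm.lt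
  obtain ⟨τ, hτ, hτα⟩ := exists_riccatiChart_eq hp (-α)
  have hτ' := abs_lt.1 hτ
  choose θ h0 hθ using fun l => exists_angle_solution hp hq hV l (-τ)
  have hcont := continuous_angle_solution hp hq hV h0 hθ
  obtain ⟨k, hk⟩ := exists_lt_angle_solution hp hq hV hτ h0 hθ
  obtain ⟨L, hL⟩ := exists_forall_angle_solution_lt hp hq hV hτ h0 hθ
  -- The start `-τ` encodes `r(-1) = α`. The end angles `τ` and `τ - 2p` both encode `r(1) = -α`,
  -- reached without a pole and after one pole; the second lies above `-3p`, within reach of the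
  -- shooting.
  obtain ⟨l₀, hl₀⟩ : ∃ l, θ l 1 = τ := mem_range_of_exists_le_of_exists_ge hcont
    ⟨L, by linarith [hL L le_rfl]⟩ ⟨k, hk.le⟩
  obtain ⟨l₁, hl₁, hl₁'⟩ : τ - 2 * p ∈ (fun l => θ l 1) '' Icc l₀ (max L l₀) :=
    intermediate_value_Icc' (le_max_right _ _) hcont.continuousOn
      ⟨by linarith [hL _ (le_max_left L l₀)], by simp only [hl₀]; linarith⟩
  simp only at hl₁'
  have hlt : l₀ < l₁ := by
    refine lt_of_le_of_ne hl₁.1 fun h => ?_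
    rw [← h, hl₀] at hl₁'
    linarith
  -- One-way crossing of the pole angles keeps the trajectory at `l₀` inside `(-p, p)` and lets the
  -- one at `l₁` meet `-p` exactly once, at `c`.
  have hbar : ∀ l k a : ℝ, p ≤ |k| → p ≤ |k + 2 * p| → -1 ≤ a → θ l a ≤ k →
      ∀ x ∈ Ioc a 1, θ l x < k := by
    intro l k a hk1 hk2 ha hak x hx
    have := neg_of_deriv_neg_at_zeros (z := fun x => θ l x - k)
      (z' := fun x => angleField p q V l x (θ l x)) (a := a) (b := 1) (x := x)
      (fun y hy => (hθ l y ⟨ha.trans hy.1, hy.2⟩).sub_const k) (fun y _ hy0 => ?_)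
      (by linarith) hx
    · linarith
    · rw [show θ l y = k by linarith, angleField_node hp hk1 hk2]
      linarith
  have hp1 : p ≤ |p| := le_abs_self p
  have hp2 : p ≤ |p + 2 * p| := (by linarith : p ≤ p + 2 * p).trans (le_abs_self _)
  have hp3 : p ≤ |(-p)| := by rwa [abs_neg]
  have hp4 : p ≤ |(-p) + 2 * p| := (by linarith : p ≤ -p + 2 * p).trans (le_abs_self _)
  have hp5 : p ≤ |(-3 * p)| := (by linarith : p ≤ -(-3 * p)).trans (neg_le_abs _)
  have hp6 : p ≤ |(-3 * p) + 2 * p| :=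
    (by linarith : p ≤ -(-3 * p + 2 * p)).trans (neg_le_abs _)
  have hup : ∀ l, ∀ x ∈ Icc (-1 : ℝ) 1, θ l x < p := by
    intro l x hx
    rcases eq_or_lt_of_le hx.1 with rfl | hx1
    · rw [h0]
      linarith
    · exact hbar l p (-1) hp1 hp2 le_rfl (by rw [h0]; linarith) x ⟨hx1, hx.2⟩
  have hlow₀ : ∀ x ∈ Icc (-1 : ℝ) 1, -p < θ l₀ x := by
    intro x hx
    rcases eq_or_lt_of_le hx.2 with rfl | hx1
    · rw [hl₀]
      exact hτ'.1
    · by_contra! h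
      have := hbar l₀ (-p) x hp3 hp4 hx.1 h 1 ⟨hx1, le_rfl⟩
      linarith
  have hlow₁ : ∀ x ∈ Icc (-1 : ℝ) 1, -3 * p < θ l₁ x := by
    intro x hx
    rcases eq_or_lt_of_le hx.2 with rfl | hx1
    · rw [hl₁']
      linarith
    · by_contra! h
      have := hbar l₁ (-3 * p) x hp5 hp6 hx.1 h 1 ⟨hx1, le_rfl⟩
      linarith
  have hθc : ContinuousOn (θ l₁) (Icc (-1) 1) :=
    fun x hx => (hθ l₁ x hx).continuousAt.continuousWithinAt
  obtain ⟨c, hc, hcθ⟩ : -p ∈ θ l₁ '' Icc (-1) 1 :=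
    intermediate_value_Icc' (by norm_num) hθc ⟨by linarith, by rw [h0]; linarith⟩
  have hc1 : c ≠ 1 := by
    rintro rfl
    linarith
  have hc2 : c ≠ -1 := by
    rintro rfl
    rw [h0] at hcθ
    linarith
  have hcI : c ∈ Ioo (-1 : ℝ) 1 := ⟨lt_of_le_of_ne hc.1 hc2.symm, lt_of_le_of_ne hc.2 hc1⟩
  have hright : ∀ x ∈ Ioc c 1, θ l₁ x < -p := hbar l₁ (-p) c hp3 hp4 hc.1 hcθ.le
  have hleft : ∀ x ∈ Ico (-1) c, -p < θ l₁ x := by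
    intro x hx
    by_contra! h
    have := hbar l₁ (-p) x hp3 hp4 hx.1 h c ⟨hx.2, hc.2⟩
    linarith
  have hcontc : Tendsto (θ l₁) (𝓝 c) (𝓝 (-p)) := by
    rw [← hcθ]
    exact (hθ l₁ c hc).continuousAt
  have hrange : ∀ x ∈ Ioc c 1, |θ l₁ x + 2 * p| < p := fun x hx => by
    have h1 := hright x hx
    have h2 := hlow₁ x ⟨hc.1.trans hx.1.le, hx.2⟩
    exact abs_lt.2 ⟨by linarith, by linarith⟩
  have hsub : ∀ x ∈ Ico (-1) c, x ∈ Icc (-1 : ℝ) 1 := fun x hx => ⟨hx.1, hx.2.le.trans hc.2⟩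
  refine ⟨l₀, l₁, c, fun x => riccatiChart p (θ l₀ x), fun x => riccatiChart p (θ l₁ x + 2 * p),
    fun x => riccatiChart p (θ l₁ x), hlt, hcI, fun x hx => ?_, ?_, ?_, fun x hx => ?_, ?_, ?_,
    fun x hx => ?_, ?_, ?_⟩
  · refine hasDerivAt_riccatiChart_comp hpq (abs_lt.2 ⟨hlow₀ x hx, hup l₀ x hx⟩) ?_
    have := hθ l₀ x hx
    rwa [angleField_of_ge hp (hlow₀ x hx).le] at this
  · simp only [hl₀, hτα]
  · simp only [h0, riccatiChart_neg, hτα, neg_neg]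
  · refine hasDerivAt_riccatiChart_comp hpq (θ := fun x => θ l₁ x + 2 * p) (hrange x hx) ?_
    have := hθ l₁ x ⟨hc.1.trans hx.1.le, hx.2⟩
    rw [angleField_of_le hp (hright x hx).le] at this
    exact this.add_const _
  · simp only [hl₁', sub_add_cancel, hτα]
  · refine (tendsto_riccatiChart hp).comp (tendsto_nhdsWithin_iff.2 ⟨?_, ?_⟩)
    · have := (hcontc.add_const (2 * p)).mono_left (nhdsWithin_le_nhds (s := Ioi c))
      rwa [show -p + 2 * p = p by ring] at this
    · filter_upwards [Ioc_mem_nhdsGT hcI.2] with x hx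
      exact mem_Iio.2 (by linarith [hright x hx])
  · refine hasDerivAt_riccatiChart_comp hpq
      (abs_lt.2 ⟨hleft x hx, hup l₁ x (hsub x hx)⟩) ?_
    have := hθ l₁ x (hsub x hx)
    rwa [angleField_of_ge hp (hleft x hx).le] at this
  · simp only [h0, riccatiChart_neg, hτα, neg_neg]
  · have h1 : Tendsto (fun x => riccatiChart p (-θ l₁ x)) (𝓝[<] c) atTop := by
      refine (tendsto_riccatiChart hp).comp (tendsto_nhdsWithin_iff.2 ⟨?_, ?_⟩)
      · have := hcontc.neg.mono_left (nhdsWithin_le_nhds (s := Iio c))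
        rwa [neg_neg] at this
      · filter_upwards [Ico_mem_nhdsLT hcI.1] with x hx
        exact mem_Iio.2 (by linarith [hleft x hx])
    simp only [riccatiChart_neg] at h1
    simpa [Function.comp_def] using tendsto_neg_atTop_atBot.comp h1

end Shooting

/-! ### Eigenfunctions recovered from the Riccati equation -/

section Profiles

variable {p q : ℝ}

theorem sub_one_mul_sub_one (hpq : p.HolderConjugate q) : (p - 1) * (q - 1) = 1 := by
  have := hpq.sub_one_mul_conj
  linarith

theorem abs_spow_mul_rpow (hpq : p.HolderConjugate q) (r : ℝ) {f : ℝ} (hf : 0 ≤ f) :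
    |spow (q - 1) r * f| ^ p = |r| ^ q * f ^ p := by
  have hq : 0 < q - 1 := hpq.symm.sub_one_pos
  rw [abs_mul, abs_spow hq, abs_of_nonneg hf, Real.mul_rpow (by positivity) hf,
    ← Real.rpow_mul (abs_nonneg _), hpq.symm.sub_one_mul_conj]

/-- The derivative of `r f ^ p` along a solution `f' = ψ(r) f` of the Riccati equation. -/
theorem hasDerivAt_mul_rpow (hpq : p.HolderConjugate q) {r f : ℝ → ℝ} {x v : ℝ}
    (hr : HasDerivAt r (v - (p - 1) * |r x| ^ q) x)
    (hf : HasDerivAt f (spow (q - 1) (r x) * f x) x) (hfx : 0 < f x) :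
    HasDerivAt (fun y => r y * f y ^ p)
      (|spow (q - 1) (r x) * f x| ^ p + v * f x ^ p) x := by
  have hq : 0 < q - 1 := hpq.symm.sub_one_pos
  refine (hr.mul (hf.rpow_const (Or.inl hfx.ne'))).congr_deriv ?_
  have h1 := mul_spow hq (r x)
  rw [sub_add_cancel] at h1
  have h2 : f x ^ p = f x ^ (p - 1) * f x := by
    rw [← Real.rpow_add_one hfx.ne', sub_add_cancel]
  rw [abs_spow_mul_rpow hpq _ hfx.le]
  calc _ = v * f x ^ p - (p - 1) * |r x| ^ q * f x ^ p
        + p * (r x * spow (q - 1) (r x)) * (f x ^ (p - 1) * f x) := by ring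
    _ = _ := by rw [h1, ← h2]; ring

/-- The derivative of the flux `r f ^ (p - 1)`. -/
theorem hasDerivAt_mul_rpow_sub_one (hpq : p.HolderConjugate q) {r f : ℝ → ℝ} {x v : ℝ}
    (hr : HasDerivAt r (v - (p - 1) * |r x| ^ q) x)
    (hf : HasDerivAt f (spow (q - 1) (r x) * f x) x) (hfx : 0 < f x) :
    HasDerivAt (fun y => r y * f y ^ (p - 1)) (v * f x ^ (p - 1)) x := by
  have hq : 0 < q - 1 := hpq.symm.sub_one_pos
  refine (hr.mul (hf.rpow_const (Or.inl hfx.ne'))).congr_deriv ?_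
  have h1 := mul_spow hq (r x)
  rw [sub_add_cancel] at h1
  have h2 : f x ^ (p - 1) = f x ^ (p - 1 - 1) * f x := by
    rw [← Real.rpow_add_one hfx.ne', sub_add_cancel]
  calc _ = v * f x ^ (p - 1) - (p - 1) * |r x| ^ q * f x ^ (p - 1)
        + (p - 1) * (r x * spow (q - 1) (r x)) * (f x ^ (p - 1 - 1) * f x) := by ring
    _ = _ := by rw [h1, ← h2]; ring

/-- As `(p-1)(q-1) = 1`, the signed power `spow (q - 1)` inverts `spow (p - 1)`, so `spow (q - 1) r`
is the logarithmic derivative of the eigenfunction, which is recovered by an exponential. The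
integral identity comes from integrating the derivative of `r v^p`. -/
theorem exists_profile (hpq : p.HolderConjugate q) {V : ℝ → ℝ} {α l : ℝ} {r : ℝ → ℝ}
    (hV : Continuous V)
    (hr : ∀ x ∈ Icc (-1 : ℝ) 1, HasDerivAt r (V x - l - (p - 1) * |r x| ^ q) x)
    (hr1 : r 1 = -α) (hr2 : r (-1) = α) :
    ∃ v : ℝ → ℝ, Continuous v ∧ (∀ x, 0 < v x) ∧
      (∀ x ∈ Icc (-1 : ℝ) 1, HasDerivAt v (spow (q - 1) (r x) * v x) x) ∧
      ∫ x in (-1)..1, (|spow (q - 1) (r x) * v x| ^ p + (V x - l) * v x ^ p)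
        = -α * (v 1 ^ p + v (-1) ^ p) := by
  have hq : 0 < q - 1 := hpq.symm.sub_one_pos
  have hrc : ContinuousOn r (Icc (-1) 1) := fun x hx => (hr x hx).continuousAt.continuousWithinAt
  set g : ℝ → ℝ := fun x => spow (q - 1) (r (projIcc (-1) 1 (by norm_num) x)) with hg
  have hgc : Continuous g := (continuous_spow hq).comp
    (hrc.comp_continuous (continuous_subtype_val.comp continuous_projIcc) fun x => Subtype.prop _)
  have hgx : ∀ x ∈ Icc (-1 : ℝ) 1, g x = spow (q - 1) (r x) := fun x hx => by
    simp only [hg, projIcc_of_mem _ hx]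
  set v : ℝ → ℝ := fun x => Real.exp (∫ t in (-1)..x, g t) with hv
  have hvd : ∀ x, HasDerivAt v (g x * v x) x := fun x => by
    have := (hgc.integral_hasStrictDerivAt (-1) x).hasDerivAt.exp
    exact this.congr_deriv (mul_comm _ _)
  have hvc : Continuous v := continuous_iff_continuousAt.2 fun x => (hvd x).continuousAt
  have hv0 : ∀ x, 0 < v x := fun x => Real.exp_pos _
  have hvd' : ∀ x ∈ Icc (-1 : ℝ) 1, HasDerivAt v (spow (q - 1) (r x) * v x) x := fun x hx => by
    rw [← hgx x hx]
    exact hvd x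
  refine ⟨v, hvc, hv0, hvd', ?_⟩
  have hint : IntervalIntegrable
      (fun x => |spow (q - 1) (r x) * v x| ^ p + (V x - l) * v x ^ p) volume (-1) 1 := by
    refine ContinuousOn.intervalIntegrable ?_
    rw [uIcc_of_le (by norm_num)]
    have h1 : ContinuousOn (fun x => spow (q - 1) (r x)) (Icc (-1) 1) :=
      (continuous_spow hq).comp_continuousOn hrc
    exact ((h1.mul hvc.continuousOn).abs.rpow_const fun _ _ => Or.inr hpq.nonneg).add
      ((hV.sub continuous_const).continuousOn.mul
        (hvc.continuousOn.rpow_const fun _ _ => Or.inr hpq.nonneg))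
  rw [intervalIntegral.integral_eq_sub_of_hasDerivAt
    (f := fun y => r y * v y ^ p) (fun x hx => ?_) hint, hr1, hr2]
  · ring
  · rw [uIcc_of_le (by norm_num)] at hx
    exact hasDerivAt_mul_rpow hpq (hr x hx) (hvd' x hx) (hv0 x)

/-- The difficulty is at the node, where `r` blows up. It is resolved by the flux `r f^(p-1)`, which
stays bounded there: this forces `f → 0` and bounds `f'`. -/
theorem exists_profile_right (hpq : p.HolderConjugate q) {V : ℝ → ℝ} (hV : Continuous V)
    {α l c : ℝ} {r : ℝ → ℝ} (hc : c < 1)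
    (hr : ∀ x ∈ Ioc c 1, HasDerivAt r (V x - l - (p - 1) * |r x| ^ q) x) (hr1 : r 1 = -α)
    (hrc : Tendsto r (𝓝[>] c) atTop) :
    ∃ (f : ℝ → ℝ) (C : ℝ), Continuous f ∧ (∀ x ≤ c, f x = 0) ∧ (∀ x, c < x → 0 < f x) ∧
      (∀ x ∈ Ioc c 1, HasDerivAt f (spow (q - 1) (r x) * f x) x) ∧
      (∀ x ∈ Ioc c 1, |spow (q - 1) (r x) * f x| ≤ C) ∧
      ∫ x in c..1, (|spow (q - 1) (r x) * f x| ^ p + (V x - l) * f x ^ p) = -α * f 1 ^ p := by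
  have hq : 0 < q - 1 := hpq.symm.sub_one_pos
  have hp1 : 0 < p - 1 := hpq.sub_one_pos
  have hrcont : ContinuousOn r (Ioc c 1) := fun x hx => (hr x hx).continuousAt.continuousWithinAt
  set g : ℝ → ℝ := fun x => spow (q - 1) (r (min x 1)) with hg
  have hmin : ∀ x ∈ Ioi c, min x 1 ∈ Ioc c 1 := fun x hx => ⟨lt_min hx hc, min_le_right _ _⟩
  have hgc : ContinuousOn g (Ioi c) := (continuous_spow hq).comp_continuousOn
    (hrcont.comp (continuous_id.min continuous_const).continuousOn hmin)
  have hgx : ∀ x ∈ Ioc c 1, g x = spow (q - 1) (r x) := fun x hx => by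
    simp only [hg, min_eq_left hx.2]
  set f : ℝ → ℝ := fun x => if x ≤ c then 0 else Real.exp (∫ t in (1 : ℝ)..x, g t) with hf
  have hf0 : ∀ x ≤ c, f x = 0 := fun x hx => if_pos hx
  have hfe : ∀ x, c < x → f x = Real.exp (∫ t in (1 : ℝ)..x, g t) := fun x hx =>
    if_neg (not_le.2 hx)
  have hfpos : ∀ x, c < x → 0 < f x := fun x hx => by
    rw [hfe x hx]
    exact Real.exp_pos _
  have hfd : ∀ x, c < x → HasDerivAt f (g x * f x) x := fun x hx => by
    have hsub : uIcc 1 x ⊆ Ioi c := fun y hy => lt_of_lt_of_le (lt_min hc hx) hy.1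
    have h1 := (intervalIntegral.integral_hasDerivAt_right
      ((hgc.mono hsub).intervalIntegrable)
      (hgc.stronglyMeasurableAtFilter isOpen_Ioi x hx)
      (hgc.continuousAt (Ioi_mem_nhds hx))).exp
    rw [← hfe x hx, mul_comm] at h1
    refine h1.congr_of_eventuallyEq ?_
    filter_upwards [Ioi_mem_nhds hx] with y hy using hfe y hy
  have hfd' : ∀ x ∈ Ioc c 1, HasDerivAt f (spow (q - 1) (r x) * f x) x := fun x hx => by
    rw [← hgx x hx]
    exact hfd x hx.1
  obtain ⟨b, hb, hbr⟩ : ∃ b ∈ Ioo c 1, ∀ x ∈ Ioc c b, 1 ≤ r x := by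
    have h1 := hrc.eventually (eventually_ge_atTop 1)
    obtain ⟨b, hb, hb'⟩ := mem_nhdsGT_iff_exists_Ioc_subset.1 h1
    refine ⟨min b ((c + 1) / 2), ⟨lt_min hb (by linarith), ?_⟩, fun x hx => ?_⟩
    · exact (min_le_right _ _).trans_lt (by linarith)
    · exact hb' ⟨hx.1, hx.2.trans (min_le_left _ _)⟩
  have hfcont : ContinuousOn f (Ioi c) := fun x hx => (hfd x hx).continuousAt.continuousWithinAt
  -- Near `c` one has `r ≥ 1`, so `f` increases there and is bounded by its values on `[b, 1]`.
  obtain ⟨F, hF0, hF⟩ : ∃ F, 0 ≤ F ∧ ∀ x ∈ Ioc c 1, f x ≤ F := by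
    obtain ⟨F, hF⟩ := (isCompact_Icc (a := b) (b := 1)).exists_bound_of_continuousOn
      (hfcont.mono fun x hx => hb.1.trans_le hx.1)
    refine ⟨F, (norm_nonneg _).trans (hF b ⟨le_rfl, hb.2.le⟩), fun x hx => ?_⟩
    rcases le_total b x with h | h
    · exact (le_abs_self _).trans (hF x ⟨h, hx.2⟩)
    · have hmono : MonotoneOn f (Ioc c b) := by
        refine monotoneOn_of_deriv_nonneg (convex_Ioc _ _) (hfcont.mono fun y hy => hy.1)
          (fun y hy => ?_) fun y hy => ?_
        · rw [interior_Ioc] at hy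
          exact (hfd y hy.1).differentiableAt.differentiableWithinAt
        · rw [interior_Ioc] at hy
          rw [(hfd' y ⟨hy.1, hy.2.le.trans hb.2.le⟩).deriv,
            spow_of_nonneg hq (zero_le_one.trans (hbr y ⟨hy.1, hy.2.le⟩))]
          have := hbr y ⟨hy.1, hy.2.le⟩
          have := hfpos y hy.1
          positivity
      exact (hmono ⟨hx.1, h⟩ ⟨hb.1, le_rfl⟩ h).trans
        ((le_abs_self _).trans (hF b ⟨le_rfl, hb.2.le⟩))
  obtain ⟨M, hM⟩ := (isCompact_Icc (a := c) (b := 1)).exists_bound_of_continuousOn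
    (hV.sub (continuous_const (y := l))).continuousOn
  -- The flux has derivative `(V - l) f^(p-1)`, which is bounded, so integrating back from `1`
  -- bounds it up to the node.
  obtain ⟨C, hC⟩ : ∃ C, ∀ x ∈ Ioc c 1, |r x * f x ^ (p - 1)| ≤ C := by
    refine ⟨|r 1 * f 1 ^ (p - 1)| + M * F ^ (p - 1) * (1 - c), fun x hx => ?_⟩
    have hbound : ∀ y ∈ Icc x 1, ‖(V y - l) * f y ^ (p - 1)‖ ≤ M * F ^ (p - 1) := fun y hy => by
      have hyc : c < y := hx.1.trans_le hy.1
      have h1 := hM y ⟨hyc.le, hy.2⟩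
      rw [norm_mul, Real.norm_of_nonneg (Real.rpow_nonneg (hfpos y hyc).le _)]
      have h2 : f y ^ (p - 1) ≤ F ^ (p - 1) :=
        Real.rpow_le_rpow (hfpos y hyc).le (hF y ⟨hyc, hy.2⟩) hp1.le
      exact mul_le_mul h1 h2 (Real.rpow_nonneg (hfpos y hyc).le _) ((norm_nonneg _).trans h1)
    have h3 := (convex_Icc x 1).norm_image_sub_le_of_norm_hasDerivWithin_le
      (f := fun y => r y * f y ^ (p - 1)) (fun y hy => (hasDerivAt_mul_rpow_sub_one hpq
        (hr y ⟨hx.1.trans_le hy.1, hy.2⟩) (hfd' y ⟨hx.1.trans_le hy.1, hy.2⟩)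
        (hfpos y (hx.1.trans_le hy.1))).hasDerivWithinAt) hbound
      (⟨hx.2, le_rfl⟩ : (1 : ℝ) ∈ Icc x 1) (⟨le_rfl, hx.2⟩ : x ∈ Icc x 1)
    have h4 : M * F ^ (p - 1) * ‖x - 1‖ ≤ M * F ^ (p - 1) * (1 - c) := by
      have h5 := (norm_nonneg _).trans (hbound x ⟨le_rfl, hx.2⟩)
      refine mul_le_mul_of_nonneg_left ?_ h5
      rw [Real.norm_eq_abs, abs_of_nonpos (by linarith [hx.2])]
      linarith [hx.1]
    have h6 := norm_sub_norm_le (r x * f x ^ (p - 1)) (r 1 * f 1 ^ (p - 1))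
    simp only [Real.norm_eq_abs] at h3 h4 h6
    linarith
  -- With a bounded flux, `f^(p-1) ≤ C / r` tends to zero.
  have hflim : Tendsto f (𝓝[>] c) (𝓝 0) := by
    have hev : ∀ᶠ x in 𝓝[>] c, x ∈ Ioc c b := Ioc_mem_nhdsGT hb.1
    have h1 : Tendsto (fun x => f x ^ (p - 1)) (𝓝[>] c) (𝓝 0) := by
      refine squeeze_zero' (g := fun x => C / r x) ?_ ?_ (hrc.const_div_atTop C)
      · filter_upwards [hev] with x hx
        exact Real.rpow_nonneg (hfpos x hx.1).le _
      · filter_upwards [hev] with x hx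
        have := hbr x hx
        rw [le_div_iff₀ (by linarith), mul_comm]
        exact (le_abs_self _).trans (hC x ⟨hx.1, hx.2.trans hb.2.le⟩)
    have h2 := h1.rpow_const (p := q - 1) (Or.inr hq.le)
    rw [Real.zero_rpow hq.ne'] at h2
    refine h2.congr' ?_
    filter_upwards [hev] with x hx
    rw [← Real.rpow_mul (hfpos x hx.1).le, sub_one_mul_sub_one hpq, Real.rpow_one]
  have hfcontinuous : Continuous f := by
    rw [continuous_iff_continuousAt]
    intro x
    rcases lt_trichotomy x c with h | rfl | h
    · refine (continuousAt_const (y := (0 : ℝ))).congr ?_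
      filter_upwards [Iio_mem_nhds h] with y hy using (hf0 y (le_of_lt hy)).symm
    · rw [continuousAt_iff_continuous_left'_right']
      constructor
      · refine (continuousWithinAt_const (b := (0 : ℝ))).congr_of_eventuallyEq ?_ (hf0 _ le_rfl)
        filter_upwards [self_mem_nhdsWithin] with y hy using hf0 y (le_of_lt hy)
      · rw [ContinuousWithinAt, hf0 _ le_rfl]
        exact hflim
    · exact (hfd x h).continuousAt
  -- By `(p-1)(q-1) = 1`, the absolute value of `f'` is the flux to the power `q - 1`.
  have hC' : ∀ x ∈ Ioc c 1, |spow (q - 1) (r x) * f x| ≤ C ^ (q - 1) := fun x hx => by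
    have h1 := Real.rpow_le_rpow (abs_nonneg _) (hC x hx) hq.le
    rwa [abs_mul, Real.mul_rpow (abs_nonneg _) (abs_nonneg _),
      abs_of_nonneg (Real.rpow_nonneg (hfpos x hx.1).le _), ← Real.rpow_mul (hfpos x hx.1).le,
      sub_one_mul_sub_one hpq, Real.rpow_one, ← abs_spow hq,
      ← abs_of_pos (hfpos x hx.1), ← abs_mul] at h1
  refine ⟨f, C ^ (q - 1), hfcontinuous, hf0, hfpos, hfd', hC', ?_⟩
  have hψc : ContinuousOn (fun x => spow (q - 1) (r x) * f x) (Ioc c 1) :=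
    ((continuous_spow hq).comp_continuousOn hrcont).mul hfcontinuous.continuousOn
  have hint : IntervalIntegrable
      (fun x => |spow (q - 1) (r x) * f x| ^ p + (V x - l) * f x ^ p) volume c 1 := by
    refine IntervalIntegrable.add ?_ (Continuous.intervalIntegrable
      ((hV.sub continuous_const).mul (hfcontinuous.rpow_const fun _ => Or.inr hpq.nonneg)) _ _)
    rw [intervalIntegrable_iff_integrableOn_Ioc_of_le hc.le]
    refine Integrable.of_bound ((hψc.abs.rpow_const fun _ _ =>
      Or.inr hpq.nonneg).aestronglyMeasurable measurableSet_Ioc) ((C ^ (q - 1)) ^ p) ?_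
    rw [ae_restrict_iff' measurableSet_Ioc]
    refine Eventually.of_forall fun x hx => ?_
    rw [Real.norm_of_nonneg (by positivity)]
    exact Real.rpow_le_rpow (abs_nonneg _) (hC' x hx) hpq.nonneg
  set P : ℝ → ℝ := fun x => r x * f x ^ p with hP
  have hPc : P c = 0 := by
    simp only [hP, hf0 c le_rfl, Real.zero_rpow hpq.ne_zero, mul_zero]
  have hPd : ∀ x ∈ Ioc c 1, HasDerivAt P
      (|spow (q - 1) (r x) * f x| ^ p + (V x - l) * f x ^ p) x := fun x hx =>
    hasDerivAt_mul_rpow hpq (hr x hx) (hfd' x hx) (hfpos x hx.1)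
  -- At the node `P` is the bounded flux times `f`, so it tends to `0`.
  have hPcont : ContinuousOn P (Icc c 1) := by
    intro x hx
    rcases eq_or_lt_of_le hx.1 with rfl | h
    · have h1 : Tendsto P (𝓝[>] c) (𝓝 0) := by
        have h2 : Tendsto (fun x => C * f x) (𝓝[>] c) (𝓝 0) := by
          simpa using hflim.const_mul C
        refine squeeze_zero_norm' ?_ h2
        filter_upwards [Ioc_mem_nhdsGT hc] with y hy
        have h3 : P y = r y * f y ^ (p - 1) * f y := by
          simp only [hP]
          rw [mul_assoc, ← Real.rpow_add_one (hfpos y hy.1).ne', sub_add_cancel]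
        rw [h3, norm_mul, Real.norm_of_nonneg (hfpos y hy.1).le]
        exact mul_le_mul_of_nonneg_right (hC y hy) (hfpos y hy.1).le
      have h4 : ContinuousWithinAt P (Ioi c) c := by
        rw [ContinuousWithinAt, hPc]
        exact h1
      exact (continuousWithinAt_Ioi_iff_Ici.1 h4).mono fun y hy => hy.1
    · exact (hPd x ⟨h, hx.2⟩).continuousAt.continuousWithinAt
  rw [intervalIntegral.integral_eq_sub_of_hasDerivAt_of_le hc.le hPcont
    (fun x hx => hPd x ⟨hx.1, hx.2.le⟩) hint, hPc, sub_zero]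
  simp only [hP, hr1]

/-- Reflection: `x ↦ -s(-x)` solves the Riccati equation for the potential `V(-x)`. -/
theorem exists_profile_left (hpq : p.HolderConjugate q) {V : ℝ → ℝ} (hV : Continuous V)
    {α l c : ℝ} {s : ℝ → ℝ} (hc : -1 < c)
    (hs : ∀ x ∈ Ico (-1) c, HasDerivAt s (V x - l - (p - 1) * |s x| ^ q) x) (hs1 : s (-1) = α)
    (hsc : Tendsto s (𝓝[<] c) atBot) :
    ∃ (f : ℝ → ℝ) (C : ℝ), Continuous f ∧ (∀ x, c ≤ x → f x = 0) ∧ (∀ x < c, 0 < f x) ∧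
      (∀ x ∈ Ico (-1) c, HasDerivAt f (spow (q - 1) (s x) * f x) x) ∧
      (∀ x ∈ Ico (-1) c, |spow (q - 1) (s x) * f x| ≤ C) ∧
      ∫ x in (-1)..c, (|spow (q - 1) (s x) * f x| ^ p + (V x - l) * f x ^ p)
        = -α * f (-1) ^ p := by
  have hmem : ∀ x ∈ Ioc (-c) 1, -x ∈ Ico (-1) c := fun x hx =>
    ⟨by linarith [hx.2], by linarith [hx.1]⟩
  have hmem' : ∀ x ∈ Ico (-1) c, -x ∈ Ioc (-c) 1 := fun x hx =>
    ⟨by linarith [hx.2], by linarith [hx.1]⟩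
  obtain ⟨f, C, h1, h2, h3, h4, h5, h6⟩ := exists_profile_right hpq (V := fun x => V (-x))
    (hV.comp continuous_neg) (α := α) (l := l) (c := -c) (r := fun x => -s (-x)) (by linarith)
    (fun x hx => by
      have := ((hs (-x) (hmem x hx)).comp x (hasDerivAt_neg x)).neg
      refine this.congr_deriv ?_
      rw [abs_neg]
      ring)
    (by rw [hs1])
    (by
      refine tendsto_neg_atBot_atTop.comp (hsc.comp ?_)
      have : Tendsto Neg.neg (𝓝[>] (-c)) (𝓝[<] (- -c)) := tendsto_neg_nhdsGT
      rwa [neg_neg] at this)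
  refine ⟨fun x => f (-x), C, h1.comp continuous_neg, fun x hx => h2 _ (by linarith),
    fun x hx => h3 _ (by linarith), fun x hx => ?_, fun x hx => ?_, ?_⟩
  · have := (h4 (-x) (hmem' x hx)).comp x (hasDerivAt_neg x)
    refine this.congr_deriv ?_
    rw [neg_neg, spow_neg]
    ring
  · have := h5 (-x) (hmem' x hx)
    rwa [neg_neg, spow_neg, neg_mul, abs_neg] at this
  · simp only [neg_neg]
    rw [← h6]
    have := intervalIntegral.integral_comp_neg (a := -1) (b := c)
      (fun x => |spow (q - 1) (-s (-x)) * f x| ^ p + (V (-x) - l) * f x ^ p)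
    rw [neg_neg] at this
    rw [← this]
    simp only [neg_neg, spow_neg, neg_mul, abs_neg]

end Profiles

/-! ### Eigenfunctions as elements of `W1p` -/

section TestFunctions

variable {p : ℝ} [hp : Fact (1 < p)]

/-- A nodal piece extended by zero may have a kink at the node; the countable set `T` absorbs it. -/
theorem exists_W1p_indicator {f g : ℝ → ℝ} {C : ℝ} {S T : Set ℝ} (hS : MeasurableSet S)
    (hT : T.Countable) (hf : Continuous f) (hg : ContinuousOn g S) (hC : ∀ x ∈ S, |g x| ≤ C)
    (h1 : ∀ x ∈ S, HasDerivAt f (g x) x)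
    (h2 : ∀ x ∈ Ioo (-1 : ℝ) 1, x ∉ S → x ∉ T → HasDerivAt f 0 x) :
    ∃ u : W1p p, (∀ x ∈ Icc (-1 : ℝ) 1, evalAt u x = f x) ∧
      weakDeriv u =ᵐ[μI] S.indicator g := by
  refine exists_W1p (C := max C 0) hT hf.continuousOn (fun x hx => ?_) ?_ (fun x _ => ?_)
  · by_cases hxS : x ∈ S
    · rw [indicator_of_mem hxS]
      exact h1 x hxS
    · rw [indicator_of_notMem hxS]
      exact h2 x hx.1 hxS hx.2
  · exact ((aestronglyMeasurable_indicator_iff hS).2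
      (hg.aestronglyMeasurable hS)).restrict
  · by_cases hxS : x ∈ S
    · rw [indicator_of_mem hxS]
      exact (hC x hxS).trans (le_max_left _ _)
    · rw [indicator_of_notMem hxS, abs_zero]
      exact le_max_right _ _

theorem intervalIntegral_congr_of_ae_Ioo {F G : ℝ → ℝ} {a b : ℝ} (ha : -1 ≤ a) (hab : a ≤ b)
    (hb : b ≤ 1) (h : ∀ᵐ x ∂μI, x ∈ Ioo a b → F x = G x) :
    ∫ x in a..b, F x = ∫ x in a..b, G x := by
  rw [intervalIntegral.integral_of_le hab, intervalIntegral.integral_of_le hab,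
    integral_Ioc_eq_integral_Ioo, integral_Ioc_eq_integral_Ioo]
  refine setIntegral_congr_ae measurableSet_Ioo ?_
  rw [ae_restrict_iff' measurableSet_Ioo] at h
  filter_upwards [h] with x hx hxI
  exact hx (Ioo_subset_Ioo ha hb hxI) hxI

/-- The integral is split at `c` because the identity for a nodal piece is known on one side only,
the other side contributing zero. For the positive profile `c = 1` is used. -/
theorem energy_eq_of_profile {V : ℝ → ℝ} (hV : Continuous V) {α l c : ℝ} (hc : c ∈ Icc (-1 : ℝ) 1)
    {u : W1p p} {f g : ℝ → ℝ} (hf0 : ∀ x ∈ Icc (-1 : ℝ) 1, 0 ≤ f x)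
    (hu : ∀ x ∈ Icc (-1 : ℝ) 1, evalAt u x = f x)
    (hg : weakDeriv u =ᵐ[μI] g)
    (h : (∫ x in (-1)..c, (|g x| ^ p + (V x - l) * f x ^ p))
      + ∫ x in c..1, (|g x| ^ p + (V x - l) * f x ^ p) = -α * (f 1 ^ p + f (-1) ^ p)) :
    energy p α V u = l * mass p u := by
  have hi : ∀ s t : ℝ, -1 ≤ s → s ≤ t → t ≤ 1 → IntervalIntegrable
      (fun x => |weakDeriv u x| ^ p + (V x - l) * |evalAt u x| ^ p) volume s t :=
    fun s t hs hst ht => (intervalIntegrable_abs_weakDeriv_rpow u hs hst ht).add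
      (Continuous.intervalIntegrable ((hV.sub continuous_const).mul
        ((continuous_evalAt u).abs.rpow_const fun _ => Or.inr (by linarith [hp.out]))) _ _)
  have hcongr : ∀ s t : ℝ, -1 ≤ s → s ≤ t → t ≤ 1 →
      ∫ x in s..t, (|weakDeriv u x| ^ p + (V x - l) * |evalAt u x| ^ p)
        = ∫ x in s..t, (|g x| ^ p + (V x - l) * f x ^ p) := fun s t hs hst ht => by
    refine intervalIntegral_congr_of_ae_Ioo hs hst ht ?_
    filter_upwards [hg] with x hx hxI
    have hxc : x ∈ Icc (-1 : ℝ) 1 := ⟨hs.trans hxI.1.le, hxI.2.le.trans ht⟩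
    rw [hx, hu x hxc, abs_of_nonneg (hf0 x hxc)]
  have h3 := energy_sub_eq hV α l u
  rw [← intervalIntegral.integral_add_adjacent_intervals (hi (-1) c le_rfl hc.1 hc.2)
    (hi c 1 hc.1 hc.2 le_rfl), hcongr _ _ le_rfl hc.1 hc.2, hcongr _ _ hc.1 hc.2 le_rfl, h,
    hu 1 (by norm_num), hu (-1) (by norm_num), abs_of_nonneg (hf0 1 (by norm_num)),
    abs_of_nonneg (hf0 (-1) (by norm_num))] at h3
  linarith

theorem ne_zero_of_evalAt_pos {u : W1p p} {x : ℝ} (h : 0 < evalAt u x) : u ≠ 0 := by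
  rintro rfl
  exact h.ne' rfl

theorem energy_eq_sub_integral {V W : ℝ → ℝ} (hV : Continuous V) (hW : Continuous W) {α : ℝ}
    (u : W1p p) :
    energy p α W u = energy p α V u - ∫ x in (-1)..1, (V x - W x) * |evalAt u x| ^ p := by
  rw [energy_eq hV, energy_eq hW, intervalIntegral.integral_of_le (by norm_num),
    integral_Ioc_eq_integral_Ioo]
  simp_rw [sub_mul]
  rw [integral_sub (integrableOn_mul_abs_evalAt_rpow hV u) (integrableOn_mul_abs_evalAt_rpow hW u)]
  ring

end TestFunctions

/-! ### Sign analysis -/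

theorem exists_zero_of_integral_mul_eq_zero {d w : ℝ → ℝ} {a b : ℝ} (hab : a < b)
    (hd : Continuous d) (hw : Continuous w) (hpos : ∀ x ∈ Ioo a b, 0 < w x)
    (h : ∫ x in a..b, d x * w x = 0) : ∃ x ∈ Ioo a b, d x = 0 := by
  obtain ⟨x, hx, hdx⟩ : ∃ x ∈ Ioo a b, d x ≤ 0 := by
    by_contra! hcon
    exact (intervalIntegral.intervalIntegral_pos_of_pos_on ((hd.mul hw).intervalIntegrable _ _)
      (fun x hx => mul_pos (hcon x hx) (hpos x hx)) hab).ne' h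
  obtain ⟨y, hy, hdy⟩ : ∃ x ∈ Ioo a b, 0 ≤ d x := by
    by_contra! hcon
    have := intervalIntegral.intervalIntegral_pos_of_pos_on
      ((hd.mul hw).neg.intervalIntegrable _ _)
      (fun x hx => neg_pos.2 (mul_neg_of_neg_of_pos (hcon x hx) (hpos x hx))) hab
    have e : ∫ x in a..b, -(d x * w x) = 0 := by rw [intervalIntegral.integral_neg, h, neg_zero]
    exact this.ne' e
  obtain ⟨z, hz, hz0⟩ := isPreconnected_Ioo.intermediate_value hx hy hd.continuousOn ⟨hdx, hdy⟩
  exact ⟨z, hz, hz0⟩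

/-- A function `d` orthogonal to `f ^ p` that changes sign where `f / v` crosses the level `k` has a
negative integral against `v ^ p`. -/
theorem integral_mul_rpow_neg {p : ℝ} (hp : 0 < p) {d f v : ℝ → ℝ} {a b k x₀ : ℝ} (hab : a < b)
    (hd : Continuous d) (hf : Continuous f) (hv : Continuous v) (hv0 : ∀ x, 0 < v x)
    (hf0 : ∀ x ∈ Icc a b, 0 ≤ f x) (hk : 0 < k) (hd0 : d x₀ = 0)
    (hcross : ∀ x ∈ Icc a b, x ≠ x₀ →
      (f x / v x < k ∧ d x ≤ 0) ∨ (k < f x / v x ∧ 0 ≤ d x))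
    (h : ∫ x in a..b, d x * f x ^ p = 0) :
    (∫ x in a..b, d x * v x ^ p) ≤ 0 ∧
      ((∃ x ∈ Icc a b, d x ≠ 0) → ∫ x in a..b, d x * v x ^ p < 0) := by
  have hfp : Continuous fun x => f x ^ p := hf.rpow_const fun _ => Or.inr hp.le
  have hvp : Continuous fun x => v x ^ p := hv.rpow_const fun _ => Or.inr hp.le
  -- Adding a multiple of the vanishing integral of `d f^p` does not change the integral of `-d
  -- v^p`. The factor `k^p` makes the weight difference change sign exactly where `d` does, so `N ≥
  -- 0`.
  set N : ℝ → ℝ := fun x => d x * (f x ^ p / k ^ p - v x ^ p) with hN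
  have hNc : Continuous N := hd.mul ((hfp.div_const _).sub hvp)
  have e : ∫ x in a..b, N x = -∫ x in a..b, d x * v x ^ p := by
    have h1 : ∀ x, N x = (k ^ p)⁻¹ * (d x * f x ^ p) - d x * v x ^ p := fun x => by
      simp only [hN]
      ring
    have hdf : Continuous fun x => d x * f x ^ p := hd.mul hfp
    have hdv : Continuous fun x => d x * v x ^ p := hd.mul hvp
    simp_rw [h1]
    rw [intervalIntegral.integral_sub ((hdf.const_mul _).intervalIntegrable _ _)
      (hdv.intervalIntegrable _ _), intervalIntegral.integral_const_mul, h]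
    ring
  have hkp : 0 < k ^ p := Real.rpow_pos_of_pos hk p
  have hlt : ∀ x ∈ Icc a b, f x / v x < k → f x ^ p / k ^ p < v x ^ p := fun x hx hx' => by
    rw [div_lt_iff₀ hkp, ← Real.mul_rpow (hv0 x).le hk.le]
    rw [div_lt_iff₀ (hv0 x)] at hx'
    exact Real.rpow_lt_rpow (hf0 x hx) (by linarith) hp
  have hgt : ∀ x ∈ Icc a b, k < f x / v x → v x ^ p < f x ^ p / k ^ p := fun x hx hx' => by
    rw [lt_div_iff₀ hkp, ← Real.mul_rpow (hv0 x).le hk.le]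
    rw [lt_div_iff₀ (hv0 x)] at hx'
    exact Real.rpow_lt_rpow (mul_pos (hv0 x) hk).le (by linarith) hp
  have hN0 : ∀ x ∈ Icc a b, 0 ≤ N x := fun x hx => by
    by_cases hx0 : x = x₀
    · simp [hN, hx0, hd0]
    · rcases hcross x hx hx0 with ⟨h1, h2⟩ | ⟨h1, h2⟩
      · exact mul_nonneg_of_nonpos_of_nonpos h2 (by linarith [hlt x hx h1])
      · exact mul_nonneg h2 (by linarith [hgt x hx h1])
  constructor
  · have := intervalIntegral.integral_nonneg (μ := volume) hab.le hN0
    linarith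
  · rintro ⟨x, hx, hdx⟩
    have hx0 : x ≠ x₀ := fun h => hdx (h ▸ hd0)
    have hNx : 0 < N x := by
      rcases hcross x hx hx0 with ⟨h1, h2⟩ | ⟨h1, h2⟩
      · exact mul_pos_of_neg_of_neg (lt_of_le_of_ne h2 hdx) (by linarith [hlt x hx h1])
      · exact mul_pos (lt_of_le_of_ne h2 hdx.symm) (by linarith [hgt x hx h1])
    have := intervalIntegral.integral_pos hab hNc.continuousOn
      (fun y hy => hN0 y ⟨hy.1.le, hy.2⟩) ⟨x, hx, hNx⟩
    linarith

/-- Comparison of two solutions of the Riccati equation with equal values at `b`. -/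
theorem riccati_lt {p q l₀ l₁ : ℝ} {V r₀ r : ℝ → ℝ} {a b : ℝ} (hl : l₀ < l₁)
    (hr₀ : ∀ x ∈ Ioc a b, HasDerivAt r₀ (V x - l₀ - (p - 1) * |r₀ x| ^ q) x)
    (hr : ∀ x ∈ Ioc a b, HasDerivAt r (V x - l₁ - (p - 1) * |r x| ^ q) x) (hb : r b = r₀ b)
    {x : ℝ} (hx : x ∈ Ioo a b) : r₀ x < r x := by
  -- Wherever the solutions meet, `r - r₀` has slope `l₀ - l₁ < 0`; so `r ≤ r₀` at `x` would force
  -- `r < r₀` at `b`.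
  by_contra! h
  have := neg_of_deriv_neg_at_zeros (z := fun x => r x - r₀ x)
    (z' := fun x => V x - l₁ - (p - 1) * |r x| ^ q - (V x - l₀ - (p - 1) * |r₀ x| ^ q))
    (a := x) (b := b) (x := b) (fun y hy => (hr y ⟨hx.1.trans_le hy.1, hy.2⟩).sub
      (hr₀ y ⟨hx.1.trans_le hy.1, hy.2⟩))
    (fun y _ hy => by
      rw [show r y = r₀ y by linarith]
      linarith) (by linarith) ⟨hx.2, le_rfl⟩
  linarith

/-- Comparison of two solutions of the Riccati equation with equal values at `a`. -/
theorem riccati_gt {p q l₀ l₁ : ℝ} {V r₀ r : ℝ → ℝ} {a b : ℝ} (hl : l₀ < l₁)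
    (hr₀ : ∀ x ∈ Ico a b, HasDerivAt r₀ (V x - l₀ - (p - 1) * |r₀ x| ^ q) x)
    (hr : ∀ x ∈ Ico a b, HasDerivAt r (V x - l₁ - (p - 1) * |r x| ^ q) x) (ha : r a = r₀ a)
    {x : ℝ} (hx : x ∈ Ioo a b) : r x < r₀ x := by
  have := neg_of_deriv_neg_at_zeros (z := fun x => r x - r₀ x)
    (z' := fun x => V x - l₁ - (p - 1) * |r x| ^ q - (V x - l₀ - (p - 1) * |r₀ x| ^ q))
    (a := a) (b := x) (x := x) (fun y hy => (hr y ⟨hy.1, hy.2.trans_lt hx.2⟩).sub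
      (hr₀ y ⟨hy.1, hy.2.trans_lt hx.2⟩))
    (fun y _ hy => by
      rw [show r y = r₀ y by linarith]
      linarith) (by linarith) ⟨hx.1, le_rfl⟩
  linarith

theorem hasDerivAt_div_profile {f v : ℝ → ℝ} {a b x : ℝ} (hf : HasDerivAt f (a * f x) x)
    (hv : HasDerivAt v (b * v x) x) (hvx : 0 < v x) :
    HasDerivAt (fun y => f y / v y) ((a - b) * (f x / v x)) x := by
  refine (hf.div hv hvx.ne').congr_deriv ?_
  field_simp

/-! ### Perturbation of the first eigenvalue -/

/-- First order perturbation of a Riccati solution into a subsolution. -/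
theorem exists_subsolution {p q : ℝ} (hpq : p.HolderConjugate q) {V d r₀ v : ℝ → ℝ} {l α : ℝ}
    (hV : Continuous V) (hd : Continuous d) (hv : Continuous v) (hv0 : ∀ x, 0 < v x)
    (hr₀ : ∀ x ∈ Icc (-1 : ℝ) 1, HasDerivAt r₀ (V x - l - (p - 1) * |r₀ x| ^ q) x)
    (hr₁ : r₀ 1 = -α) (hr₂ : r₀ (-1) = α)
    (hvd : ∀ x ∈ Icc (-1 : ℝ) 1, HasDerivAt v (spow (q - 1) (r₀ x) * v x) x)
    (hneg : ∫ x in (-1)..1, d x * v x ^ p < 0) :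
    ∃ η > 0, ∀ᶠ s in 𝓝[>] (0 : ℝ), ∃ r r' : ℝ → ℝ,
      (∀ x ∈ Icc (-1 : ℝ) 1, HasDerivAt r (r' x) x) ∧ ContinuousOn r' (Icc (-1) 1) ∧
      (∀ x ∈ Icc (-1 : ℝ) 1, r' x ≤ V x - s * d x - (l + s * η) - (p - 1) * |r x| ^ q) ∧
      r 1 = -α ∧ r (-1) = α := by
  have hq : 0 < q - 1 := hpq.symm.sub_one_pos
  have hvp : Continuous fun x => v x ^ p := hv.rpow_const fun _ => Or.inr hpq.nonneg
  have hI : 0 < ∫ x in (-1 : ℝ)..1, v x ^ p :=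
    intervalIntegral.intervalIntegral_pos_of_pos_on (hvp.intervalIntegrable _ _)
      (fun x _ => Real.rpow_pos_of_pos (hv0 x) _) (by norm_num)
  -- This is the first-order rise of the eigenvalue under `V - s d`. It is exactly the value for
  -- which `J` vanishes at `1`.
  set m := -(∫ x in (-1)..1, d x * v x ^ p) / ∫ x in (-1 : ℝ)..1, v x ^ p with hm
  have hm0 : 0 < m := div_pos (by linarith) hI
  set J : ℝ → ℝ := fun x => ∫ t in (-1)..x, (d t + m) * v t ^ p with hJ
  have hJd : ∀ x, HasDerivAt J ((d x + m) * v x ^ p) x := fun x =>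
    (((hd.add continuous_const).mul hvp).integral_hasStrictDerivAt (-1) x).hasDerivAt
  have hJ1 : J 1 = 0 := by
    have hdv : Continuous fun x => d x * v x ^ p := hd.mul hvp
    simp only [hJ, add_mul]
    rw [intervalIntegral.integral_add (hdv.intervalIntegrable _ _)
      ((hvp.const_mul m).intervalIntegrable _ _), intervalIntegral.integral_const_mul, hm,
      div_mul_cancel₀ _ hI.ne']
    ring
  have hJ2 : J (-1) = 0 := by simp [hJ]
  -- The solution of the linearised Riccati equation `h' = -(d + m) - p ψ(r₀) h`, `ψ = spow (q -
  -- 1)`, with integrating factor `v^p`. It vanishes at both ends, so `r₀ + s h` keeps the Robin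
  -- values.
  set h : ℝ → ℝ := fun x => -(J x * v x ^ (-p)) with hh
  set h' : ℝ → ℝ := fun x => -(d x + m) - p * spow (q - 1) (r₀ x) * h x with hh'
  have hhd : ∀ x ∈ Icc (-1 : ℝ) 1, HasDerivAt h (h' x) x := fun x hx => by
    refine ((hJd x).mul ((hvd x hx).rpow_const (p := -p) (Or.inl (hv0 x).ne'))).neg.congr_deriv ?_
    have e1 : v x ^ p * v x ^ (-p) = 1 := by
      rw [← Real.rpow_add (hv0 x), add_neg_cancel, Real.rpow_zero]
    have e2 : v x * v x ^ (-p - 1) = v x ^ (-p) := by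
      rw [mul_comm, ← Real.rpow_add_one (hv0 x).ne', sub_add_cancel]
    simp only [hh', hh]
    calc _ = -((d x + m) * (v x ^ p * v x ^ (-p)))
          + p * spow (q - 1) (r₀ x) * J x * (v x * v x ^ (-p - 1)) := by ring
      _ = _ := by rw [e1, e2]; ring
  refine ⟨m / 2, by positivity, ?_⟩
  -- The tangent inequality for `|r|^q` leaves the remainder `p h (ψ(r₀ + s h) - ψ(r₀))`; half of
  -- `m` is given up to absorb it uniformly in `x`.
  have hsmall : ∀ᶠ s in 𝓝 (0 : ℝ), ∀ x ∈ Icc (-1 : ℝ) 1,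
      p * (h x * (spow (q - 1) (r₀ x + s * h x) - spow (q - 1) (r₀ x))) < m / 2 := by
    refine isCompact_Icc.eventually_forall_of_forall_eventually fun y hy => ?_
    have hry : ContinuousAt (fun z : ℝ × ℝ => r₀ z.2) (0, y) :=
      ContinuousAt.comp (f := Prod.snd) (x := ((0 : ℝ), y)) (hr₀ y hy).continuousAt
        continuousAt_snd
    have hhy : ContinuousAt (fun z : ℝ × ℝ => h z.2) (0, y) :=
      ContinuousAt.comp (f := Prod.snd) (x := ((0 : ℝ), y)) (hhd y hy).continuousAt
        continuousAt_snd
    have hsp := continuous_spow hq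
    have hc : ContinuousAt (fun z : ℝ × ℝ => p * (h z.2 *
        (spow (q - 1) (r₀ z.2 + z.1 * h z.2) - spow (q - 1) (r₀ z.2)))) (0, y) :=
      continuousAt_const.mul (hhy.mul ((hsp.continuousAt.comp
        (hry.add (continuousAt_fst.mul hhy))).sub (hsp.continuousAt.comp hry)))
    refine hc.eventually (gt_mem_nhds ?_)
    simp only [zero_mul, add_zero, sub_self, mul_zero]
    positivity
  filter_upwards [mem_nhdsWithin_of_mem_nhds hsmall, self_mem_nhdsWithin] with s hs hs0
  have hs0' : 0 < s := hs0
  refine ⟨fun x => r₀ x + s * h x,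
    fun x => V x - l - (p - 1) * |r₀ x| ^ q + s * h' x,
    fun x hx => (hr₀ x hx).add ((hhd x hx).const_mul s), ?_, fun x hx => ?_, ?_, ?_⟩
  · have hr₀c : ContinuousOn r₀ (Icc (-1) 1) :=
      fun x hx => (hr₀ x hx).continuousAt.continuousWithinAt
    have hhc : ContinuousOn h (Icc (-1) 1) :=
      fun x hx => (hhd x hx).continuousAt.continuousWithinAt
    exact (continuousOn_riccati_rhs hpq.symm.nonneg hV hr₀).add (continuousOn_const.mul
      ((hd.add continuous_const).neg.continuousOn.sub ((continuousOn_const.mul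
        ((continuous_spow hq).comp_continuousOn hr₀c)).mul hhc)))
  · have h1 := abs_rpow_sub_le hpq.symm.lt (r₀ x) (r₀ x + s * h x)
    have h2 := hs x hx
    have h3 : (p - 1) * q = p := hpq.sub_one_mul_conj
    have h4 : (p - 1) * (|r₀ x + s * h x| ^ q - |r₀ x| ^ q)
        ≤ (p - 1) * (q * spow (q - 1) (r₀ x + s * h x) * (r₀ x + s * h x - r₀ x)) :=
      mul_le_mul_of_nonneg_left h1 hpq.sub_one_pos.le
    have h5 : (p - 1) * (q * spow (q - 1) (r₀ x + s * h x) * (r₀ x + s * h x - r₀ x))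
        = s * (p * (h x * spow (q - 1) (r₀ x + s * h x))) := by
      rw [show (p - 1) * (q * spow (q - 1) (r₀ x + s * h x) * (r₀ x + s * h x - r₀ x))
        = ((p - 1) * q) * (s * (h x * spow (q - 1) (r₀ x + s * h x))) by ring, h3]
      ring
    have h6 := mul_lt_mul_of_pos_left h2 hs0'
    rw [h5] at h4
    simp only [hh']
    linarith
  · simp only [hh, hJ1, hr₁]
    ring
  · simp only [hh, hJ2, hr₂]
    ring

/-! ### Decreasing the gap of a convex potential -/

theorem integral_sub_affine_mul {V w : ℝ → ℝ} (hV : Continuous V) (hw : Continuous w)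
    (a b k m : ℝ) : ∫ x in a..b, (V x - (k * x + m)) * w x
      = (∫ x in a..b, V x * w x) - k * (∫ x in a..b, x * w x) - m * ∫ x in a..b, w x := by
  have h1 : Continuous fun x => V x * w x := hV.mul hw
  have h2 : Continuous fun x => x * w x := continuous_id.mul hw
  have e : ∀ x, (V x - (k * x + m)) * w x = V x * w x - k * (x * w x) - m * w x := fun x => by ring
  have h3 : Continuous fun x => V x * w x - k * (x * w x) := h1.sub (h2.const_mul k)
  simp_rw [e]
  rw [intervalIntegral.integral_sub (h3.intervalIntegrable _ _)
      ((hw.const_mul m).intervalIntegrable _ _),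
    intervalIntegral.integral_sub (h1.intervalIntegrable _ _)
      ((h2.const_mul k).intervalIntegrable _ _), intervalIntegral.integral_const_mul,
    intervalIntegral.integral_const_mul]

/-- Orthogonality to both weights means that the line passes through the two weighted barycentres of
the graph of `V`, right and left of `c`. Their abscissae are separated by `c`, so the line exists.
The slope bounds keep later descent steps inside a compact set. -/
theorem exists_affine_orthogonal {V w w' : ℝ → ℝ} {c : ℝ} (hc : c ∈ Ioo (-1 : ℝ) 1)
    (hV : Continuous V) (hw : Continuous w) (hw' : Continuous w')
    (hpos : ∀ x, c < x → 0 < w x) (hpos' : ∀ x < c, 0 < w' x) :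
    ∃ κ m : ℝ, (∫ x in c..1, (V x - (κ * x + m)) * w x = 0) ∧
      (∫ x in (-1)..c, (V x - (κ * x + m)) * w' x = 0) ∧
      (∀ k, (∀ x ∈ Icc (-1 : ℝ) 1, ∀ y ∈ Icc (-1 : ℝ) 1, x ≤ y → k * (y - x) ≤ V y - V x) →
        k ≤ κ) ∧
      ∀ k, (∀ x ∈ Icc (-1 : ℝ) 1, ∀ y ∈ Icc (-1 : ℝ) 1, x ≤ y → V y - V x ≤ k * (y - x)) →
        κ ≤ k := by
  have hcI : c ∈ Icc (-1 : ℝ) 1 := Ioo_subset_Icc_self hc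
  set mR := ∫ x in c..1, w x with hmR
  set xR := ∫ x in c..1, x * w x with hxR
  set yR := ∫ x in c..1, V x * w x with hyR
  set mL := ∫ x in (-1)..c, w' x with hmL
  set xL := ∫ x in (-1)..c, x * w' x with hxL
  set yL := ∫ x in (-1)..c, V x * w' x with hyL
  have hmR0 : 0 < mR := intervalIntegral.intervalIntegral_pos_of_pos_on
    (hw.intervalIntegrable _ _) (fun x hx => hpos x hx.1) hc.2
  have hmL0 : 0 < mL := intervalIntegral.intervalIntegral_pos_of_pos_on
    (hw'.intervalIntegrable _ _) (fun x hx => hpos' x hx.2) hc.1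
  have hxR0 : c * mR < xR := by
    have h1 := intervalIntegral.intervalIntegral_pos_of_pos_on
      (f := fun x => (x - (0 * x + c)) * w x)
      (Continuous.intervalIntegrable (by fun_prop) _ _)
      (fun x hx => mul_pos (by linarith [hx.1]) (hpos x hx.1)) hc.2
    rw [integral_sub_affine_mul (V := fun x => x) continuous_id hw] at h1
    simp only [zero_mul, sub_zero] at h1
    linarith
  have hxL0 : xL < c * mL := by
    have h1 := intervalIntegral.intervalIntegral_pos_of_pos_on
      (f := fun x => (c - (1 * x + 0)) * w' x)
      (Continuous.intervalIntegrable (by fun_prop) _ _)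
      (fun x hx => mul_pos (by linarith [hx.2]) (hpos' x hx.2)) hc.1
    rw [integral_sub_affine_mul continuous_const hw', intervalIntegral.integral_const_mul] at h1
    linarith
  have hXR : c < xR / mR := (lt_div_iff₀ hmR0).2 hxR0
  have hXL : xL / mL < c := (div_lt_iff₀ hmL0).2 hxL0
  have hX : 0 < xR / mR - xL / mL := by linarith
  set κ := (yR / mR - yL / mL) / (xR / mR - xL / mL) with hκ
  have hκ' : κ * (xR / mR - xL / mL) = yR / mR - yL / mL := div_mul_cancel₀ _ hX.ne'
  refine ⟨κ, yR / mR - κ * (xR / mR), ?_, ?_, fun k hk => ?_, fun k hk => ?_⟩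
  · rw [integral_sub_affine_mul hV hw]
    change yR - κ * xR - (yR / mR - κ * (xR / mR)) * mR = 0
    field_simp
    ring
  · rw [integral_sub_affine_mul hV hw']
    change yL - κ * xL - (yR / mR - κ * (xR / mR)) * mL = 0
    rw [show yR / mR - κ * (xR / mR) = yL / mL - κ * (xL / mL) by linarith]
    field_simp
    ring
  -- The graph lies above the line of slope `k` through `(c, V c)` to the right of `c` and below it
  -- to the left. The barycentres inherit this, so the line through them has slope at least `k`.
  · have h1 : 0 ≤ ∫ x in c..1, (V x - (k * x + (V c - k * c))) * w x := by
      refine intervalIntegral.integral_nonneg_of_ae_restrict hc.2.le ?_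
      rw [Filter.EventuallyLE, ← restrict_Ioo_eq_restrict_Icc, ae_restrict_iff' measurableSet_Ioo]
      refine Eventually.of_forall fun x hx => mul_nonneg ?_ (hpos x hx.1).le
      have := hk c hcI x ⟨hc.1.le.trans hx.1.le, hx.2.le⟩ hx.1.le
      linarith
    have h2 : 0 ≤ ∫ x in (-1)..c, ((fun x => -V x) x - (-k * x + (-(V c - k * c)))) * w' x := by
      refine intervalIntegral.integral_nonneg_of_ae_restrict hc.1.le ?_
      rw [Filter.EventuallyLE, ← restrict_Ioo_eq_restrict_Icc, ae_restrict_iff' measurableSet_Ioo]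
      refine Eventually.of_forall fun x hx => mul_nonneg ?_ (hpos' x hx.2).le
      have := hk x ⟨hx.1.le, hx.2.le.trans hc.2.le⟩ c hcI hx.2.le
      linarith
    rw [integral_sub_affine_mul hV hw] at h1
    rw [integral_sub_affine_mul (V := fun x => -V x) hV.neg hw'] at h2
    simp only [neg_mul, intervalIntegral.integral_neg] at h2
    change 0 ≤ yR - k * xR - (V c - k * c) * mR at h1
    change 0 ≤ -yL - -(k * xL) - -((V c - k * c) * mL) at h2
    have h3 : k * (xR / mR) + (V c - k * c) ≤ yR / mR := by
      rw [le_div_iff₀ hmR0, add_mul, mul_assoc, div_mul_cancel₀ _ hmR0.ne']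
      linarith
    have h4 : yL / mL ≤ k * (xL / mL) + (V c - k * c) := by
      rw [div_le_iff₀ hmL0, add_mul, mul_assoc, div_mul_cancel₀ _ hmL0.ne']
      linarith
    refine le_of_mul_le_mul_right ?_ hX
    linarith
  · have h1 : 0 ≤ ∫ x in c..1, ((fun x => -V x) x - (-k * x + (-(V c - k * c)))) * w x := by
      refine intervalIntegral.integral_nonneg_of_ae_restrict hc.2.le ?_
      rw [Filter.EventuallyLE, ← restrict_Ioo_eq_restrict_Icc, ae_restrict_iff' measurableSet_Ioo]
      refine Eventually.of_forall fun x hx => mul_nonneg ?_ (hpos x hx.1).le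
      have := hk c hcI x ⟨hc.1.le.trans hx.1.le, hx.2.le⟩ hx.1.le
      linarith
    have h2 : 0 ≤ ∫ x in (-1)..c, (V x - (k * x + (V c - k * c))) * w' x := by
      refine intervalIntegral.integral_nonneg_of_ae_restrict hc.1.le ?_
      rw [Filter.EventuallyLE, ← restrict_Ioo_eq_restrict_Icc, ae_restrict_iff' measurableSet_Ioo]
      refine Eventually.of_forall fun x hx => mul_nonneg ?_ (hpos' x hx.2).le
      have := hk x ⟨hx.1.le, hx.2.le.trans hc.2.le⟩ c hcI hx.2.le
      linarith
    rw [integral_sub_affine_mul (V := fun x => -V x) hV.neg hw] at h1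
    rw [integral_sub_affine_mul hV hw'] at h2
    simp only [neg_mul, intervalIntegral.integral_neg] at h1
    change 0 ≤ -yR - -(k * xR) - -((V c - k * c) * mR) at h1
    change 0 ≤ yL - k * xL - (V c - k * c) * mL at h2
    have h3 : yR / mR ≤ k * (xR / mR) + (V c - k * c) := by
      rw [div_le_iff₀ hmR0, add_mul, mul_assoc, div_mul_cancel₀ _ hmR0.ne']
      linarith
    have h4 : k * (xL / mL) + (V c - k * c) ≤ yL / mL := by
      rw [le_div_iff₀ hmL0, add_mul, mul_assoc, div_mul_cancel₀ _ hmL0.ne']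
      linarith
    refine le_of_mul_le_mul_right ?_ hX
    linarith

/-- The sign of a convex function with two zeros. -/
theorem convexOn_sign {d : ℝ → ℝ} (hd : ConvexOn ℝ (Icc (-1) 1) d) {a b : ℝ}
    (ha : a ∈ Icc (-1 : ℝ) 1) (hb : b ∈ Icc (-1 : ℝ) 1) (hab : a < b) (hda : d a = 0)
    (hdb : d b = 0) {x : ℝ} (hx : x ∈ Icc (-1 : ℝ) 1) :
    (a ≤ x → x ≤ b → d x ≤ 0) ∧ (x ≤ a → 0 ≤ d x) ∧ (b ≤ x → 0 ≤ d x) := by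
  refine ⟨fun h1 h2 => ?_, fun h => ?_, fun h => ?_⟩
  · have := hd.le_max_of_mem_Icc ha hb ⟨h1, h2⟩
    rwa [hda, hdb, max_self] at this
  · by_contra! hneg
    rcases eq_or_lt_of_le h with rfl | hlt
    · linarith
    · have := hd.secant_mono_aux1 hx hb hlt hab
      rw [hda, hdb] at this
      nlinarith
  · by_contra! hneg
    rcases eq_or_lt_of_le h with rfl | hlt
    · linarith
    · have := hd.secant_mono_aux1 ha hx hab hlt
      rw [hda, hdb] at this
      nlinarith

/-- The convex, not affine potential `V` can be moved towards an affine function so that the gap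
decreases. -/
theorem exists_gap_lt {p : ℝ} [hp : Fact (1 < p)] (α : ℝ) {V : ℝ → ℝ} (hV : Continuous V)
    (hconv : ConvexOn ℝ (Icc (-1) 1) V)
    (haff : ¬ ∃ a b : ℝ, ∀ x ∈ Icc (-1 : ℝ) 1, V x = a * x + b) :
    ∃ κ : ℝ,
      (∀ k, (∀ x ∈ Icc (-1 : ℝ) 1, ∀ y ∈ Icc (-1 : ℝ) 1, x ≤ y → k * (y - x) ≤ V y - V x) →
        k ≤ κ) ∧
      (∀ k, (∀ x ∈ Icc (-1 : ℝ) 1, ∀ y ∈ Icc (-1 : ℝ) 1, x ≤ y → V y - V x ≤ k * (y - x)) →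
        κ ≤ k) ∧
      ∃ s ∈ Ioo (0 : ℝ) 1, gap p α (fun x => (1 - s) * V x + s * (κ * x)) < gap p α V := by
  have hpq := Real.HolderConjugate.conjExponent hp.out
  set q := p.conjExponent
  have hp0 := hpq.pos
  have hq : 0 < q - 1 := hpq.symm.sub_one_pos
  obtain ⟨l₀, l₁, c, r₀, r, s, hl, hc, hr₀, hr₀1, hr₀2, hr, hr1, hrc, hs, hs1, hsc⟩ :=
    exists_riccati hpq hV α
  have hcI : c ∈ Icc (-1 : ℝ) 1 := Ioo_subset_Icc_self hc
  obtain ⟨v, hv, hv0, hvd, hvE⟩ := exists_profile hpq hV hr₀ hr₀1 hr₀2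
  obtain ⟨f, C, hf, hf0, hfpos, hfd, hfC, hfE⟩ := exists_profile_right hpq hV hc.2 hr hr1 hrc
  obtain ⟨g, D, hg, hg0, hgpos, hgd, hgD, hgE⟩ := exists_profile_left hpq hV hc.1 hs hs1 hsc
  have hf0' : ∀ x, 0 ≤ f x := fun x => by
    rcases le_or_gt x c with h | h
    · exact (hf0 x h).ge
    · exact (hfpos x h).le
  have hg0' : ∀ x, 0 ≤ g x := fun x => by
    rcases le_or_gt c x with h | h
    · exact (hg0 x h).ge
    · exact (hgpos x h).le
  have hfp : Continuous fun x => f x ^ p := hf.rpow_const fun _ => Or.inr hp0.le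
  have hgp : Continuous fun x => g x ^ p := hg.rpow_const fun _ => Or.inr hp0.le
  have hvp : Continuous fun x => v x ^ p := hv.rpow_const fun _ => Or.inr hp0.le
  obtain ⟨κ, m, hR, hL, hκ1, hκ2⟩ := exists_affine_orthogonal hc hV hfp hgp
    (fun x hx => Real.rpow_pos_of_pos (hfpos x hx) p)
    (fun x hx => Real.rpow_pos_of_pos (hgpos x hx) p)
  refine ⟨κ, hκ1, hκ2, ?_⟩
  set d : ℝ → ℝ := fun x => V x - (κ * x + m) with hd
  have hdc : Continuous d := by fun_prop
  have hdconv : ConvexOn ℝ (Icc (-1) 1) d := by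
    refine hconv.sub ⟨convex_Icc _ _, fun x _ y _ a b _ _ hab => le_of_eq ?_⟩
    simp only [smul_eq_mul]
    linear_combination m * hab
  -- the zeros of `d` on the two sides of the node
  obtain ⟨b, hb, hdb⟩ := exists_zero_of_integral_mul_eq_zero hc.2 hdc hfp
    (fun x hx => Real.rpow_pos_of_pos (hfpos x hx.1) p) hR
  obtain ⟨a, ha, hda⟩ := exists_zero_of_integral_mul_eq_zero hc.1 hdc hgp
    (fun x hx => Real.rpow_pos_of_pos (hgpos x hx.2) p) hL
  have haI : a ∈ Icc (-1 : ℝ) 1 := ⟨ha.1.le, ha.2.le.trans hc.2.le⟩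
  have hbI : b ∈ Icc (-1 : ℝ) 1 := ⟨hc.1.le.trans hb.1.le, hb.2.le⟩
  have hsign := fun {x : ℝ} => convexOn_sign hdconv haI hbI (ha.2.trans hb.1) hda hdb (x := x)
  -- The logarithmic derivative of `f / v` is `ψ(r) - ψ(r₀)`, with `ψ` increasing and `r₀ < r` by
  -- Riccati comparison from the common value at `1`.
  have hmonoR : StrictMonoOn (fun x => f x / v x) (Icc c 1) := by
    refine strictMonoOn_of_deriv_pos (convex_Icc _ _)
      (hf.div hv fun x => (hv0 x).ne').continuousOn fun x hx => ?_
    rw [interior_Icc] at hx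
    have hxI : x ∈ Icc (-1 : ℝ) 1 := ⟨hc.1.le.trans hx.1.le, hx.2.le⟩
    rw [(hasDerivAt_div_profile (hfd x ⟨hx.1, hx.2.le⟩) (hvd x hxI) (hv0 x)).deriv]
    have h1 := riccati_lt hl (fun y hy => hr₀ y ⟨hc.1.le.trans hy.1.le, hy.2⟩) hr
      (hr1.trans hr₀1.symm) hx
    have h2 := strictMono_spow hq h1
    exact mul_pos (by linarith) (div_pos (hfpos x hx.1) (hv0 x))
  have hantiL : StrictAntiOn (fun x => g x / v x) (Icc (-1) c) := by
    refine strictAntiOn_of_deriv_neg (convex_Icc _ _)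
      (hg.div hv fun x => (hv0 x).ne').continuousOn fun x hx => ?_
    rw [interior_Icc] at hx
    have hxI : x ∈ Icc (-1 : ℝ) 1 := ⟨hx.1.le, hx.2.le.trans hc.2.le⟩
    rw [(hasDerivAt_div_profile (hgd x ⟨hx.1.le, hx.2⟩) (hvd x hxI) (hv0 x)).deriv]
    have h1 := riccati_gt hl (fun y hy => hr₀ y ⟨hy.1, hy.2.le.trans hc.2.le⟩) hs
      (hs1.trans hr₀2.symm) hx
    have h2 := strictMono_spow hq h1
    exact mul_neg_of_neg_of_pos (by linarith) (div_pos (hgpos x hx.2) (hv0 x))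
  obtain ⟨hRle, hRlt⟩ := integral_mul_rpow_neg hp0 hc.2 hdc hf hv hv0 (fun x _ => hf0' x)
    (div_pos (hfpos b hb.1) (hv0 b)) hdb (fun x hx hxb => by
      have hxI : x ∈ Icc (-1 : ℝ) 1 := ⟨hc.1.le.trans hx.1, hx.2⟩
      rcases lt_or_gt_of_ne hxb with h | h
      · exact Or.inl ⟨hmonoR hx ⟨hb.1.le, hb.2.le⟩ h,
          (hsign hxI).1 (ha.2.le.trans hx.1) h.le⟩
      · exact Or.inr ⟨hmonoR ⟨hb.1.le, hb.2.le⟩ hx h, (hsign hxI).2.2 h.le⟩) hR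
  obtain ⟨hLle, hLlt⟩ := integral_mul_rpow_neg hp0 hc.1 hdc hg hv hv0 (fun x _ => hg0' x)
    (div_pos (hgpos a ha.2) (hv0 a)) hda (fun x hx hxa => by
      have hxI : x ∈ Icc (-1 : ℝ) 1 := ⟨hx.1, hx.2.trans hc.2.le⟩
      rcases lt_or_gt_of_ne hxa with h | h
      · exact Or.inr ⟨hantiL hx ⟨ha.1.le, ha.2.le⟩ h, (hsign hxI).2.1 h.le⟩
      · exact Or.inl ⟨hantiL ⟨ha.1.le, ha.2.le⟩ hx h,
          (hsign hxI).1 h.le (hx.2.trans hb.1.le)⟩) hL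
  have hneg : ∫ x in (-1)..1, d x * v x ^ p < 0 := by
    have hdv : Continuous fun x => d x * v x ^ p := hdc.mul hvp
    rw [← intervalIntegral.integral_add_adjacent_intervals (hdv.intervalIntegrable (-1) c)
      (hdv.intervalIntegrable c 1)]
    obtain ⟨x, hx, hdx⟩ : ∃ x ∈ Icc (-1 : ℝ) 1, d x ≠ 0 := by
      by_contra! h
      exact haff ⟨κ, m, fun x hx => by linarith [h x hx]⟩
    rcases le_total x c with h | h
    · linarith [hLlt ⟨x, ⟨hx.1, h⟩, hdx⟩]
    · linarith [hRlt ⟨x, ⟨h, hx.2⟩, hdx⟩]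
  obtain ⟨η, hη, hsub⟩ := exists_subsolution hpq hV hdc hv hv0 hr₀ hr₀1 hr₀2 hvd hneg
  obtain ⟨t, ⟨R, R', hRd, hRc, hRle', hR1, hR2⟩, ht⟩ :=
    (hsub.and (Ioo_mem_nhdsGT (zero_lt_one' ℝ))).exists
  refine ⟨t, ht, ?_⟩
  -- This is `V - t d - t m`; the constant `t m` shifts both eigenvalues alike and cancels in the
  -- gap.
  set W : ℝ → ℝ := fun x => (1 - t) * V x + t * (κ * x) with hW
  have hWc : Continuous W := by fun_prop
  have hWd : ∀ x, V x - W x = t * d x + t * m := fun x => by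
    simp only [hW, hd]
    ring
  -- the eigenfunctions as elements of `W1p`
  have hrcont : ContinuousOn r (Ioc c 1) := fun x hx => (hr x hx).continuousAt.continuousWithinAt
  have hscont : ContinuousOn s (Ico (-1) c) :=
    fun x hx => (hs x hx).continuousAt.continuousWithinAt
  have hr₀cont : ContinuousOn r₀ (Icc (-1) 1) :=
    fun x hx => (hr₀ x hx).continuousAt.continuousWithinAt
  have hψv : ContinuousOn (fun x => spow (q - 1) (r₀ x) * v x) (Icc (-1) 1) :=
    ((continuous_spow hq).comp_continuousOn hr₀cont).mul hv.continuousOn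
  obtain ⟨E, hE⟩ := isCompact_Icc.exists_bound_of_continuousOn hψv
  obtain ⟨u₀, hu₀, hu₀'⟩ := exists_W1p_indicator (p := p) measurableSet_Icc countable_empty hv
    hψv hE hvd (fun x hx hx' => absurd (Ioo_subset_Icc_self hx) hx')
  have hψf : ContinuousOn (fun x => spow (q - 1) (r x) * f x) (Ioc c 1) :=
    ((continuous_spow hq).comp_continuousOn hrcont).mul hf.continuousOn
  have hψg : ContinuousOn (fun x => spow (q - 1) (s x) * g x) (Ico (-1) c) :=
    ((continuous_spow hq).comp_continuousOn hscont).mul hg.continuousOn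
  obtain ⟨uR, huR, huR'⟩ := exists_W1p_indicator (p := p) measurableSet_Ioc (countable_singleton c)
    hf hψf hfC hfd
    (fun x hx hx' hxc => by
      have hlt : x < c := by
        by_contra! h
        exact hx' ⟨lt_of_le_of_ne h (Ne.symm hxc), hx.2.le⟩
      refine (hasDerivAt_const x (0 : ℝ)).congr_of_eventuallyEq ?_
      filter_upwards [Iio_mem_nhds hlt] with y hy using hf0 y (le_of_lt hy))
  obtain ⟨uL, huL, huL'⟩ := exists_W1p_indicator (p := p) measurableSet_Ico (countable_singleton c)
    hg hψg hgD hgd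
    (fun x hx hx' hxc => by
      have hlt : c < x := by
        by_contra! h
        exact hx' ⟨hx.1.le, lt_of_le_of_ne h hxc⟩
      refine (hasDerivAt_const x (0 : ℝ)).congr_of_eventuallyEq ?_
      filter_upwards [Ioi_mem_nhds hlt] with y hy using hg0 y (le_of_lt hy))
  have hu₀ne : u₀ ≠ 0 := ne_zero_of_evalAt_pos (x := 0) (by
    rw [hu₀ 0 (by norm_num)]
    exact hv0 0)
  have huRne : uR ≠ 0 := ne_zero_of_evalAt_pos (x := 1) (by
    rw [huR 1 (by norm_num)]
    exact hfpos 1 hc.2)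
  have huLne : uL ≠ 0 := ne_zero_of_evalAt_pos (x := -1) (by
    rw [huL (-1) (by norm_num)]
    exact hgpos (-1) hc.1)
  have hzero : (0 : ℝ) ^ p = 0 := Real.zero_rpow hp0.ne'
  have en₀ : energy p α V u₀ = l₀ * mass p u₀ := by
    refine energy_eq_of_profile hV (c := 1) (by norm_num) (fun x _ => (hv0 x).le) hu₀ hu₀' ?_
    rw [intervalIntegral.integral_same, add_zero, ← hvE]
    refine intervalIntegral.integral_congr fun x hx => ?_
    rw [uIcc_of_le (by norm_num)] at hx
    simp only [indicator_of_mem hx]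
  have enR : energy p α V uR = l₁ * mass p uR := by
    refine energy_eq_of_profile hV hcI (fun x _ => hf0' x) huR huR' ?_
    have h1 : ∫ x in (-1)..c, (|(Ioc c 1).indicator (fun x => spow (q - 1) (r x) * f x) x| ^ p
        + (V x - l₁) * f x ^ p) = 0 := by
      refine (intervalIntegral.integral_congr fun x hx => ?_).trans
        (intervalIntegral.integral_zero (a := -1) (b := c))
      rw [uIcc_of_le hc.1.le] at hx
      simp only [indicator_of_notMem (fun h : x ∈ Ioc c 1 => absurd h.1 (not_lt.2 hx.2)),
        hf0 x hx.2, abs_zero, hzero, mul_zero, add_zero]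
    have h2 : ∫ x in c..1, (|(Ioc c 1).indicator (fun x => spow (q - 1) (r x) * f x) x| ^ p
        + (V x - l₁) * f x ^ p) = -α * f 1 ^ p := by
      rw [← hfE]
      refine intervalIntegral.integral_congr fun x hx => ?_
      rw [uIcc_of_le hc.2.le] at hx
      rcases eq_or_lt_of_le hx.1 with rfl | h
      · simp [hf0 c le_rfl]
      · simp only [indicator_of_mem (show x ∈ Ioc c 1 from ⟨h, hx.2⟩)]
    rw [h1, h2, hf0 (-1) hc.1.le, hzero]
    ring
  have enL : energy p α V uL = l₁ * mass p uL := by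
    refine energy_eq_of_profile hV hcI (fun x _ => hg0' x) huL huL' ?_
    have h1 : ∫ x in c..1, (|(Ico (-1) c).indicator (fun x => spow (q - 1) (s x) * g x) x| ^ p
        + (V x - l₁) * g x ^ p) = 0 := by
      refine (intervalIntegral.integral_congr fun x hx => ?_).trans
        (intervalIntegral.integral_zero (a := c) (b := 1))
      rw [uIcc_of_le hc.2.le] at hx
      simp only [indicator_of_notMem (fun h : x ∈ Ico (-1) c => absurd h.2 (not_lt.2 hx.1)),
        hg0 x hx.1, abs_zero, hzero, mul_zero, add_zero]
    have h2 : ∫ x in (-1)..c, (|(Ico (-1) c).indicator (fun x => spow (q - 1) (s x) * g x) x| ^ p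
        + (V x - l₁) * g x ^ p) = -α * g (-1) ^ p := by
      rw [← hgE]
      refine intervalIntegral.integral_congr fun x hx => ?_
      rw [uIcc_of_le hc.1.le] at hx
      rcases eq_or_lt_of_le hx.2 with rfl | h
      · simp [hg0 x le_rfl]
      · simp only [indicator_of_mem (show x ∈ Ico (-1) c from ⟨hx.1, h⟩)]
    rw [h1, h2, hg0 1 hc.2.le, hzero]
    ring
  -- Orthogonality to `d` means that the perturbation acts on the nodal pieces only through the
  -- constant.
  have hshift : ∀ u : W1p p, (∫ x in (-1)..1, d x * |evalAt u x| ^ p) = 0 →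
      energy p α V u = l₁ * mass p u → energy p α W u ≤ (l₁ - t * m) * mass p u := by
    intro u hu0 huE
    have hup : Continuous fun x => |evalAt u x| ^ p :=
      (continuous_evalAt u).abs.rpow_const fun _ => Or.inr hp0.le
    have hdu : Continuous fun x => d x * |evalAt u x| ^ p := hdc.mul hup
    rw [energy_eq_sub_integral hV hWc, huE]
    have e : ∀ x, (V x - W x) * |evalAt u x| ^ p
        = t * (d x * |evalAt u x| ^ p) + t * m * |evalAt u x| ^ p := fun x => by
      rw [hWd]
      ring
    simp_rw [e]
    rw [intervalIntegral.integral_add ((hdu.const_mul t).intervalIntegrable _ _)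
      ((hup.const_mul (t * m)).intervalIntegrable _ _), intervalIntegral.integral_const_mul,
      intervalIntegral.integral_const_mul, hu0, mul_zero, zero_add,
      intervalIntegral.integral_of_le (by norm_num), integral_Ioc_eq_integral_Ioo, mass]
    linarith
  have hdR : (∫ x in (-1)..1, d x * |evalAt uR x| ^ p) = 0 := by
    have hdf : Continuous fun x => d x * f x ^ p := hdc.mul hfp
    have h1 : ∫ x in (-1)..1, d x * |evalAt uR x| ^ p = ∫ x in (-1)..1, d x * f x ^ p := by
      refine intervalIntegral.integral_congr fun x hx => ?_
      rw [uIcc_of_le (by norm_num)] at hx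
      simp only [huR x hx, abs_of_nonneg (hf0' x)]
    have h2 : ∫ x in (-1)..c, d x * f x ^ p = 0 := by
      refine (intervalIntegral.integral_congr fun x hx => ?_).trans
        (intervalIntegral.integral_zero (a := -1) (b := c))
      rw [uIcc_of_le hc.1.le] at hx
      simp only [hf0 x hx.2, hzero, mul_zero]
    rw [h1, ← intervalIntegral.integral_add_adjacent_intervals (hdf.intervalIntegrable (-1) c)
      (hdf.intervalIntegrable c 1), h2, hR, add_zero]
  have hdL : (∫ x in (-1)..1, d x * |evalAt uL x| ^ p) = 0 := by
    have hdg : Continuous fun x => d x * g x ^ p := hdc.mul hgp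
    have h1 : ∫ x in (-1)..1, d x * |evalAt uL x| ^ p = ∫ x in (-1)..1, d x * g x ^ p := by
      refine intervalIntegral.integral_congr fun x hx => ?_
      rw [uIcc_of_le (by norm_num)] at hx
      simp only [huL x hx, abs_of_nonneg (hg0' x)]
    have h2 : ∫ x in c..1, d x * g x ^ p = 0 := by
      refine (intervalIntegral.integral_congr fun x hx => ?_).trans
        (intervalIntegral.integral_zero (a := c) (b := 1))
      rw [uIcc_of_le hc.2.le] at hx
      simp only [hg0 x hx.1, hzero, mul_zero]
    rw [h1, ← intervalIntegral.integral_add_adjacent_intervals (hdg.intervalIntegrable (-1) c)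
      (hdg.intervalIntegrable c 1), h2, hL, add_zero]
  -- Four one-sided bounds suffice: upper for the first and lower for the second eigenvalue of `V`,
  -- the reverse for `W`.
  have bd1 : eigenvalue p α V 0 ≤ l₀ := eigenvalue_zero_le hV hu₀ne en₀.le
  have bd2 : l₁ ≤ eigenvalue p α V 1 := le_eigenvalue_one hV (c := c) fun u hu =>
    mul_mass_le_energy_of_node hpq hV hc hr hr1 hs hs1 hu
  have bd3 : eigenvalue p α W 1 ≤ l₁ - t * m := by
    refine eigenvalue_one_le hWc huRne huLne (fun x hx => ?_) ?_ (hshift uR hdR enR)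
      (hshift uL hdL enL)
    · rw [huR x hx, huL x hx]
      rcases le_total x c with h | h
      · rw [hf0 x h, zero_mul]
      · rw [hg0 x h, mul_zero]
    · filter_upwards [huR', huL'] with x h1 h2
      rw [h1, h2]
      rcases le_or_gt x c with h | h
      · rw [indicator_of_notMem (fun h' : x ∈ Ioc c 1 => absurd h'.1 (not_lt.2 h)), zero_mul]
      · rw [indicator_of_notMem (fun h' : x ∈ Ico (-1) c => absurd h'.2 (not_lt.2 h.le)), mul_zero]
  have bd4 : l₀ + t * η - t * m ≤ eigenvalue p α W 0 := le_eigenvalue_zero hWc fun u =>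
    mul_mass_le_energy hpq hWc hRd hRc (fun x hx => by
      have h1 := hRle' x hx
      have h2 := hWd x
      linarith) hR1 hR2 u
  have := mul_pos ht.1 hη
  rw [gap, gap]
  linarith

/-! ### Minimizing the gap over segments from a convex to an affine potential -/

theorem convexOn_mul_add_linear {V : ℝ → ℝ} (hV : ConvexOn ℝ (Icc (-1) 1) V) {t : ℝ} (ht : 0 ≤ t)
    (a : ℝ) : ConvexOn ℝ (Icc (-1) 1) fun x => t * V x + a * x := by
  refine ⟨convex_Icc _ _, fun x hx y hy b c hb hc hbc => ?_⟩
  have h := mul_le_mul_of_nonneg_left (hV.2 hx hy hb hc hbc) ht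
  simp only [smul_eq_mul] at h ⊢
  linarith

/-- Each eigenvalue is monotone in the potential and commutes with constant shifts, so the gap is
Lipschitz in the sup norm of the potential on `[-1, 1]`. -/
theorem continuous_gap_mul_add_linear {p : ℝ} [Fact (1 < p)] (α : ℝ) {V : ℝ → ℝ}
    (hV : Continuous V) :
    Continuous fun z : ℝ × ℝ => gap p α fun x => z.1 * V x + z.2 * x := by
  obtain ⟨M, hM⟩ := isCompact_Icc.exists_bound_of_continuousOn (hV.continuousOn (s := Icc (-1) 1))
  have hM0 : 0 ≤ M := (norm_nonneg _).trans (hM 0 (by norm_num))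
  have key : ∀ z z' : ℝ × ℝ, ∀ x ∈ Icc (-1 : ℝ) 1,
      z.1 * V x + z.2 * x ≤ z'.1 * V x + z'.2 * x + (M + 1) * dist z z' := by
    intro z z' x hx
    have h1 : (z.1 - z'.1) * V x ≤ dist z z' * M := by
      refine (le_abs_self _).trans ?_
      rw [abs_mul]
      exact mul_le_mul (le_max_left _ _) (hM x hx) (abs_nonneg _) dist_nonneg
    have h2 : (z.2 - z'.2) * x ≤ dist z z' * 1 := by
      refine (le_abs_self _).trans ?_
      rw [abs_mul]
      exact mul_le_mul (le_max_right _ _) (abs_le.2 hx) (abs_nonneg _) dist_nonneg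
    linarith
  refine (LipschitzWith.of_le_add_mul ⟨2 * (M + 1), by positivity⟩ fun z z' => ?_).continuous
  have h := gap_le_add (p := p) (α := α) (by fun_prop) (by fun_prop) (key z z') (key z' z)
  rw [dist_comm z' z] at h
  refine h.trans_eq ?_
  change _ = _ + 2 * (M + 1) * dist z z'
  ring

/-- A convex potential with bounded slopes has at least the gap of some linear potential. -/
theorem exists_gap_linear_le {p : ℝ} [Fact (1 < p)] (α : ℝ) {V : ℝ → ℝ} (hV : Continuous V)
    (hconv : ConvexOn ℝ (Icc (-1) 1) V) {K : ℝ} (hK : 0 ≤ K)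
    (hslope : ∀ x ∈ Icc (-1 : ℝ) 1, ∀ y ∈ Icc (-1 : ℝ) 1, x ≤ y → |V y - V x| ≤ K * (y - x)) :
    ∃ a : ℝ, gap p α (fun x => a * x) ≤ gap p α V := by
  by_cases haff : ∃ a b : ℝ, ∀ x ∈ Icc (-1 : ℝ) 1, V x = a * x + b
  · obtain ⟨a, b, h⟩ := haff
    have h1 := gap_le_add (p := p) (α := α) (V := fun x => a * x) (W := V) (b := -b) (b' := b)
      (by fun_prop) hV (fun x hx => by linarith [h x hx]) (fun x hx => (h x hx).le)
    exact ⟨a, by linarith⟩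
  -- The triangle with vertices `(1, 0)` and `(0, ±K)`; its side `t = 0` carries the linear
  -- potentials.
  set S : Set (ℝ × ℝ) := {z | z.1 ∈ Icc (0 : ℝ) 1 ∧ |z.2| ≤ K * (1 - z.1)} with hS
  have hSc : IsCompact S := by
    have h1 : IsClosed {z : ℝ × ℝ | z.1 ∈ Icc (0 : ℝ) 1} := isClosed_Icc.preimage continuous_fst
    have h2 : IsClosed {z : ℝ × ℝ | |z.2| ≤ K * (1 - z.1)} :=
      isClosed_le (by fun_prop) (by fun_prop)
    have h3 : IsCompact (Icc (0 : ℝ) 1 ×ˢ Icc (-K) K) := isCompact_Icc.prod isCompact_Icc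
    refine h3.of_isClosed_subset (h1.inter h2) ?_
    rintro ⟨t, a⟩ ⟨ht, ha⟩
    exact ⟨ht, abs_le.1 (ha.trans (mul_le_of_le_one_right hK (by linarith [ht.1])))⟩
  have hS1 : ((1 : ℝ), (0 : ℝ)) ∈ S := by simp [hS]
  obtain ⟨⟨t, a⟩, hta, hmin⟩ := hSc.exists_isMinOn ⟨_, hS1⟩
    (continuous_gap_mul_add_linear (p := p) α hV).continuousOn
  have hmin' : ∀ t' a', (t', a') ∈ S → gap p α (fun x => t * V x + a * x)
      ≤ gap p α fun x => t' * V x + a' * x := fun t' a' h => isMinOn_iff.1 hmin (t', a') h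
  obtain ⟨ht, ha⟩ := hta
  simp only at ht ha
  rcases eq_or_lt_of_le ht.1 with h0 | h0
  · have h1 := hmin' 1 0 hS1
    simp only [← h0, zero_mul, one_mul, zero_add, add_zero] at h1
    exact ⟨a, h1⟩
  exfalso
  obtain ⟨κ, hκ1, hκ2, s, hs, hlt⟩ := exists_gap_lt (p := p) α
    (V := fun x => t * V x + a * x) (by fun_prop) (convexOn_mul_add_linear hconv h0.le a) (by
      rintro ⟨a', b, h⟩
      refine haff ⟨(a' - a) / t, b / t, fun x hx => ?_⟩
      have := h x hx
      field_simp
      linarith)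
  -- The slopes of `t V + a x` lie in `[a - t K, a + t K]`, hence so does `κ`. Then `|(1-s) a + s κ|
  -- ≤ |a| + s t K ≤ K (1 - (1-s) t)`, and the new point remains in the triangle, contradicting
  -- minimality.
  have hκ3 : a - t * K ≤ κ := hκ1 _ fun x hx y hy hxy => by
    have := mul_le_mul_of_nonneg_left (abs_le.1 (hslope x hx y hy hxy)).1 h0.le
    linarith
  have hκ4 : κ ≤ a + t * K := hκ2 _ fun x hx y hy hxy => by
    have := mul_le_mul_of_nonneg_left (abs_le.1 (hslope x hx y hy hxy)).2 h0.le
    linarith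
  have hmem : ((1 - s) * t, (1 - s) * a + s * κ) ∈ S := by
    have hs1 : 0 ≤ 1 - s := by linarith [hs.2]
    refine ⟨⟨mul_nonneg hs1 h0.le, mul_le_one₀ (by linarith [hs.1]) h0.le ht.2⟩, ?_⟩
    obtain ⟨ha1, ha2⟩ := abs_le.1 ha
    have h1 := mul_le_mul_of_nonneg_left hκ3 hs.1.le
    have h2 := mul_le_mul_of_nonneg_left hκ4 hs.1.le
    rw [abs_le]
    constructor <;> linarith
  refine absurd (hmin' _ _ hmem) (not_le.2 (lt_of_eq_of_lt (gap_congr fun x _ => ?_) hlt))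
  ring

/-- A convex function on `[-1, 1]` has bounded slopes on `[-ρ, ρ]` for `ρ < 1`. -/
theorem abs_sub_le_of_convexOn {V : ℝ → ℝ} (hV : ConvexOn ℝ (Icc (-1) 1) V) {M ρ : ℝ}
    (hM : ∀ x ∈ Icc (-1 : ℝ) 1, |V x| ≤ M) (hρ1 : ρ < 1) {x y : ℝ}
    (hx : -ρ ≤ x) (hy : y ≤ ρ) (hxy : x ≤ y) : |V y - V x| ≤ 2 * M / (1 - ρ) * (y - x) := by
  rcases eq_or_lt_of_le hxy with rfl | hlt
  · simp
  have hm1 : (-1 : ℝ) ∈ Icc (-1 : ℝ) 1 := by norm_num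
  have h1 : (1 : ℝ) ∈ Icc (-1 : ℝ) 1 := by norm_num
  have hxI : x ∈ Icc (-1 : ℝ) 1 := ⟨by linarith, by linarith⟩
  have hyI : y ∈ Icc (-1 : ℝ) 1 := ⟨by linarith, by linarith⟩
  -- The chord over `[x, y]` has slope between those of the chords over `[-1, x]` and `[y, 1]`,
  -- whose lengths are at least `1 - ρ`.
  have hR := hV.slope_mono_adjacent hxI h1 hlt (by linarith)
  have hL := hV.slope_mono_adjacent hm1 hyI (by linarith) hlt
  obtain ⟨a1, a2⟩ := abs_le.1 (hM 1 h1)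
  obtain ⟨b1, b2⟩ := abs_le.1 (hM (-1) hm1)
  obtain ⟨c1, c2⟩ := abs_le.1 (hM x hxI)
  obtain ⟨d1, d2⟩ := abs_le.1 (hM y hyI)
  have hR' : (V 1 - V y) / (1 - y) ≤ 2 * M / (1 - ρ) :=
    div_le_div₀ (by linarith) (by linarith) (by linarith) (by linarith)
  have hL' : -((V x - V (-1)) / (x - -1)) ≤ 2 * M / (1 - ρ) := by
    rw [← neg_div]
    exact div_le_div₀ (by linarith) (by linarith) (by linarith) (by linarith)
  have hd : 0 < y - x := by linarith
  have habs : |V y - V x| / (y - x) = |(V y - V x) / (y - x)| := by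
    rw [abs_div, abs_of_pos hd]
  rw [← div_le_iff₀ hd, habs, abs_le]
  constructor <;> linarith

/-- A convex potential which is not affine has a larger gap than some linear potential. -/
theorem exists_gap_linear_lt {p : ℝ} [Fact (1 < p)] (α : ℝ) {V : ℝ → ℝ}
    (hVcont : ContinuousOn V (Icc (-1) 1)) (hVconv : ConvexOn ℝ (Icc (-1) 1) V)
    (hVaff : ¬ ∃ a b : ℝ, ∀ x ∈ Icc (-1 : ℝ) 1, V x = a * x + b) :
    ∃ a : ℝ, gap p α (fun x => a * x) < gap p α V := by
  have hI : (-1 : ℝ) ≤ 1 := by norm_num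
  -- Continuity on all of `ℝ` is needed above, so `V` is extended by constants; the gap sees only
  -- `[-1, 1]`.
  set U : ℝ → ℝ := IccExtend hI ((Icc (-1 : ℝ) 1).domRestrict V) with hU
  have hUV : ∀ x ∈ Icc (-1 : ℝ) 1, V x = U x := fun x hx => by
    rw [hU, IccExtend_of_mem hI _ hx, domRestrict_apply]
  have hUc : Continuous U := hVcont.domRestrict.Icc_extend'
  have hUconv : ConvexOn ℝ (Icc (-1) 1) U := hVconv.congr hUV
  rw [gap_congr hUV]
  -- Strictness is secured here, before the dilation: its cost is kept below two thirds of the gain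
  -- from this first step.
  obtain ⟨κ, -, -, s, hs, hlt⟩ := exists_gap_lt (p := p) α hUc hUconv (by
    rintro ⟨a, b, h⟩
    exact hVaff ⟨a, b, fun x hx => (hUV x hx).trans (h x hx)⟩)
  set W : ℝ → ℝ := fun x => (1 - s) * U x + s * κ * x with hW
  have hWc : Continuous W := by fun_prop
  have hWconv : ConvexOn ℝ (Icc (-1) 1) W :=
    convexOn_mul_add_linear hUconv (by linarith [hs.2]) _
  have hlt' : gap p α W < gap p α U :=
    lt_of_eq_of_lt (gap_congr fun x _ => by simp only [hW]; ring) hlt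
  obtain ⟨M, hM⟩ := isCompact_Icc.exists_bound_of_continuousOn (hWc.continuousOn (s := Icc (-1) 1))
  have hM0 : 0 ≤ M := (norm_nonneg _).trans (hM 0 (by norm_num))
  obtain ⟨δ, hδ, hδW⟩ := Metric.uniformContinuousOn_iff.1
    (isCompact_Icc.uniformContinuousOn_of_continuous (hWc.continuousOn (s := Icc (-1 : ℝ) 1)))
    ((gap p α U - gap p α W) / 3) (by linarith)
  obtain ⟨ρ, hρ, hρ1⟩ : ∃ ρ, max 0 (1 - δ) < ρ ∧ ρ < 1 :=
    exists_between (max_lt one_pos (by linarith))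
  have hρ0 : 0 < ρ := (le_max_left _ _).trans_lt hρ
  have hρδ : 1 - ρ < δ := by linarith [(le_max_right _ _).trans_lt hρ]
  have hρI : ∀ x ∈ Icc (-1 : ℝ) 1, -ρ ≤ ρ * x ∧ ρ * x ≤ ρ := fun x hx =>
    ⟨by nlinarith [hx.1], by nlinarith [hx.2]⟩
  have hρI' : ∀ x ∈ Icc (-1 : ℝ) 1, ρ * x ∈ Icc (-1 : ℝ) 1 := fun x hx =>
    ⟨by linarith [(hρI x hx).1], by linarith [(hρI x hx).2]⟩
  have hclose : ∀ x ∈ Icc (-1 : ℝ) 1,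
      |W (ρ * x) - W x| < (gap p α U - gap p α W) / 3 := fun x hx => by
    refine hδW _ (hρI' x hx) _ hx (lt_of_le_of_lt ?_ hρδ)
    rw [Real.dist_eq, show ρ * x - x = -((1 - ρ) * x) by ring, abs_neg, abs_mul,
      abs_of_pos (by linarith)]
    exact mul_le_of_le_one_right (by linarith) (abs_le.2 hx)
  -- The dilated potential samples `W` only on `[-ρ, ρ]`, where a convex function has bounded
  -- slopes.
  obtain ⟨a, ha⟩ := exists_gap_linear_le (p := p) α (V := fun x => W (ρ * x)) (by fun_prop)
    ⟨convex_Icc _ _, fun x hx y hy b c hb hc hbc => by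
      have h := hWconv.2 (hρI' x hx) (hρI' y hy) hb hc hbc
      rwa [show b • (ρ * x) + c • (ρ * y) = ρ * (b • x + c • y) by
        simp only [smul_eq_mul]; ring] at h⟩
    (K := 2 * M / (1 - ρ) * ρ) (mul_nonneg (div_nonneg (by linarith) (by linarith)) hρ0.le)
    (fun x hx y hy hxy => (abs_sub_le_of_convexOn hWconv hM hρ1 (hρI x hx).1 (hρI y hy).2
      (mul_le_mul_of_nonneg_left hxy hρ0.le)).trans_eq (by ring))
  refine ⟨a, ha.trans_lt ?_⟩
  have h := gap_le_add (p := p) (α := α) (V := fun x => W (ρ * x)) (W := W)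
    (b := (gap p α U - gap p α W) / 3) (b' := (gap p α U - gap p α W) / 3) (by fun_prop) hWc (fun x hx => by linarith [(abs_lt.1 (hclose x hx)).2])
    (fun x hx => by linarith [(abs_lt.1 (hclose x hx)).1])
  linarith

end RobinGap

theorem theorem2 (p : ℝ) [Fact (1 < p)] (α : ℝ) (V : ℝ → ℝ)
    (hVcont : ContinuousOn V (Set.Icc (-1) 1))
    (hVconv : ConvexOn ℝ (Set.Icc (-1) 1) V)
    (hVaff : ¬ ∃ a b : ℝ, ∀ x ∈ Set.Icc (-1 : ℝ) 1, V x = a * x + b) :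
    ∃ a : ℝ, RobinGap.gap p α V > RobinGap.gap p α (fun x => a * x) :=
  RobinGap.exists_gap_linear_lt α hVcont hVconv hVaff
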